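/- **Setting.** A symmetric surface $(\Sigma,\sigma)$ is a closed connected oriented, possibly nodal, surface with an orientation-reversing involution: $\Sigma$ is obtained from a closed oriented smooth surface $\widetilde\Sigma$ (possibly disconnected) by identifying the two points in each of finitely many disjoint pairs of distinct points, and $\sigma$ is induced by a smooth orientation-reversing involution of $\widetilde\Sigma$ preserving this set of pairs. Let $\Sigma^\sigma$ be the fixed locus. A rank 1 real bundle pair $(L,\widetilde\phi)$ over $(\Sigma,\sigma)$ is a complex line bundle $L\to\Sigma$ with a continuous involution $\widetilde\phi$ of $L$ covering $\sigma$ and anti-linear on the fibers; its fixed locus $L^{\widetilde\phi}$ is a real line bundle over $\Sigma^\sigma$. We consider isomorphisms of real bundle pairs $$\Psi:\big(L^{\otimes2}\oplus 2L^*,\widetilde\phi^{\otimes 2}\oplus2\widetilde\phi^*\big)\cong\big(\Sigma\times\mathbb C^3,\sigma\times\mathfrak c\big)\qquad(*)$$ where $\mathfrak c$ is the standard conjugation, up to homotopy through such isomorphisms. For a nonzero $v\in L_x$ let $v^*\in L_x^*$ be the dual vector, $v^*(v)=1$. Say that $\Psi$ has canonical determinant if the induced isomorphism $\Lambda^3_{\mathbb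 C}\Psi$ is homotopic, through isomorphisms of real bundle pairs, to the canonical one $\Lambda^3_{\mathbb C}(L^{\otimes2}\oplus2L^*)=L^{\otimes2}\otimes L^*\otimes L^*=\Sigma\times\mathbb C$, which sends $(v\otimes v)\wedge(v^*,0)\wedge(0,v^*)$ to $1$. **Corollary.** Let $(L,\widetilde\phi)$ be a rank 1 real bundle pair over a symmetric surface $(\Sigma,\sigma)$. (1) If $L^{\widetilde\phi}\to\Sigma^\sigma$ is orientable, there is a canonical homotopy class of isomorphisms $(*)$: the isomorphisms $\Psi$ that have canonical determinant and whose restriction to the real parts over $\Sigma^\sigma$ is homotopic to the trivialization of $(L^{\widetilde\phi})^{\otimes2}\oplus 2(L^{\widetilde\phi})^*$ by the frame $s\otimes s,\ (s^*,0),\ (0,s^*)$ for some nowhere zero section $s$ of $L^{\widetilde\phi}$ exist and form exactly one homotopy class. (2) In general, the class is determined by a choice of orientation of each loop in $\Sigma^\sigma$ over which $L^{\widetilde\phi}$ is not orientable. Precisely, let $(c_i)$ be loops in $\Sigma^\sigma$ whose classes form a basis of $H_1(\Sigma^\sigma;\mathbb Z)$ (if $\Sigma$ has no nodes, for example the circles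 that are the components of $\Sigma^\sigma$), and choose an orientation of each $c_i$ over which $L^{\widetilde\phi}$ is not orientable. Then the isomorphisms $\Psi$ satisfying the following exist and form exactly one homotopy class: $\Psi$ has canonical determinant, and for each $i$ the restriction of $\Psi$ to the real parts is homotopic along $c_i$ (equivalently, along a loop in $\Sigma^{\sigma}$ freely homotopic to $c_i$) to the trivialization given by - $s\otimes s,\ (s^*,0),\ (0,s^*)$ for some nowhere zero section $s$ of $L^{\widetilde\phi}$ along $c_i$, if $L^{\widetilde\phi}$ is orientable over $c_i$; - $s\otimes s,\ \cos(\pi\theta)(s^*,0)+\sin(\pi\theta)(0,s^*),\ -\sin(\pi\theta)(s^*,0)+\cos(\pi\theta)(0,s^*)$, if it is not, where $\theta\in\mathbb R$ parametrizes $c_i$ with period $1$ in the chosen direction and $s$ is a nowhere zero section of $L^{\widetilde\phi}$ along this parametrization with $s(\theta+1)=-s(\theta)$. If $L^{\widetilde\phi}$ is orientable over $\Sigma^\sigma$, this class is the one in (1). -/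

import Mathlib

open Bundle Topology
open scoped Manifold ContDiff TensorProduct

namespace RealPairs

/-! ## Closed nodal symmetric surfaces -/

/-- The structure of a nodal symmetric surface with normalization `S`, where `S` is a (possibly
disconnected) smooth surface: an oriented atlas, an orientation-reversing smooth involution `inv`,
and an involution `node` that exchanges the two points of each of the finitely many pairs of
distinct points to be identified and fixes all other points.  The involution preserves the set of
these pairs. -/
structure SymmetricSurface (S : Type*) [TopologicalSpace S]
    [ChartedSpace (EuclideanSpace ℝ (Fin 2)) S] where
  /-- The atlas is oriented: all changes of charts have positive Jacobian. -/
  oriented : ∀ e ∈ atlas (EuclideanSpace ℝ (Fin 2)) S, ∀ e' ∈ atlas (EuclideanSpace ℝ (Fin 2)) S,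
    ∀ z ∈ (e.symm.trans e').source, 0 < (fderiv ℝ (e.symm.trans e') z).det
  inv : S → S
  inv_involutive : Function.Involutive inv
  inv_smooth : ContMDiff (𝓡 2) (𝓡 2) ∞ inv
  /-- `inv` reverses the orientation.  The differential at `x` is read in the charts at `x` and
  `inv x`, which belong to the oriented atlas. -/
  inv_reversing : ∀ x : S,
    (fderiv ℝ (writtenInExtChartAt (𝓡 2) (𝓡 2) x inv) (extChartAt (𝓡 2) x x)).det < 0
  node : S → S
  node_involutive : Function.Involutive node
  node_finite : {x | node x ≠ x}.Finite
  inv_node : ∀ x, inv (node x) = node (inv x)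

namespace SymmetricSurface

variable {S : Type*} [TopologicalSpace S] [ChartedSpace (EuclideanSpace ℝ (Fin 2)) S]

/-- Two points of the normalization are identified if they are equal or form a node. -/
def nodeSetoid (X : SymmetricSurface S) : Setoid S where
  r x y := y = x ∨ y = X.node x
  iseqv :=
    { refl := fun x => Or.inl rfl
      symm := by
        rintro x y (rfl | rfl)
        · exact Or.inl rfl
        · exact Or.inr (X.node_involutive x).symm
      trans := by
        rintro x y z (rfl | rfl) (rfl | rfl)
        · exact Or.inl rfl
        · exact Or.inr rfl
        · exact Or.inr rfl
        · exact Or.inl (X.node_involutive x) }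

/-- The nodal surface `Σ`, with the quotient topology. -/
abbrev Carrier (X : SymmetricSurface S) : Type _ := Quotient X.nodeSetoid

/-- The involution `σ` on the nodal surface `Σ`. -/
def conj (X : SymmetricSurface S) : X.Carrier → X.Carrier :=
  Quotient.map X.inv (by
    rintro x y (rfl | rfl)
    · exact Or.inl rfl
    · exact Or.inr (X.inv_node x))

theorem conj_involutive (X : SymmetricSurface S) : Function.Involutive X.conj := by
  intro p
  induction p using Quotient.inductionOn with
  | h x => exact congrArg _ (X.inv_involutive x)

end SymmetricSurface

/-! ## Real bundle pairs of rank 1 -/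

section

variable {B : Type*} [TopologicalSpace B]

/-- A conjugation on the complex line bundle `L → B` lifting the involution `σ`: a continuous
bundle map covering `σ`, anti-linear on the fibers, whose square is the identity.  A complex line
bundle with a conjugation is a rank 1 real bundle pair. -/
structure Conjugation (σ : B → B) (L : B → Type*) [∀ x, AddCommGroup (L x)]
    [∀ x, Module ℂ (L x)] [∀ x, TopologicalSpace (L x)] [TopologicalSpace (TotalSpace ℂ L)] where
  map : ∀ x, L x ≃ₛₗ[starRingEnd ℂ] L (σ x)
  map_map : ∀ x (v : L x),
    (⟨σ (σ x), map (σ x) (map x v)⟩ : TotalSpace ℂ L) = ⟨x, v⟩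
  continuous_map : Continuous
    fun p : TotalSpace ℂ L => (⟨σ p.proj, map p.proj p.snd⟩ : TotalSpace ℂ L)

variable {σ : B → B} {L : B → Type*} [∀ x, AddCommGroup (L x)] [∀ x, Module ℂ (L x)]
  [∀ x, TopologicalSpace (L x)] [TopologicalSpace (TotalSpace ℂ L)]

/-- `v ∈ L_x` lies in the fixed locus of the conjugation (in particular, `σ x = x`). -/
def Conjugation.IsReal (φ : Conjugation σ L) (x : B) (v : L x) : Prop :=
  (⟨σ x, φ.map x v⟩ : TotalSpace ℂ L) = ⟨x, v⟩

/-- The pullback by `f : Y → B` of the real line bundle `L^φ` is orientable: there is a choice `o`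
of a half-line in each of its fibers which is locally spanned by a continuous nowhere zero
section. -/
def Conjugation.RealPartOrientableAlong (φ : Conjugation σ L) {Y : Type*} [TopologicalSpace Y]
    (f : Y → B) : Prop :=
  ∃ o : ∀ y, Module.Ray ℝ (L (f y)), ∀ y₀ : Y, ∃ U ∈ 𝓝 y₀, ∃ s : ∀ y, L (f y),
    ContinuousOn (fun y => (⟨f y, s y⟩ : TotalSpace ℂ L)) U ∧
    ∀ y ∈ U, φ.IsReal (f y) (s y) ∧ ∃ h : s y ≠ 0, o y = rayOfNeZero ℝ (s y) h

/-- A continuous nowhere zero section of the pullback by `f : Y → B` of the real line bundle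
`L^φ`. -/
structure Conjugation.RealFrameAlong (φ : Conjugation σ L) {Y : Type*} [TopologicalSpace Y]
    (f : Y → B) where
  sec : ∀ y, L (f y)
  ne_zero : ∀ y, sec y ≠ 0
  isReal : ∀ y, φ.IsReal (f y) (sec y)
  continuous_sec : Continuous fun y => (⟨f y, sec y⟩ : TotalSpace ℂ L)

/-! ## The real bundle pair `L^{⊗2} ⊕ 2L*` and its isomorphisms with the trivial one -/

/-- The fiber at `x` of `L^{⊗2} ⊕ L* ⊕ L*`. -/
abbrev SumFiber (L : B → Type*) [∀ x, AddCommGroup (L x)] [∀ x, Module ℂ (L x)] (x : B) : Type _ :=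
  (L x ⊗[ℂ] L x) × Module.Dual ℂ (L x) × Module.Dual ℂ (L x)

/-- The anti-linear map induced on dual spaces, `α ↦ conj ∘ α ∘ g⁻¹`. -/
def dualConj {V V' : Type*} [AddCommGroup V] [Module ℂ V] [AddCommGroup V'] [Module ℂ V']
    (g : V ≃ₛₗ[starRingEnd ℂ] V') (α : Module.Dual ℂ V) : Module.Dual ℂ V' where
  toFun w := starRingEnd ℂ (α (g.symm w))
  map_add' := by intros; simp
  map_smul' := by intros; simp [LinearEquiv.map_smulₛₗ]

/-- The conjugation `φ^{⊗2} ⊕ φ* ⊕ φ*`. -/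
noncomputable def Conjugation.sumMap (φ : Conjugation σ L) (x : B) (w : SumFiber L x) :
    SumFiber L (σ x) :=
  (TensorProduct.map (φ.map x).toLinearMap (φ.map x).toLinearMap w.1,
    dualConj (φ.map x) w.2.1, dualConj (φ.map x) w.2.2)

variable [FiberBundle ℂ L] [VectorBundle ℂ ℂ L]

/-- The dual vector `v*` of a nonzero vector `v` of a fiber of `L`, i.e. `v*(v) = 1`. -/
noncomputable def dualVec {x : B} (v : L x) : Module.Dual ℂ (L x) :=
  ((trivializationAt ℂ L x).linearMapAt ℂ x v)⁻¹ • (trivializationAt ℂ L x).linearMapAt ℂ x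

theorem dualVec_self {x : B} {v : L x} (hv : v ≠ 0) : dualVec v v = 1 := by
  have h : (trivializationAt ℂ L x).linearMapAt ℂ x v ≠ 0 := by
    intro h0
    apply hv
    have := (trivializationAt ℂ L x).symmₗ_linearMapAt (R := ℂ)
      (FiberBundle.mem_baseSet_trivializationAt' x) v
    rw [h0, map_zero] at this
    exact this.symm
  simp [dualVec, h]

/-- The frame `v ⊗ v, (v*, 0), (0, v*)` of the fiber of `L^{⊗2} ⊕ L* ⊕ L*` determined by a nonzero
vector `v` of the fiber of `L`. -/
noncomputable def frame {x : B} (v : L x) : Fin 3 → SumFiber L x :=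
  ![(v ⊗ₜ[ℂ] v, 0, 0), (0, dualVec v, 0), (0, 0, dualVec v)]

/-- Continuity of a family of linear maps from the fibers of `L^{⊗2} ⊕ L* ⊕ L*` at `f y` to `ℂ³`:
it is continuous in the local trivializations of this bundle induced by those of `L`, i.e. the
images of the local frames `s ⊗ s, (s*, 0), (0, s*)` are continuous, with `s` the nowhere zero local
section of `L` given by a local trivialization of `L`. -/
def ContinuousFamily {Y : Type*} [TopologicalSpace Y] (f : Y → B)
    (Ψ : ∀ y, SumFiber L (f y) →ₗ[ℂ] (Fin 3 → ℂ)) : Prop :=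
  ∀ (x₀ : B) (i : Fin 3),
    ContinuousOn (fun y => Ψ y (frame ((trivializationAt ℂ L x₀).symm (f y) (1 : ℂ)) i))
      (f ⁻¹' (trivializationAt ℂ L x₀).baseSet)

/-- An isomorphism of real bundle pairs
`(L^{⊗2} ⊕ 2L*, φ^{⊗2} ⊕ 2φ*) ≅ (B × ℂ³, σ × conj)` over `(B, σ)`. -/
structure RealIso (φ : Conjugation σ L) where
  equiv : ∀ x, SumFiber L x ≃ₗ[ℂ] (Fin 3 → ℂ)
  continuous_equiv : ContinuousFamily (fun x => x) fun x => (equiv x).toLinearMap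
  equiv_conj : ∀ x (w : SumFiber L x), equiv (σ x) (φ.sumMap x w) = star (equiv x w)

variable {φ : Conjugation σ L}

/-- Two isomorphisms of real bundle pairs are homotopic through such isomorphisms. -/
def RealIso.Homotopic (Ψ₀ Ψ₁ : RealIso φ) : Prop :=
  ∃ H : unitInterval → RealIso φ, H 0 = Ψ₀ ∧ H 1 = Ψ₁ ∧
    ContinuousFamily (fun p : unitInterval × B => p.2) fun p => ((H p.1).equiv p.2).toLinearMap

/-! ## The canonical homotopy class -/

/-- The matrix of `Ψ` at `x` with respect to the frame `v ⊗ v, (v*, 0), (0, v*)`. -/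
noncomputable def RealIso.matrix (Ψ : RealIso φ) {x : B} (v : L x) : Matrix (Fin 3) (Fin 3) ℂ :=
  Matrix.of fun i j => Ψ.equiv x (frame v j) i

/-- The isomorphism `Λ³(L^{⊗2} ⊕ 2L*) ≅ Λ³ℂ³ = ℂ` of real line bundle pairs induced by `Ψ` is
homotopic to the canonical one, `Λ³(L^{⊗2} ⊕ 2L*) = L^{⊗2} ⊗ L* ⊗ L* = ℂ`.  The latter sends
`(v ⊗ v) ∧ (v*, 0) ∧ (0, v*)` to `1` for every nonzero `v`, so it identifies the former with the
function `det Ψ.matrix v`, and homotopies between them with homotopies of functions `h` with values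
in `ℂ \ {0}` and `h (σ x) = conj (h x)`. -/
def RealIso.HasCanonicalDet (Ψ : RealIso φ) : Prop :=
  ∃ h : C(unitInterval × B, ℂ), (∀ p, h p ≠ 0) ∧ (∀ t x, h (t, σ x) = starRingEnd ℂ (h (t, x))) ∧
    (∀ x, h (0, x) = 1) ∧ ∀ x (v : L x), v ≠ 0 → h (1, x) = (Ψ.matrix v).det

/-- Over the fixed locus, the restriction of `Ψ` to the real parts is homotopic to the isomorphism
given by the frame `s ⊗ s, (s*, 0), (0, s*)` of `(L^φ)^{⊗2} ⊕ 2(L^φ)*`, for some nowhere zero section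
`s` of the real line bundle `L^φ`. -/
def RealIso.IsStandardOnFixedLocus (Ψ : RealIso φ) : Prop :=
  ∃ s : φ.RealFrameAlong (Subtype.val : Function.fixedPoints σ → B),
    ∃ H : C(unitInterval × Function.fixedPoints σ, Matrix (Fin 3) (Fin 3) ℝ),
      (∀ p, (H p).det ≠ 0) ∧ (∀ x, H (0, x) = 1) ∧
        ∀ x, (H (1, x)).map Complex.ofReal = Ψ.matrix (s.sec x)

/-- The canonical isomorphisms in the case of an orientable real part. -/
def RealIso.IsCanonical (Ψ : RealIso φ) : Prop :=
  Ψ.HasCanonicalDet ∧ Ψ.IsStandardOnFixedLocus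

/-- The rotation by the angle `t` in the last two coordinates. -/
noncomputable def rot (t : ℝ) : Matrix (Fin 3) (Fin 3) ℂ :=
  !![1, 0, 0; 0, (Real.cos t : ℂ), -(Real.sin t : ℂ); 0, (Real.sin t : ℂ), (Real.cos t : ℂ)]

/-- The parametrization by `ℝ` of the loop `c` in the fixed locus, with period `1`. -/
noncomputable def loopParam (c : C(Circle, Function.fixedPoints σ)) (θ : ℝ) : B :=
  (c (Circle.exp (2 * Real.pi * θ))).val

/-- Along the loop `c` in the fixed locus, the restriction of `Ψ` to the real parts is homotopic to
the isomorphism given by the frame obtained from `s ⊗ s, (s*, 0), (0, s*)` by rotating the last two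
vectors by the angle `k π θ`, where `s` is a nowhere zero section of `L^φ` along the loop with
`s(θ + 1) = (-1)^k s(θ)`.  The loop may be replaced by a homotopic one. -/
def RealIso.IsStandardAlong (Ψ : RealIso φ) (c : C(Circle, Function.fixedPoints σ)) (k : ℤ) :
    Prop :=
  ∃ c' : C(Circle, Function.fixedPoints σ), c'.Homotopic c ∧
  ∃ s : φ.RealFrameAlong (loopParam c'),
    (∀ θ, (⟨loopParam c' (θ + 1), s.sec (θ + 1)⟩ : TotalSpace ℂ L) =
      ⟨loopParam c' θ, ((-1 : ℂ) ^ k) • s.sec θ⟩) ∧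
    ∃ H : C(unitInterval × ℝ, Matrix (Fin 3) (Fin 3) ℝ),
      (∀ p, (H p).det ≠ 0) ∧ (∀ t θ, H (t, θ + 1) = H (t, θ)) ∧ (∀ θ, H (0, θ) = 1) ∧
        ∀ θ, (H (1, θ)).map Complex.ofReal = Ψ.matrix (s.sec θ) * rot (k * Real.pi * θ)

/-- The real line bundle `L^φ` is orientable over the loop `c`. -/
def Conjugation.OrientableOver (φ : Conjugation σ L) (c : C(Circle, Function.fixedPoints σ)) :
    Prop :=
  φ.RealPartOrientableAlong fun z => (c z).val

/-- The canonical isomorphisms determined by a system of loops `c` in the fixed locus and a choice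
`o` of orientation of each loop `c i` over which `L^φ` is not orientable: `o i = 1` stands for the
orientation by the parametrization and `o i = -1` for the opposite one.  The rotating frame makes a
positive half-turn along the loop in the chosen direction. -/
def RealIso.IsCanonicalFor {ι : Type*} (Ψ : RealIso φ) (c : ι → C(Circle, Function.fixedPoints σ))
    (o : {i : ι // ¬ φ.OrientableOver (c i)} → ℤˣ) : Prop :=
  Ψ.HasCanonicalDet ∧ (∀ i, φ.OrientableOver (c i) → Ψ.IsStandardAlong (c i) 0) ∧
    ∀ i : {i : ι // ¬ φ.OrientableOver (c i)}, Ψ.IsStandardAlong (c i.1) ((o i : ℤˣ) : ℤ)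

end

/-- The self-map `z ↦ z ^ n` of the circle. -/
noncomputable def circlePow (n : ℤ) : C(Circle, Circle) := ⟨fun z => z ^ n, continuous_zpow n⟩

/-- The loops `c i` freely generate the first homology of `Y` over the integers: maps from `Y` to
the circle, which up to homotopy are the elements of `H¹(Y; ℤ) = Hom(H₁(Y; ℤ), ℤ)`, are classified
by their degrees along these loops, and these degrees can be arbitrary.  If `Y` is a disjoint union
of finitely many circles and points, parametrizations of the circles have this property. -/
def IsLoopBasis {Y ι : Type*} [TopologicalSpace Y] (c : ι → C(Circle, Y)) : Prop :=
  (∀ n : ι → ℤ, ∃ f : C(Y, Circle), ∀ i, (f.comp (c i)).Homotopic (circlePow (n i))) ∧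
    ∀ f g : C(Y, Circle), (∀ i, (f.comp (c i)).Homotopic (g.comp (c i))) → f.Homotopic g

end RealPairs

/-! An isomorphism `Ψ` is recorded by its matrices in the frames `v ⊗ v, (v*, 0), (0, v*)`. These
form a function on the nonzero vectors of `L` whose columns are homogeneous of degrees `2, -1, -1`
and which turns the conjugation of `L` into complex conjugation. The degrees sum to zero, so the
determinant is a function on the base. A homotopy is a family of the same kind over `I × Σ`, and
over the fixed locus the quotient of two such families is a function with values in `GL₃(ℝ)`. Three
facts carry the proof.

Reduction to the real part. Given two independent first rows, the third rows with prescribed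
determinant form an affine space, and an invariant Hermitian metric selects one of determinant `1`
(`complRow`). So only the first two rows matter. Dependent pairs of rows have real dimension 8 in
the 12-dimensional space of all pairs, so by general position two compatible rows given on a closed
invariant set extend over a base of dimension at most 3. Equivariance costs nothing: the involution
is free off the fixed locus, so a perturbation on a small piece can be copied to its disjoint
translate (`exists_avoiding`). Over `Σ` this extends every trivialization of determinant `1` of the
real part (`exists_realIso_extension`). Over `I × Σ` it shows that isomorphisms with canonical
determinant are homotopic as soon as their real parts differ by a null-homotopic matrix function
(`RealIso.homotopic_of_null`).

A reference frame on the real part. The fixed locus is a curve, with nodes or isolated points, so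
`L` has a nowhere zero complex section over it. The real and imaginary parts of the section give a
real trivialization of determinant `1` (`coframeMat`), and the ratio of the section to its conjugate
is a circle-valued phase `u`. In a real frame of `L` along a loop, the argument of the section is
half that of `u`. Hence the parity of the degree `k` of `u` decides whether the real part is
orientable along the loop, and the trivialization is homotopic there to the frame making `k`
half-turns (`orientableOver_iff_even`, `isStandardAlong_iff`). Multiplying the section by `g`
multiplies `u` by `g²`, so on a basis of loops the degrees can be prescribed within their parities,
in particular as `0` or as the chosen signs (`exists_isUnitSec_halfTurns`).

Loops in `GL₃(ℝ)`. A matrix function of positive determinant on the curve is, after general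
position, a circle-valued rotation times a null factor (`exists_blk_mul_null`). Squares of rotations
are null (`null_blk_sq`). Therefore nullity can be tested on a basis of loops (`IsLoopBasis.null`).

Together these say that `Ψ` satisfies the required conditions exactly when it has canonical
determinant and its quotient by the reference frame is null, and that such `Ψ` form one homotopy
class (`exists_homotopy_class`). If the real part is orientable, a global real section has phase `1`
and serves for both descriptions at once. -/

namespace RealPairs

set_option linter.unusedSectionVars false

/-! ## Homogeneous functions on a line bundle -/

section HomogeneousFunctions

variable {B : Type*} [TopologicalSpace B] {σ : B → B} {L : B → Type*} [∀ x, AddCommGroup (L x)]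
  [∀ x, Module ℂ (L x)] [∀ x, TopologicalSpace (L x)] [TopologicalSpace (TotalSpace ℂ L)]

/-- Scalar multiplication on the total space. -/
def scale (c : ℂ) (p : TotalSpace ℂ L) : TotalSpace ℂ L := ⟨p.1, c • p.2⟩

@[simp] theorem scale_proj (c : ℂ) (p : TotalSpace ℂ L) : (scale c p).1 = p.1 := rfl

theorem scale_scale (c d : ℂ) (p : TotalSpace ℂ L) : scale c (scale d p) = scale (c * d) p := by
  obtain ⟨x, v⟩ := p
  exact congrArg (TotalSpace.mk x) (smul_smul c d v)

@[simp] theorem scale_one (p : TotalSpace ℂ L) : scale 1 p = p := by simp [scale]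

/-- A conjugation as a map of the total space. -/
def Conjugation.tot (φ : Conjugation σ L) (p : TotalSpace ℂ L) : TotalSpace ℂ L :=
  ⟨σ p.1, φ.map p.1 p.2⟩

@[simp] theorem Conjugation.tot_proj (φ : Conjugation σ L) (p : TotalSpace ℂ L) :
    (φ.tot p).1 = σ p.1 := rfl

theorem Conjugation.tot_tot (φ : Conjugation σ L) (p : TotalSpace ℂ L) : φ.tot (φ.tot p) = p :=
  φ.map_map p.1 p.2

theorem Conjugation.continuous_tot (φ : Conjugation σ L) : Continuous φ.tot := φ.continuous_map

theorem Conjugation.tot_scale (φ : Conjugation σ L) (c : ℂ) (p : TotalSpace ℂ L) :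
    φ.tot (scale c p) = scale (starRingEnd ℂ c) (φ.tot p) := by
  obtain ⟨x, v⟩ := p
  exact congrArg (TotalSpace.mk (σ x)) ((φ.map x).map_smulₛₗ c v)

theorem Conjugation.tot_snd_ne_zero (φ : Conjugation σ L) {p : TotalSpace ℂ L} (hp : p.2 ≠ 0) :
    (φ.tot p).2 ≠ 0 := by
  obtain ⟨x, v⟩ := p
  exact (φ.map x).map_ne_zero_iff.2 hp

theorem scale_snd_ne_zero {c : ℂ} (hc : c ≠ 0) {p : TotalSpace ℂ L} (hp : p.2 ≠ 0) :
    (scale c p).2 ≠ 0 := by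
  obtain ⟨x, v⟩ := p
  exact smul_ne_zero hc hp

variable [FiberBundle ℂ L] [VectorBundle ℂ ℂ L]

/-- The nowhere zero section over the domain of the local trivialization at `a`. -/
noncomputable def locSec (L : B → Type*) [∀ x, AddCommGroup (L x)]
    [∀ x, Module ℂ (L x)] [∀ x, TopologicalSpace (L x)] [TopologicalSpace (TotalSpace ℂ L)]
    [FiberBundle ℂ L] (a x : B) : TotalSpace ℂ L :=
  ⟨x, (trivializationAt ℂ L a).symm x (1 : ℂ)⟩

/-- The fiber coordinate of the local trivialization at `a`. -/
noncomputable def coord (a : B) (p : TotalSpace ℂ L) : ℂ :=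
  (trivializationAt ℂ L a).linearMapAt ℂ p.1 p.2

@[simp] theorem locSec_proj (a x : B) : (locSec L a x).1 = x := rfl

theorem coord_scale (a : B) (c : ℂ) (p : TotalSpace ℂ L) :
    coord a (scale c p) = c * coord a p := by
  obtain ⟨x, v⟩ := p
  exact ((trivializationAt ℂ L a).linearMapAt ℂ x).map_smul c v

theorem coord_locSec {a x : B} (hx : x ∈ (trivializationAt ℂ L a).baseSet) :
    coord a (locSec L a x) = 1 := by
  simp only [coord, locSec]
  exact (trivializationAt ℂ L a).linearMapAt_symm (R := ℂ) hx 1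

theorem scale_coord_locSec {a : B} {p : TotalSpace ℂ L}
    (hp : p.1 ∈ (trivializationAt ℂ L a).baseSet) : scale (coord a p) (locSec L a p.1) = p := by
  obtain ⟨x, v⟩ := p
  simp only [scale, locSec, coord]
  congr 1
  have h := (trivializationAt ℂ L a).symm_linearMapAt (R := ℂ) hp v
  have h2 : (trivializationAt ℂ L a).symmₗ ℂ x
      ((trivializationAt ℂ L a).linearMapAt ℂ x v • (1 : ℂ)) = v := by
    rw [smul_eq_mul, mul_one]
    exact (trivializationAt ℂ L a).symmₗ_linearMapAt (R := ℂ) hp v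
  rw [map_smul, Trivialization.symmₗ_apply _ hp] at h2
  exact h2

theorem coord_ne_zero {a : B} {p : TotalSpace ℂ L}
    (hp : p.1 ∈ (trivializationAt ℂ L a).baseSet) (h0 : p.2 ≠ 0) : coord a p ≠ 0 := by
  intro h
  have := scale_coord_locSec hp
  rw [h] at this
  apply h0
  rw [← this]
  exact zero_smul ℂ (locSec L a p.1).2

theorem locSec_snd_ne_zero {a x : B} (hx : x ∈ (trivializationAt ℂ L a).baseSet) :
    (locSec L a x).2 ≠ 0 := by
  intro h
  have h1 : coord a (locSec L a x) = 0 := by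
    rw [coord, h]
    exact map_zero ((trivializationAt ℂ L a).linearMapAt ℂ x)
  exact one_ne_zero ((coord_locSec hx).symm.trans h1)

theorem continuousOn_coord (a : B) :
    ContinuousOn (coord (L := L) a) {p | p.1 ∈ (trivializationAt ℂ L a).baseSet} := by
  have h : ContinuousOn (fun p : TotalSpace ℂ L => ((trivializationAt ℂ L a) p).2)
      {p | p.1 ∈ (trivializationAt ℂ L a).baseSet} := by
    refine continuous_snd.comp_continuousOn ((trivializationAt ℂ L a).continuousOn.mono ?_)
    intro p hp
    exact (trivializationAt ℂ L a).mem_source.2 hp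
  refine h.congr fun p hp => ?_
  simp only [coord]
  rw [Trivialization.coe_linearMapAt_of_mem _ hp]

theorem continuousOn_locSec (a : B) :
    ContinuousOn (locSec L a) (trivializationAt ℂ L a).baseSet := by
  have h := (trivializationAt ℂ L a).continuousOn_symm.comp
    (Continuous.continuousOn (s := (trivializationAt ℂ L a).baseSet)
      (f := fun x : B => ((x, (1 : ℂ)) : B × ℂ)) (by fun_prop)) (fun x hx => ⟨hx, trivial⟩)
  exact h

theorem continuous_scale {Z : Type*} [TopologicalSpace Z] {c : Z → ℂ} {q : Z → TotalSpace ℂ L}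
    {s : Set Z} (hc : ContinuousOn c s) (hq : ContinuousOn q s) :
    ContinuousOn (fun z => scale (c z) (q z)) s := by
  intro z hz
  let e := trivializationAt ℂ L (q z).1
  have hzb : (q z).1 ∈ e.baseSet := FiberBundle.mem_baseSet_trivializationAt' _
  have hproj : ContinuousOn (fun z => (q z).1) s :=
    (FiberBundle.continuous_proj ℂ L).comp_continuousOn hq
  have hev : ∀ᶠ y in 𝓝[s] z, (q y).1 ∈ e.baseSet :=
    (hproj z hz).eventually (e.open_baseSet.mem_nhds hzb)
  rw [FiberBundle.continuousWithinAt_totalSpace]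
  refine ⟨hproj z hz, ?_⟩
  have h2 := ((FiberBundle.continuousWithinAt_totalSpace ℂ q).1 (hq z hz)).2
  refine ((hc z hz).mul h2).congr_of_eventuallyEq ?_ ?_
  · filter_upwards [hev] with y hy
    have := e.coe_linearMapAt_of_mem (R := ℂ) hy
    have h3 := congrFun this
    simp only [scale]
    change (e ⟨(q y).1, c y • (q y).2⟩).2 = c y * (e ⟨(q y).1, (q y).2⟩).2
    rw [← h3, ← h3, map_smul, smul_eq_mul]
  · have := e.coe_linearMapAt_of_mem (R := ℂ) hzb
    have h3 := congrFun this
    simp only [scale]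
    change (e ⟨(q z).1, c z • (q z).2⟩).2 = c z * (e ⟨(q z).1, (q z).2⟩).2
    rw [← h3, ← h3, map_smul, smul_eq_mul]

/-- Two nonzero vectors of the same fiber are proportional. -/
theorem exists_scale_eq {p q : TotalSpace ℂ L} (h : p.1 = q.1) (hp : p.2 ≠ 0) (hq : q.2 ≠ 0) :
    ∃ c : ℂ, c ≠ 0 ∧ q = scale c p := by
  have hpb : p.1 ∈ (trivializationAt ℂ L p.1).baseSet := FiberBundle.mem_baseSet_trivializationAt' _
  have hqb : q.1 ∈ (trivializationAt ℂ L p.1).baseSet := h ▸ hpb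
  refine ⟨coord p.1 q * (coord p.1 p)⁻¹,
    mul_ne_zero (coord_ne_zero hqb hq) (inv_ne_zero (coord_ne_zero hpb hp)), ?_⟩
  have h1 := scale_coord_locSec hqb
  rw [← h] at h1
  have h2 : locSec L p.1 p.1 = scale (coord p.1 p)⁻¹ p := by
    conv_rhs => arg 2; rw [← scale_coord_locSec hpb]
    rw [scale_scale, inv_mul_cancel₀ (coord_ne_zero hpb hp), scale_one]
  rw [← scale_scale, ← h2, h1]

variable {T : Type*} [TopologicalSpace T] {κ : Type*}

/-- A continuous family over the subset `A` of the base `T`, along the map `f` to `B`, of functions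
on the nonzero vectors of the line bundle, whose components are homogeneous of degrees `w`. -/
structure IsSec (f : T → B) (w : κ → ℤ) (A : Set T) (r : T → TotalSpace ℂ L → κ → ℂ) : Prop where
  hom : ∀ t ∈ A, ∀ p : TotalSpace ℂ L, p.1 = f t → p.2 ≠ 0 → ∀ c : ℂ, c ≠ 0 → ∀ k,
    r t (scale c p) k = c ^ w k * r t p k
  cont : ∀ a, ContinuousOn (fun t => r t (locSec L a (f t)))
    (A ∩ f ⁻¹' (trivializationAt ℂ L a).baseSet)

/-- Compatibility of a family of functions with the conjugation and the involution `τ` of the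
base. -/
def IsRealSec (φ : Conjugation σ L) (f : T → B) (τ : T → T) (A : Set T)
    (r : T → TotalSpace ℂ L → κ → ℂ) : Prop :=
  ∀ t ∈ A, ∀ p : TotalSpace ℂ L, p.1 = f t → p.2 ≠ 0 → ∀ k,
    r (τ t) (φ.tot p) k = starRingEnd ℂ (r t p k)

variable {f : T → B} {w : κ → ℤ} {A : Set T} {r : T → TotalSpace ℂ L → κ → ℂ}

theorem IsSec.mono {A' : Set T} (h : IsSec f w A r) (hA : A' ⊆ A) : IsSec f w A' r :=
  ⟨fun t ht => h.hom t (hA ht), fun a => (h.cont a).mono (Set.inter_subset_inter_left _ hA)⟩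

theorem IsSec.congr {r' : T → TotalSpace ℂ L → κ → ℂ} (h : IsSec f w A r)
    (hr : ∀ t ∈ A, ∀ p : TotalSpace ℂ L, p.1 = f t → p.2 ≠ 0 → r' t p = r t p) :
    IsSec f w A r' := by
  refine ⟨fun t ht p hp hp0 c hc k => ?_, fun a => (h.cont a).congr fun t ht => ?_⟩
  · rw [hr t ht p hp hp0, hr t ht (scale c p) hp (scale_snd_ne_zero hc hp0), h.hom t ht p hp hp0 c hc]
  · exact hr t ht.1 _ rfl (locSec_snd_ne_zero ht.2)

theorem IsSec.eq_coord (h : IsSec f w A r) {t : T} (ht : t ∈ A) {p : TotalSpace ℂ L}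
    (hp : p.1 = f t) (hp0 : p.2 ≠ 0) {a : B}
    (ha : f t ∈ (trivializationAt ℂ L a).baseSet) (k : κ) :
    r t p k = coord a p ^ w k * r t (locSec L a (f t)) k := by
  have hpa : p.1 ∈ (trivializationAt ℂ L a).baseSet := hp ▸ ha
  conv_lhs => rw [← scale_coord_locSec hpa]
  rw [hp, h.hom t ht _ rfl (locSec_snd_ne_zero ha) _ (coord_ne_zero hpa hp0)]

/-- Continuity is only required along the local sections. Homogeneity expresses the value at any
other vector through its fiber coordinate, a continuous nonzero factor. -/
theorem IsSec.continuousOn_comp (h : IsSec f w A r) {Z : Type*} [TopologicalSpace Z] {Q : Set Z}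
    {s : Z → T} {q : Z → TotalSpace ℂ L} (hs : ContinuousOn s Q) (hq : ContinuousOn q Q)
    (hsA : ∀ z ∈ Q, s z ∈ A) (hqs : ∀ z ∈ Q, (q z).1 = f (s z)) (hq0 : ∀ z ∈ Q, (q z).2 ≠ 0) :
    ContinuousOn (fun z => r (s z) (q z)) Q := by
  intro z hz
  rw [ContinuousWithinAt, tendsto_pi_nhds]
  intro k
  let a := (q z).1
  have hza : (q z).1 ∈ (trivializationAt ℂ L a).baseSet :=
    FiberBundle.mem_baseSet_trivializationAt' _
  have hproj : ContinuousOn (fun z => (q z).1) Q :=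
    (FiberBundle.continuous_proj ℂ L).comp_continuousOn hq
  have hev : ∀ᶠ y in 𝓝[Q] z, (q y).1 ∈ (trivializationAt ℂ L a).baseSet :=
    (hproj z hz).eventually ((trivializationAt ℂ L a).open_baseSet.mem_nhds hza)
  have hkey : ∀ y ∈ Q, (q y).1 ∈ (trivializationAt ℂ L a).baseSet →
      r (s y) (q y) k = coord a (q y) ^ w k * r (s y) (locSec L a (f (s y))) k := fun y hy hya =>
    h.eq_coord (hsA y hy) (hqs y hy) (hq0 y hy) (hqs y hy ▸ hya) k
  have h1 : ContinuousWithinAt (fun y => coord a (q y) ^ w k) Q z := by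
    refine ContinuousWithinAt.zpow₀ ?_ _ (Or.inl (coord_ne_zero hza (hq0 z hz)))
    have : ContinuousAt (coord (L := L) a) (q z) :=
      (continuousOn_coord a).continuousAt
        (((trivializationAt ℂ L a).open_baseSet.preimage
          (FiberBundle.continuous_proj ℂ L)).mem_nhds hza)
    exact this.comp_continuousWithinAt (hq z hz)
  have h2 : ContinuousWithinAt (fun y => r (s y) (locSec L a (f (s y))) k)
      (Q ∩ {y | (q y).1 ∈ (trivializationAt ℂ L a).baseSet}) z := by
    have := (h.cont a (s z) ⟨hsA z hz, Set.mem_preimage.2 (hqs z hz ▸ hza)⟩)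
    have h3 := this.comp (t := A ∩ f ⁻¹' (trivializationAt ℂ L a).baseSet)
      (f := s) (s := Q ∩ {y | (q y).1 ∈ (trivializationAt ℂ L a).baseSet}) (x := z)
      ((hs z hz).mono Set.inter_subset_left)
      (fun y hy => ⟨hsA y hy.1, Set.mem_preimage.2 (hqs y hy.1 ▸ hy.2)⟩)
    exact (continuous_apply k).continuousAt.comp_continuousWithinAt h3
  have h2' : ContinuousWithinAt (fun y => r (s y) (locSec L a (f (s y))) k) Q z :=
    h2.mono_of_mem_nhdsWithin (Filter.inter_mem self_mem_nhdsWithin hev)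
  have h3 : ContinuousWithinAt (fun y => r (s y) (q y) k) Q z := by
    refine (h1.mul h2').congr_of_eventuallyEq ?_ (hkey z hz hza)
    filter_upwards [hev, self_mem_nhdsWithin] with y hy hyQ using hkey y hyQ hy
  exact h3

/-- Testing along arbitrary continuous choices of vectors avoids fixing a trivialization. This
matters for families built with the conjugation, which does not preserve the local sections. -/
theorem IsSec.of_continuousOn
    (hom : ∀ t ∈ A, ∀ p : TotalSpace ℂ L, p.1 = f t → p.2 ≠ 0 → ∀ c : ℂ, c ≠ 0 → ∀ k,
      r t (scale c p) k = c ^ w k * r t p k)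
    (hf : Continuous f)
    (h : ∀ (Q : Set T) (q : T → TotalSpace ℂ L), Q ⊆ A → ContinuousOn q Q →
      (∀ z ∈ Q, (q z).1 = f z) → (∀ z ∈ Q, (q z).2 ≠ 0) → ContinuousOn (fun z => r z (q z)) Q) :
    IsSec f w A r :=
  ⟨hom, fun a => h _ _ Set.inter_subset_left ((continuousOn_locSec a).comp hf.continuousOn
    fun _ ht => ht.2) (fun _ _ => rfl) fun _ ht => locSec_snd_ne_zero ht.2⟩

end HomogeneousFunctions

/-! ### Extension of compatible families and invariant metrics -/

section Extension

variable {B : Type*} [TopologicalSpace B] {σ : B → B} {L : B → Type*} [∀ x, AddCommGroup (L x)]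
  [∀ x, Module ℂ (L x)] [∀ x, TopologicalSpace (L x)] [TopologicalSpace (TotalSpace ℂ L)]
  [FiberBundle ℂ L] [VectorBundle ℂ ℂ L]
  {T : Type*} [TopologicalSpace T] {κ : Type*} {f : T → B} {w : κ → ℤ} {A : Set T}
  {r r' : T → TotalSpace ℂ L → κ → ℂ}

variable (L) in
theorem exists_finite_partition [CompactSpace T] [T2Space T] (hf : Continuous f) :
    ∃ (n : Finset B) (χ : B → C(T, ℝ)), (∀ a t, 0 ≤ χ a t) ∧ (∀ t, ∑ a ∈ n, χ a t = 1) ∧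
      ∀ a ∈ n, tsupport (χ a) ⊆ f ⁻¹' (trivializationAt ℂ L a).baseSet := by
  classical
  obtain ⟨n, hn⟩ := isCompact_univ.elim_finite_subcover
    (fun a => f ⁻¹' (trivializationAt ℂ L a).baseSet)
    (fun a => (trivializationAt ℂ L a).open_baseSet.preimage hf)
    (fun t _ => Set.mem_iUnion.2 ⟨f t, FiberBundle.mem_baseSet_trivializationAt' _⟩)
  obtain ⟨ρ, hρ⟩ := PartitionOfUnity.exists_isSubordinate_of_locallyFinite isClosed_univ
    (fun a : n => f ⁻¹' (trivializationAt ℂ L a.1).baseSet)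
    (fun a => (trivializationAt ℂ L a.1).open_baseSet.preimage hf)
    (locallyFinite_of_finite _) (by
      intro t ht
      obtain ⟨a, ha, hta⟩ := Set.mem_iUnion₂.1 (hn ht)
      exact Set.mem_iUnion.2 ⟨⟨a, ha⟩, hta⟩)
  refine ⟨n, fun a => if h : a ∈ n then ρ ⟨a, h⟩ else 0, fun a t => ?_, fun t => ?_,
    fun a ha => ?_⟩
  · by_cases h : a ∈ n
    · simpa [h] using ρ.nonneg _ t
    · simp [h]
  · have := ρ.sum_eq_one (Set.mem_univ t)
    rw [finsum_eq_sum_of_fintype] at this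
    rw [← Finset.sum_coe_sort, ← this]
    exact Finset.sum_congr rfl fun a _ => by simp
  · simpa [ha] using hρ ⟨a, ha⟩

theorem IsSec.add (h : IsSec f w A r) (h' : IsSec f w A r') :
    IsSec f w A fun t p k => r t p k + r' t p k := by
  refine ⟨fun t ht p hp hp0 c hc k => ?_, fun a => (h.cont a).add (h'.cont a)⟩
  rw [h.hom t ht p hp hp0 c hc, h'.hom t ht p hp hp0 c hc, mul_add]

theorem isSec_zero : IsSec f w A (fun _ (_ : TotalSpace ℂ L) (_ : κ) => (0 : ℂ)) :=
  ⟨by simp, fun _ => continuousOn_const⟩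

theorem IsSec.sum {I : Type*} (n : Finset I) {R : I → T → TotalSpace ℂ L → κ → ℂ}
    (h : ∀ a ∈ n, IsSec f w A (R a)) : IsSec f w A fun t p k => ∑ a ∈ n, R a t p k := by
  classical
  induction n using Finset.induction_on with
  | empty => simpa using isSec_zero
  | insert a s ha ih =>
    simp only [Finset.sum_insert ha]
    exact (h a (Finset.mem_insert_self _ _)).add
      (ih fun b hb => h b (Finset.mem_insert_of_mem hb))

theorem IsSec.mul (h : IsSec f w A r) {g : T → κ → ℂ} (hg : ContinuousOn g A) :
    IsSec f w A fun t p k => g t k * r t p k := by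
  refine ⟨fun t ht p hp hp0 c hc k => ?_,
    fun a => (hg.mono Set.inter_subset_left).mul (h.cont a)⟩
  rw [h.hom t ht p hp hp0 c hc]
  ring

/-- The family of functions which, in terms of the local trivialization at `a`, is given by the
function `h` supported in the domain of this trivialization. -/
noncomputable def coordSec (w : κ → ℤ) (a : B) (h : T → κ → ℂ) (t : T) (p : TotalSpace ℂ L)
    (k : κ) : ℂ := h t k * coord a p ^ w k

theorem coordSec_of_notMem {a : B} {h : T → κ → ℂ} {t : T} (ht : t ∉ tsupport h)
    (p : TotalSpace ℂ L) : coordSec w a h t p = 0 := by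
  ext k
  simp [coordSec, image_eq_zero_of_notMem_tsupport ht]

/-- The powers of the coordinate are continuous only over the domain of the trivialization. Off the
support of `h` the product vanishes, so nothing is needed there. -/
theorem isSec_coordSec (hf : Continuous f) {a : B} {h : T → κ → ℂ} (hc : Continuous h)
    (hs : tsupport h ⊆ f ⁻¹' (trivializationAt ℂ L a).baseSet) :
    IsSec f w A (coordSec (L := L) w a h) := by
  refine IsSec.of_continuousOn (fun t _ p _ _ c _ k => ?_) hf fun Q q _ hq hqf hq0 z hz => ?_
  · simp only [coordSec, coord_scale, mul_zpow]
    ring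
  · by_cases hzs : z ∈ tsupport h
    · have hza : (q z).1 ∈ (trivializationAt ℂ L a).baseSet := hqf z hz ▸ hs hzs
      have h1 : ContinuousAt (coord (L := L) a) (q z) := (continuousOn_coord a).continuousAt
        (((trivializationAt ℂ L a).open_baseSet.preimage
          (FiberBundle.continuous_proj ℂ L)).mem_nhds hza)
      rw [ContinuousWithinAt, tendsto_pi_nhds]
      intro k
      have h2 : ContinuousWithinAt (fun y => coord a (q y) ^ w k) Q z :=
        ContinuousWithinAt.zpow₀ (h1.comp_continuousWithinAt (hq z hz)) _
          (Or.inl (coord_ne_zero hza (hq0 z hz)))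
      exact ContinuousWithinAt.mul (f := fun y => h y k)
        ((continuous_apply k).comp hc).continuousWithinAt h2
    · have : ∀ᶠ y in 𝓝[Q] z, y ∉ tsupport h :=
        mem_nhdsWithin_of_mem_nhds ((isClosed_tsupport h).isOpen_compl.mem_nhds hzs)
      refine (continuousWithinAt_const (b := (0 : κ → ℂ))).congr_of_eventuallyEq ?_
        (coordSec_of_notMem hzs _)
      filter_upwards [this] with y hy using coordSec_of_notMem hy _

/-- The conjugate family. -/
noncomputable def conjSec (φ : Conjugation σ L) (τ : T → T) (r : T → TotalSpace ℂ L → κ → ℂ)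
    (t : T) (p : TotalSpace ℂ L) (k : κ) : ℂ := starRingEnd ℂ (r (τ t) (φ.tot p) k)

theorem IsSec.conjSec (h : IsSec f w A r) (φ : Conjugation σ L) {τ : T → T} (hf : Continuous f)
    (hτ : Continuous τ) (hfτ : ∀ t, f (τ t) = σ (f t)) (hA : ∀ t ∈ A, τ t ∈ A) :
    IsSec f w A (conjSec φ τ r) := by
  refine IsSec.of_continuousOn (fun t ht p hp hp0 c hc k => ?_) hf
    fun Q q hQ hq hqf hq0 => ?_
  · simp only [RealPairs.conjSec, φ.tot_scale]
    rw [h.hom (τ t) (hA t ht) (φ.tot p) (by rw [φ.tot_proj, hp, hfτ]) (φ.tot_snd_ne_zero hp0) _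
      (by simpa using hc)]
    simp
  · have := h.continuousOn_comp (Q := Q) (s := τ) (q := fun z => φ.tot (q z)) hτ.continuousOn
      (φ.continuous_tot.comp_continuousOn hq) (fun z hz => hA z (hQ hz))
      (fun z hz => by rw [φ.tot_proj, hqf z hz, hfτ]) (fun z hz => φ.tot_snd_ne_zero (hq0 z hz))
    exact continuousOn_pi.2 fun k => Complex.continuous_conj.comp_continuousOn
      ((continuous_apply k).comp_continuousOn this)

/-- A compatible family given over a closed invariant subset extends. -/
theorem exists_isSec_extension [CompactSpace T] [T2Space T] (φ : Conjugation σ L) {τ : T → T}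
    (hf : Continuous f) (hτ : Continuous τ) (hττ : Function.Involutive τ)
    (hfτ : ∀ t, f (τ t) = σ (f t)) (hAc : IsClosed A) (hA : ∀ t ∈ A, τ t ∈ A)
    (h : IsSec f w A r) (hr : IsRealSec φ f τ A r) :
    ∃ r', IsSec f w Set.univ r' ∧ IsRealSec φ f τ Set.univ r' ∧
      ∀ t ∈ A, ∀ p : TotalSpace ℂ L, p.1 = f t → p.2 ≠ 0 → r' t p = r t p := by
  obtain ⟨n, χ, hχ0, hχ1, hχs⟩ := exists_finite_partition L hf
  -- Tietze extension in each trivialization. Agreement with `r` is needed only on the support of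
  -- the corresponding function of the partition of unity.
  have hext : ∀ a, ∃ g : C(T, κ → ℂ), a ∈ n → ∀ t ∈ A, t ∈ tsupport (χ a) →
      g t = r t (locSec L a (f t)) := by
    intro a
    by_cases ha : a ∈ n
    · obtain ⟨g, hg⟩ := ContinuousMap.exists_restrict_eq
        (hAc.inter (isClosed_tsupport (χ a)))
        ⟨fun t : ↥(A ∩ tsupport (χ a)) => r t (locSec L a (f t)), continuousOn_iff_continuous_domRestrict.1
          ((h.cont a).mono (Set.inter_subset_inter_right _ (hχs a ha)))⟩
      exact ⟨g, fun _ t ht hta => congrArg (fun F => F ⟨t, ht, hta⟩) hg⟩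
    · exact ⟨0, fun h => absurd h ha⟩
  choose g hg using hext
  let R : T → TotalSpace ℂ L → κ → ℂ := fun t p k =>
    ∑ a ∈ n, coordSec w a (fun t k => (χ a t : ℂ) * g a t k) t p k
  have hR : IsSec f w Set.univ R := by
    refine IsSec.sum n fun a ha => isSec_coordSec hf ?_ ?_
    · exact continuous_pi fun k => (Complex.continuous_ofReal.comp (χ a).continuous).mul
        ((continuous_apply k).comp (g a).continuous)
    · refine (closure_mono fun t ht => ?_).trans (hχs a ha)
      intro h0
      apply ht
      ext k
      simp [h0]
  have hRA : ∀ t ∈ A, ∀ p : TotalSpace ℂ L, p.1 = f t → p.2 ≠ 0 → ∀ k, R t p k = r t p k := by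
    intro t ht p hp hp0 k
    have : ∀ a ∈ n, coordSec w a (fun t k => (χ a t : ℂ) * g a t k) t p k
        = (χ a t : ℂ) * r t p k := by
      intro a ha
      by_cases hta : t ∈ tsupport (χ a)
      · rw [h.eq_coord ht hp hp0 (hχs a ha hta), coordSec, hg a ha t ht hta]
        ring
      · simp [coordSec, image_eq_zero_of_notMem_tsupport hta]
    simp only [R]
    rw [Finset.sum_congr rfl this, ← Finset.sum_mul, ← Complex.ofReal_sum, hχ1]
    simp
  -- Averaging with the conjugate family enforces compatibility. Over `A` it changes nothing, since
  -- there `r` equals its own conjugate.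
  have hC := hR.conjSec φ hf hτ hfτ fun _ _ => trivial
  refine ⟨fun t p k => (1 / 2 : ℂ) * (R t p k + conjSec φ τ R t p k),
    (hR.add hC).mul (g := fun _ _ => 1 / 2) continuousOn_const, fun t _ p hp hp0 k => ?_,
    fun t ht p hp hp0 => ?_⟩
  · simp only [conjSec, hττ t, φ.tot_tot, map_mul, map_add, Complex.conj_conj]
    have h2 : (starRingEnd ℂ) (1 / 2 : ℂ) = 1 / 2 := by
      rw [map_div₀, map_one, Complex.conj_ofNat]
    rw [h2, add_comm]
  · ext k
    simp only [conjSec]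
    rw [hRA t ht p hp hp0, hRA (τ t) (hA t ht) (φ.tot p) (by rw [φ.tot_proj, hp, hfτ])
      (φ.tot_snd_ne_zero hp0), hr t ht p hp hp0, Complex.conj_conj]
    ring

/-- An invariant Hermitian metric. -/
theorem exists_metric [CompactSpace B] [T2Space B] (φ : Conjugation σ L) :
    ∃ ν : TotalSpace ℂ L → ℝ, Continuous ν ∧ (∀ p, p.2 ≠ 0 → 0 < ν p) ∧
      (∀ c p, ν (scale c p) = ‖c‖ ^ 2 * ν p) ∧ ∀ p, ν (φ.tot p) = ν p := by
  obtain ⟨n, χ, hχ0, hχ1, hχs⟩ := exists_finite_partition L (T := B) continuous_id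
  let μ : TotalSpace ℂ L → ℝ := fun p => ∑ a ∈ n, χ a p.1 * ‖coord a p‖ ^ 2
  have hproj := FiberBundle.continuous_proj ℂ L
  have hμ : Continuous μ := by
    refine continuous_finsetSum _ fun a ha => continuous_iff_continuousAt.2 fun p => ?_
    by_cases hp : p.1 ∈ tsupport (χ a)
    · have h1 : ContinuousAt (coord (L := L) a) p := (continuousOn_coord a).continuousAt
        (((trivializationAt ℂ L a).open_baseSet.preimage hproj).mem_nhds (hχs a ha hp))
      exact ((χ a).continuous.comp hproj).continuousAt.mul (h1.norm.pow 2)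
    · have : ∀ᶠ q : TotalSpace ℂ L in 𝓝 p, q.1 ∉ tsupport (χ a) :=
        ((isClosed_tsupport (χ a)).isOpen_compl.preimage hproj).mem_nhds hp
      refine (continuousAt_const (y := (0 : ℝ))).congr ?_
      filter_upwards [this] with q hq
      simp [image_eq_zero_of_notMem_tsupport hq]
  have hpos : ∀ p, p.2 ≠ 0 → 0 < μ p := by
    intro p hp
    refine Finset.sum_pos' (fun a _ => mul_nonneg (hχ0 a _) (by positivity)) ?_
    by_contra! hcon
    have h0 : ∀ a ∈ n, χ a p.1 = 0 := by
      intro a ha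
      by_contra hne
      have hp' := hχs a ha (subset_tsupport _ hne)
      have h1 := norm_pos_iff.2 (coord_ne_zero hp' hp)
      have h2 : 0 < χ a p.1 := lt_of_le_of_ne (hχ0 a _) (Ne.symm hne)
      exact absurd (hcon a ha) (not_le.2 (by positivity))
    have := hχ1 p.1
    rw [Finset.sum_eq_zero h0] at this
    exact zero_ne_one this
  have hsc : ∀ c p, μ (scale c p) = ‖c‖ ^ 2 * μ p := by
    intro c p
    simp only [μ, Finset.mul_sum, coord_scale, norm_mul, scale_proj]
    exact Finset.sum_congr rfl fun a _ => by ring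
  refine ⟨fun p => μ p + μ (φ.tot p), hμ.add (hμ.comp φ.continuous_tot), fun p hp =>
    add_pos (hpos p hp) (hpos _ (φ.tot_snd_ne_zero hp)), fun c p => ?_, fun p => ?_⟩
  · simp only [φ.tot_scale, hsc, RCLike.norm_conj]
    ring
  · simp only [φ.tot_tot]
    ring

end Extension

/-! ### General position by Hausdorff dimension -/

section GeneralPosition

variable {E : Type*} [NormedAddCommGroup E] [NormedSpace ℝ E] [FiniteDimensional ℝ E]
  {V : Type*} [NormedAddCommGroup V] [NormedSpace ℝ V]

/-- Almost all translates of a `C^1` map from `E` avoid the subset `Z`. -/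
def Avoidable (E : Type*) [NormedAddCommGroup E] [NormedSpace ℝ E] (Z : Set V) : Prop :=
  ∀ g : E → V, ContDiff ℝ 1 g → Dense {v | ∀ x, g x + v ∉ Z}

/-- A translation `v` is bad only if it is a difference `q y - g x`. By the dimension count the bad
translations have Hausdorff dimension below that of `V`, so their complement is dense. Two
parametrizations are allowed because dependent pairs of rows need two. -/
theorem avoidable_of_subset_range [FiniteDimensional ℝ V] {F₁ F₂ : Type*}
    [NormedAddCommGroup F₁] [NormedSpace ℝ F₁] [FiniteDimensional ℝ F₁]
    [NormedAddCommGroup F₂] [NormedSpace ℝ F₂] [FiniteDimensional ℝ F₂] {Z : Set V}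
    {q₁ : F₁ → V} {q₂ : F₂ → V} (h₁ : ContDiff ℝ 1 q₁) (h₂ : ContDiff ℝ 1 q₂)
    (hZ : Z ⊆ Set.range q₁ ∪ Set.range q₂)
    (d₁ : Module.finrank ℝ E + Module.finrank ℝ F₁ < Module.finrank ℝ V)
    (d₂ : Module.finrank ℝ E + Module.finrank ℝ F₂ < Module.finrank ℝ V) : Avoidable E Z := by
  intro g hg
  have c₁ : ContDiff ℝ 1 fun y : E × F₁ => q₁ y.2 - g y.1 :=
    (h₁.comp contDiff_snd).sub (hg.comp contDiff_fst)
  have c₂ : ContDiff ℝ 1 fun y : E × F₂ => q₂ y.2 - g y.1 :=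
    (h₂.comp contDiff_snd).sub (hg.comp contDiff_fst)
  have hd : dimH (Set.range (fun y : E × F₁ => q₁ y.2 - g y.1) ∪
      Set.range fun y : E × F₂ => q₂ y.2 - g y.1) < Module.finrank ℝ V := by
    rw [dimH_union, max_lt_iff]
    refine ⟨c₁.dimH_range_le.trans_lt ?_, c₂.dimH_range_le.trans_lt ?_⟩
    · rw [Module.finrank_prod]; exact_mod_cast d₁
    · rw [Module.finrank_prod]; exact_mod_cast d₂
  refine (dense_compl_of_dimH_lt_finrank hd).mono fun v hv x hx => Set.notMem_of_mem_compl hv ?_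
  rcases hZ hx with ⟨y, hy⟩ | ⟨y, hy⟩
  · exact Or.inl ⟨(x, y), by simp [hy]⟩
  · exact Or.inr ⟨(x, y), by simp [hy]⟩

variable {K : Type*} [TopologicalSpace K] [CompactSpace K]

/-- Stone–Weierstrass: the functions factoring through `j` by a `C^1` function form a subalgebra,
and linear functionals on `E` already separate points because `j` is injective. -/
theorem exists_contDiff_near {j : K → E} (hj : Continuous j) (hi : Function.Injective j)
    (h : C(K, ℝ)) {ε : ℝ} (hε : 0 < ε) :
    ∃ g : E → ℝ, ContDiff ℝ 1 g ∧ ∀ t, ‖g (j t) - h t‖ < ε := by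
  let 𝓐 : Subalgebra ℝ C(K, ℝ) :=
    { carrier := {F | ∃ g : E → ℝ, ContDiff ℝ 1 g ∧ ∀ t, F t = g (j t)}
      mul_mem' := by
        rintro F G ⟨g, hg, h1⟩ ⟨g', hg', h2⟩
        exact ⟨fun x => g x * g' x, hg.mul hg', fun t => by simp [h1, h2]⟩
      add_mem' := by
        rintro F G ⟨g, hg, h1⟩ ⟨g', hg', h2⟩
        exact ⟨fun x => g x + g' x, hg.add hg', fun t => by simp [h1, h2]⟩
      algebraMap_mem' := fun c => ⟨fun _ => c, contDiff_const, fun t => rfl⟩ }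
  have hsep : 𝓐.SeparatesPoints := by
    intro x y hxy
    obtain ⟨l, hl⟩ := SeparatingDual.exists_separating_of_ne (R := ℝ) (hi.ne hxy)
    exact ⟨fun t => l (j t), ⟨⟨fun t => l (j t), l.continuous.comp hj⟩,
      ⟨l, l.contDiff, fun t => rfl⟩, rfl⟩, hl⟩
  obtain ⟨⟨F, g, hg, hF⟩, hFh⟩ := ContinuousMap.exists_mem_subalgebra_near_continuousMap_of_separatesPoints
    𝓐 hsep h ε hε
  refine ⟨g, hg, fun t => ?_⟩
  rw [← hF t]
  exact (ContinuousMap.norm_coe_le_norm (F - h) t).trans_lt hFh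

/-- Half of `ε` is spent on replacing `h` by a `C^1` function of the embedding, with `ε / 4` for
each of the real and imaginary parts. The other half is left for the translation that avoids `Z`. -/
theorem exists_near_avoiding {κ : Type*} [Fintype κ] {j : K → E} (hj : Continuous j)
    (hi : Function.Injective j) {Z : Set (κ → ℂ)} (hZ : Avoidable E Z) {h : K → κ → ℂ}
    (hh : Continuous h) {ε : ℝ} (hε : 0 < ε) :
    ∃ η : K → κ → ℂ, Continuous η ∧ (∀ t, ‖η t - h t‖ < ε) ∧ ∀ t, η t ∉ Z := by
  have hre : ∀ k, ∃ g : E → ℝ, ContDiff ℝ 1 g ∧ ∀ t, ‖g (j t) - (h t k).re‖ < ε / 4 := fun k =>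
    exists_contDiff_near hj hi ⟨fun t => (h t k).re,
      Complex.continuous_re.comp ((continuous_apply k).comp hh)⟩ (by positivity)
  have him : ∀ k, ∃ g : E → ℝ, ContDiff ℝ 1 g ∧ ∀ t, ‖g (j t) - (h t k).im‖ < ε / 4 := fun k =>
    exists_contDiff_near hj hi ⟨fun t => (h t k).im,
      Complex.continuous_im.comp ((continuous_apply k).comp hh)⟩ (by positivity)
  choose a ha ha' using hre
  choose b hb hb' using him
  let g : E → κ → ℂ := fun x k => (a k x : ℂ) + (b k x : ℂ) * Complex.I
  have hg : ContDiff ℝ 1 g := contDiff_pi.2 fun k =>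
    (Complex.ofRealCLM.contDiff.comp (ha k)).add
      ((Complex.ofRealCLM.contDiff.comp (hb k)).mul contDiff_const)
  have hgh : ∀ t, ‖g (j t) - h t‖ ≤ ε / 2 := by
    intro t
    refine (pi_norm_le_iff_of_nonneg (by positivity)).2 fun k => ?_
    have : (g (j t) - h t) k = ((a k (j t) - (h t k).re : ℝ) : ℂ) +
        ((b k (j t) - (h t k).im : ℝ) : ℂ) * Complex.I := by
      apply Complex.ext <;> simp [g]
    rw [this]
    refine (norm_add_le _ _).trans ?_
    rw [norm_mul, Complex.norm_I, mul_one, Complex.norm_real, Complex.norm_real]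
    linarith [ha' k t, hb' k t]
  obtain ⟨v, hv, hvn⟩ := (hZ g hg).exists_dist_lt 0 (half_pos hε)
  refine ⟨fun t => g (j t) + v, (hg.continuous.comp hj).add continuous_const, fun t => ?_,
    fun t => hv (j t)⟩
  rw [dist_comm, dist_zero_right] at hvn
  calc ‖g (j t) + v - h t‖ = ‖(g (j t) - h t) + v‖ := by congr 1; abel
    _ ≤ ‖g (j t) - h t‖ + ‖v‖ := norm_add_le _ _
    _ < ε := by linarith [hgh t]

end GeneralPosition

/-! ### Equivariant perturbation, one small piece at a time -/

section Perturbation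

variable {B : Type*} [TopologicalSpace B] {σ : B → B} {L : B → Type*} [∀ x, AddCommGroup (L x)]
  [∀ x, Module ℂ (L x)] [∀ x, TopologicalSpace (L x)] [TopologicalSpace (TotalSpace ℂ L)]
  [FiberBundle ℂ L] [VectorBundle ℂ ℂ L]
  {T : Type*} [TopologicalSpace T] {κ : Type*} {f : T → B} {w : κ → ℤ} {A : Set T} {τ : T → T}
  {r : T → TotalSpace ℂ L → κ → ℂ} {Z : Set (κ → ℂ)}
  {E : Type*} [NormedAddCommGroup E] [NormedSpace ℝ E] [FiniteDimensional ℝ E]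

/-- The values of the family at the point `t` are not in `Z`. -/
def AvoidsAt (f : T → B) (r : T → TotalSpace ℂ L → κ → ℂ) (Z : Set (κ → ℂ)) (t : T) : Prop :=
  ∀ p : TotalSpace ℂ L, p.1 = f t → p.2 ≠ 0 → r t p ∉ Z

/-- Invariance of a set of values under the structure group and under conjugation. -/
structure IsInvariant (w : κ → ℤ) (Z : Set (κ → ℂ)) : Prop where
  scale : ∀ c : ℂ, c ≠ 0 → ∀ v ∈ Z, (fun k => c ^ w k * v k) ∈ Z
  conj : ∀ v ∈ Z, (fun k => starRingEnd ℂ (v k)) ∈ Z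

theorem IsSec.avoidsAt_iff (h : IsSec f w A r) (hZ : IsInvariant w Z) {t : T} (ht : t ∈ A) {a : B}
    (ha : f t ∈ (trivializationAt ℂ L a).baseSet) :
    AvoidsAt f r Z t ↔ r t (locSec L a (f t)) ∉ Z := by
  refine ⟨fun h => h _ rfl (locSec_snd_ne_zero ha), fun h0 p hp hp0 hpZ => h0 ?_⟩
  have hc := coord_ne_zero (hp ▸ ha : p.1 ∈ _) hp0
  have := hZ.scale (coord a p)⁻¹ (inv_ne_zero hc) _ hpZ
  convert this using 1
  ext k
  rw [h.eq_coord ht hp hp0 ha, ← mul_assoc, ← mul_zpow, inv_mul_cancel₀ hc, one_zpow, one_mul]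

theorem IsRealSec.avoidsAt {φ : Conjugation σ L} (h : IsRealSec φ f τ Set.univ r)
    (hZ : IsInvariant w Z) (hfτ : ∀ t, f (τ t) = σ (f t)) {t : T} (ht : AvoidsAt f r Z (τ t)) :
    AvoidsAt f r Z t := by
  intro p hp hp0 hpZ
  refine ht (φ.tot p) (by rw [φ.tot_proj, hp, hfτ]) (φ.tot_snd_ne_zero hp0) ?_
  convert hZ.conj _ hpZ using 1
  ext k
  exact h t trivial p hp hp0 k

theorem IsSec.isOpen_avoidsAt (h : IsSec f w Set.univ r) (hf : Continuous f)
    (hZ : IsInvariant w Z) (hZc : IsClosed Z) : IsOpen {t | AvoidsAt f r Z t} := by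
  refine isOpen_iff_mem_nhds.2 fun t ht => ?_
  have ha : f t ∈ (trivializationAt ℂ L (f t)).baseSet := FiberBundle.mem_baseSet_trivializationAt' _
  have ho := (trivializationAt ℂ L (f t)).open_baseSet.preimage hf
  have hc : ContinuousAt (fun s => r s (locSec L (f t) (f s))) t :=
    ((h.cont (f t)).mono fun s hs => ⟨trivial, hs⟩).continuousAt (ho.mem_nhds ha)
  have h1 := hc.eventually (hZc.isOpen_compl.mem_nhds (ht _ rfl (locSec_snd_ne_zero ha)))
  filter_upwards [h1, ho.mem_nhds ha] with s hs hsa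
  exact (h.avoidsAt_iff hZ trivial hsa).2 hs

/-- A compact subset of `T`, over which the bundle is trivialized, which embeds into `E` and is
disjoint from `A` and from its translate. -/
structure IsPiece (L : B → Type*) [∀ x, AddCommGroup (L x)]
    [∀ x, Module ℂ (L x)] [∀ x, TopologicalSpace (L x)] [TopologicalSpace (TotalSpace ℂ L)]
    [FiberBundle ℂ L] (E : Type*) [TopologicalSpace E]
    (f : T → B) (τ : T → T) (A K : Set T) : Prop where
  isCompact : IsCompact K
  disjoint : Disjoint K A
  disjoint_translate : Disjoint K (τ ⁻¹' K)
  trivialized : ∃ a, K ⊆ f ⁻¹' (trivializationAt ℂ L a).baseSet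
  embeds : ∃ j : T → E, ContinuousOn j K ∧ Set.InjOn j K

/-- The family is changed in a trivialization on a neighborhood `O` of `K`, and the conjugate change
is made on the translate of `O`. The two sets are disjoint, so the changes do not interfere. The
change is small enough to keep what was achieved on `K₁`. -/
theorem exists_avoiding_on_piece [Fintype κ] [CompactSpace T] [T2Space T] (φ : Conjugation σ L)
    (hf : Continuous f)
    (hτ : Continuous τ) (hττ : Function.Involutive τ) (hfτ : ∀ t, f (τ t) = σ (f t))
    (hAc : IsClosed A) (hA : ∀ t ∈ A, τ t ∈ A) (hZ : IsInvariant w Z) (hZc : IsClosed Z)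
    (hZE : Avoidable E Z) (h : IsSec f w Set.univ r) (hr : IsRealSec φ f τ Set.univ r)
    {K₁ K : Set T} (hK₁ : IsClosed K₁) (h₁ : ∀ t ∈ K₁, AvoidsAt f r Z t)
    (hK : IsPiece L E f τ A K) :
    ∃ r', IsSec f w Set.univ r' ∧ IsRealSec φ f τ Set.univ r' ∧
      (∀ t ∈ A, ∀ p : TotalSpace ℂ L, r' t p = r t p) ∧
      ∀ t ∈ K₁ ∪ K, AvoidsAt f r' Z t := by
  classical
  obtain ⟨a, ha⟩ := hK.trivialized
  obtain ⟨j, hj, hi⟩ := hK.embeds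
  have hKc := hK.isCompact.isClosed
  have hbo := (trivializationAt ℂ L a).open_baseSet.preimage hf
  obtain ⟨U₁, U₂, hU₁, hU₂, hKU₁, hKU₂, hU⟩ :=
    normal_separation hKc (hKc.preimage hτ) hK.disjoint_translate
  obtain ⟨O, hO, hKO, hOs⟩ := normal_exists_closure_subset hKc
    (t := (U₁ ∩ τ ⁻¹' U₂) ∩ (f ⁻¹' (trivializationAt ℂ L a).baseSet ∩ Aᶜ))
    ((hU₁.inter (hU₂.preimage hτ)).inter (hbo.inter hAc.isOpen_compl))
    fun t ht => ⟨⟨hKU₁ ht, hKU₂ (by simpa [hττ t] using ht)⟩, ha ht,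
      Set.disjoint_left.1 hK.disjoint ht⟩
  have hOτ : ∀ t ∈ O, τ t ∉ O := fun t ht ht' =>
    Set.disjoint_left.1 hU (hOs (subset_closure ht')).1.1 (hOs (subset_closure ht)).1.2
  -- the function `r` in the trivialization, and its perturbation on `K`
  let h₀ : T → κ → ℂ := fun t => r t (locSec L a (f t))
  have hh₀ : ContinuousOn h₀ (closure O) := (h.cont a).mono fun t ht => ⟨trivial, (hOs ht).2.1⟩
  -- Points of `K₁` in the translate of `O` are affected by the conjugate change. They are
  -- controlled through their images in `O`, so the margin `ε` must cover the translate of `K₁` as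
  -- well.
  have hCcl : IsClosed ((K₁ ∪ τ ⁻¹' K₁) ∩ closure O) :=
    (hK₁.union (hK₁.preimage hτ)).inter isClosed_closure
  have havoid : ∀ t ∈ (K₁ ∪ τ ⁻¹' K₁), AvoidsAt f r Z t := by
    rintro t (ht | ht)
    · exact h₁ t ht
    · exact hr.avoidsAt hZ hfτ (h₁ _ ht)
  obtain ⟨ε, hε, hεZ⟩ := (hCcl.isCompact.image_of_continuousOn
    (hh₀.mono Set.inter_subset_right)).exists_thickening_subset_open hZc.isOpen_compl (by
      rintro _ ⟨t, ⟨ht, htO⟩, rfl⟩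
      exact havoid t ht _ rfl (locSec_snd_ne_zero (hOs htO).2.1))
  have : CompactSpace K := isCompact_iff_compactSpace.1 hK.isCompact
  have hKO' : K ⊆ closure O := hKO.trans subset_closure
  obtain ⟨η, hη, hηε, hηZ⟩ := exists_near_avoiding (continuousOn_iff_continuous_domRestrict.1 hj)
    (Set.injOn_iff_injective.1 hi) hZE (continuousOn_iff_continuous_domRestrict.1 (hh₀.mono hKO')) hε
  obtain ⟨δ, hδ⟩ := ContinuousMap.exists_restrict_eq hKc
    (⟨fun t : K => η t - h₀ t, hη.sub (continuousOn_iff_continuous_domRestrict.1 (hh₀.mono hKO'))⟩ :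
      C(K, κ → ℂ))
  have hδK : ∀ t (ht : t ∈ K), δ t = η ⟨t, ht⟩ - h₀ t := fun t ht =>
    congrArg (fun F : C(K, κ → ℂ) => F ⟨t, ht⟩) hδ
  -- The correction is below `ε` on `K`, but its extension `δ` need not be elsewhere. The cutoff is
  -- therefore supported where `δ` is still below `ε`.
  have hO' : IsOpen (O ∩ {t | ‖δ t‖ < ε}) :=
    hO.inter (isOpen_lt δ.continuous.norm continuous_const)
  obtain ⟨χ, hχs, hχ1, hχI⟩ := exists_tsupport_one_of_isOpen_isClosed hO'
    isClosed_closure.isCompact hKc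
    (fun t ht => ⟨hKO ht, by
      show ‖δ t‖ < ε
      rw [hδK t ht]
      exact hηε ⟨t, ht⟩⟩ : K ⊆ O ∩ {t | ‖δ t‖ < ε})
  let d : T → κ → ℂ := fun t k => (χ t : ℂ) * δ t k
  have hdc : Continuous d := continuous_pi fun k =>
    (Complex.continuous_ofReal.comp χ.continuous).mul ((continuous_apply k).comp δ.continuous)
  have hds : tsupport d ⊆ O ∩ {t | ‖δ t‖ < ε} := by
    refine (closure_mono fun t ht => ?_).trans hχs
    intro h0
    apply ht
    ext k
    simp [d, h0]
  have hdε : ∀ t, ‖d t‖ < ε := by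
    intro t
    by_cases ht : t ∈ tsupport χ
    · refine lt_of_le_of_lt ((pi_norm_le_iff_of_nonneg (norm_nonneg _)).2 fun k => ?_)
        (hχs ht).2
      simp only [d, norm_mul, Complex.norm_real, Real.norm_eq_abs]
      rw [abs_of_nonneg (hχI t).1]
      exact (mul_le_of_le_one_left (norm_nonneg _) (hχI t).2).trans (norm_le_pi_norm _ k)
    · have : d t = 0 := by
        ext k
        simp [d, image_eq_zero_of_notMem_tsupport ht]
      rwa [this, norm_zero]
  have hΔ0 : ∀ t, t ∉ O → ∀ p : TotalSpace ℂ L, coordSec w a d t p = 0 := fun t ht p =>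
    coordSec_of_notMem (fun h => ht (hds h).1) p
  let r' : T → TotalSpace ℂ L → κ → ℂ := fun t p k =>
    (r t p k + coordSec w a d t p k) + conjSec φ τ (coordSec w a d) t p k
  have hΔ : IsSec f w Set.univ (coordSec (L := L) w a d) :=
    isSec_coordSec hf hdc (hds.trans fun t ht => (hOs (subset_closure ht.1)).2.1)
  have hr' : IsSec f w Set.univ r' :=
    (h.add hΔ).add (hΔ.conjSec φ hf hτ hfτ fun _ _ => trivial)
  have hrr' : IsRealSec φ f τ Set.univ r' := by
    intro t _ p hp hp0 k
    simp only [r', conjSec, hττ t, φ.tot_tot, map_add, Complex.conj_conj]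
    rw [hr t trivial p hp hp0]
    ring
  have hout : ∀ t, t ∉ O → τ t ∉ O → ∀ p : TotalSpace ℂ L, r' t p = r t p := by
    intro t h1 h2 p
    ext k
    simp [r', conjSec, hΔ0 t h1, hΔ0 _ h2]
  have hin : ∀ t ∈ O, (t ∈ K₁ ∪ τ ⁻¹' K₁ ∨ t ∈ K) → AvoidsAt f r' Z t := by
    intro t ht hor
    have hta := (hOs (subset_closure ht)).2.1
    rw [hr'.avoidsAt_iff hZ trivial hta]
    have hval : r' t (locSec L a (f t)) = h₀ t + d t := by
      ext k
      simp only [r', conjSec, hΔ0 _ (hOτ t ht)]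
      simp [coordSec, coord_locSec hta, h₀]
    rw [hval]
    rcases hor with h1 | h1
    · refine hεZ (Metric.mem_thickening_iff.2 ⟨h₀ t, ⟨t, ⟨h1, subset_closure ht⟩, rfl⟩, ?_⟩)
      simpa using hdε t
    · have : h₀ t + d t = η ⟨t, h1⟩ := by
        ext k
        have hχt : χ t = 1 := hχ1 h1
        simp [d, hδK t h1, hχt]
      rw [this]
      exact hηZ _
  refine ⟨r', hr', hrr', fun t ht p => hout t (fun h => (hOs (subset_closure h)).2.2 ht)
    (fun h => (hOs (subset_closure h)).2.2 (hA t ht)) p, ?_⟩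
  rintro t (ht | ht)
  · by_cases h1 : t ∈ O
    · exact hin t h1 (Or.inl (Or.inl ht))
    by_cases h2 : τ t ∈ O
    · exact hrr'.avoidsAt hZ hfτ (hin _ h2 (Or.inl (Or.inr (by simpa [hττ t] using ht))))
    · intro p hp hp0
      rw [hout t h1 h2]
      exact h₁ t ht p hp hp0
  · exact hin t (hKO ht) (Or.inr ht)

/-- General position: if `T` is covered, away from neighborhoods of `A`, by finitely many pieces,
then a compatible family avoiding `Z` over `A` can be changed outside `A` so as to avoid `Z`
everywhere. -/
theorem exists_avoiding [Fintype κ] [CompactSpace T] [T2Space T] (φ : Conjugation σ L)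
    (hf : Continuous f)
    (hτ : Continuous τ) (hττ : Function.Involutive τ) (hfτ : ∀ t, f (τ t) = σ (f t))
    (hAc : IsClosed A) (hA : ∀ t ∈ A, τ t ∈ A) (hZ : IsInvariant w Z) (hZc : IsClosed Z)
    (hZE : Avoidable E Z) (h : IsSec f w Set.univ r) (hr : IsRealSec φ f τ Set.univ r)
    (h₁ : ∀ t ∈ A, AvoidsAt f r Z t)
    (hcov : ∀ W : Set T, IsOpen W → A ⊆ W → ∃ 𝒦 : Set (Set T), 𝒦.Finite ∧
      (∀ K ∈ 𝒦, IsPiece L E f τ A K) ∧ Wᶜ ⊆ ⋃₀ 𝒦) :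
    ∃ r', IsSec f w Set.univ r' ∧ IsRealSec φ f τ Set.univ r' ∧
      (∀ t ∈ A, ∀ p : TotalSpace ℂ L, r' t p = r t p) ∧ ∀ t, AvoidsAt f r' Z t := by
  obtain ⟨W, hW, hAW, hWs⟩ := normal_exists_closure_subset hAc (h.isOpen_avoidsAt hf hZ hZc) h₁
  obtain ⟨𝒦, h𝒦, hp, hc⟩ := hcov W hW hAW
  -- Induction over the pieces. The set already treated starts as a closed neighborhood of `A` and
  -- grows by one compact piece at each step.
  have key : ∃ r', IsSec f w Set.univ r' ∧ IsRealSec φ f τ Set.univ r' ∧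
      (∀ t ∈ A, ∀ p : TotalSpace ℂ L, r' t p = r t p) ∧
      ∀ t ∈ closure W ∪ ⋃₀ 𝒦, AvoidsAt f r' Z t := by
    clear hc
    induction 𝒦, h𝒦 using Set.Finite.induction_on with
    | empty => exact ⟨r, h, hr, fun _ _ _ => rfl, fun t ht => hWs (by simpa using ht)⟩
    | @insert K 𝒦 _ hfin ih =>
      obtain ⟨r₁, a₁, b₁, c₁, d₁⟩ := ih fun K' hK' => hp K' (Set.mem_insert_of_mem _ hK')
      have hcl : IsClosed (closure W ∪ ⋃₀ 𝒦) := isClosed_closure.union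
        (hfin.isCompact_sUnion fun K' hK' =>
          (hp K' (Set.mem_insert_of_mem _ hK')).isCompact).isClosed
      obtain ⟨r₂, a₂, b₂, c₂, d₂⟩ := exists_avoiding_on_piece φ hf hτ hττ hfτ hAc hA hZ hZc hZE a₁ b₁
        hcl d₁ (hp K (Set.mem_insert _ _))
      refine ⟨r₂, a₂, b₂, fun t ht p => (c₂ t ht p).trans (c₁ t ht p), fun t ht => d₂ t ?_⟩
      rw [Set.sUnion_insert] at ht
      rcases ht with ht | ht | ht
      exacts [Or.inl (Or.inl ht), Or.inr ht, Or.inl (Or.inr ht)]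
  obtain ⟨r', a, b, c, d⟩ := key
  refine ⟨r', a, b, c, fun t => d t ?_⟩
  by_cases ht : t ∈ W
  · exact Or.inl (subset_closure ht)
  · exact Or.inr (hc ht)

/-- Pieces are obtained from a compact space `S` over `T` which is locally embedded into `T` and
into `E`. -/
theorem exists_pieces {S : Type*} [TopologicalSpace S] [CompactSpace S] [T2Space S] [T2Space T]
    {q : S → T} (hq : Continuous q) (hqs : Function.Surjective q) (hf : Continuous f)
    (hτ : Continuous τ) (hAc : IsClosed A) (hfree : ∀ t, t ∉ A → τ t ≠ t)
    (hloc : ∀ x, q x ∉ A → ∃ K ∈ 𝓝 x, Set.InjOn q K ∧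
      ∃ j : S → E, ContinuousOn j K ∧ Set.InjOn j K)
    (W : Set T) (hW : IsOpen W) (hAW : A ⊆ W) : ∃ 𝒦 : Set (Set T), 𝒦.Finite ∧
      (∀ K ∈ 𝒦, IsPiece L E f τ A K) ∧ Wᶜ ⊆ ⋃₀ 𝒦 := by
  have key : ∀ x, q x ∉ A → ∃ K ∈ 𝓝 x, IsPiece L E f τ A (q '' K) := by
    intro x hx
    obtain ⟨K, hK, hKi, j, hj, hji⟩ := hloc x hx
    obtain ⟨U, V, hU, hV, hxU, hxV, hUV⟩ := t2_separation (hfree _ hx).symm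
    have hbo := (trivializationAt ℂ L (f (q x))).open_baseSet.preimage hf
    have hO : K ∩ q ⁻¹' ((U ∩ τ ⁻¹' V) ∩
        (f ⁻¹' (trivializationAt ℂ L (f (q x))).baseSet ∩ Aᶜ)) ∈ 𝓝 x := by
      refine Filter.inter_mem hK (((((hU.inter (hV.preimage hτ)).inter
        (hbo.inter hAc.isOpen_compl))).preimage hq).mem_nhds ?_)
      exact ⟨⟨hxU, hxV⟩, FiberBundle.mem_baseSet_trivializationAt' _, hx⟩
    obtain ⟨K', hK', hK's, hK'c⟩ := local_compact_nhds hO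
    have hK'K : K' ⊆ K := fun y hy => (hK's hy).1
    refine ⟨K', hK', hK'c.image hq, ?_, ?_, ⟨f (q x), ?_⟩, ?_⟩
    · rw [Set.disjoint_left]
      rintro _ ⟨y, hy, rfl⟩
      exact (hK's hy).2.2.2
    · rw [Set.disjoint_left]
      rintro _ ⟨y, hy, rfl⟩ ⟨z, hz, hzy⟩
      refine Set.disjoint_left.1 hUV (hK's hz).2.1.1 ?_
      rw [hzy]
      exact (hK's hy).2.1.2
    · rintro _ ⟨y, hy, rfl⟩
      exact (hK's hy).2.2.1
    · have : Nonempty S := ⟨x⟩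
      have hinv : ∀ y ∈ K', Function.invFunOn q K' (q y) = y := fun y hy =>
        (hKi.mono hK'K).leftInvOn_invFunOn hy
      -- The embedding is carried over by the inverse of `q` on `K'`. The result is continuous
      -- because `q` maps closed subsets of the compact set `K'` to closed sets.
      refine ⟨j ∘ Function.invFunOn q K', continuousOn_iff_isClosed.2 fun C hC => ?_, ?_⟩
      · refine ⟨q '' (K' ∩ j ⁻¹' C), ?_, ?_⟩
        · exact (((hj.mono hK'K).preimage_isClosed_of_isClosed hK'c.isClosed hC).isCompact.image
            hq).isClosed
        · ext t
          constructor
          · rintro ⟨ht, y, hy, rfl⟩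
            refine ⟨⟨y, ⟨hy, ?_⟩, rfl⟩, y, hy, rfl⟩
            simpa [hinv y hy] using ht
          · rintro ⟨⟨y, ⟨hy, hyC⟩, rfl⟩, -⟩
            refine ⟨?_, y, hy, rfl⟩
            simpa [hinv y hy] using hyC
      · rintro _ ⟨y, hy, rfl⟩ _ ⟨z, hz, rfl⟩ hyz
        simp only [Function.comp, hinv y hy, hinv z hz] at hyz
        rw [hji (hK'K hy) (hK'K hz) hyz]
  choose! K hK hp using key
  obtain ⟨n, hn, hcov⟩ := ((hW.isClosed_compl.preimage hq).isCompact).elim_nhds_subcover K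
    fun x hx => hK x fun h => hx (hAW h)
  refine ⟨(fun x => q '' K x) '' n, n.finite_toSet.image _, ?_, fun t ht => ?_⟩
  · rintro _ ⟨x, hx, rfl⟩
    exact hp x fun h => hn x hx (hAW h)
  · obtain ⟨x, rfl⟩ := hqs t
    obtain ⟨y, hy, hxy⟩ := Set.mem_iUnion₂.1 (hcov ht)
    exact ⟨_, ⟨y, hy, rfl⟩, x, hxy, rfl⟩

end Perturbation

/-! ### Isomorphisms as homogeneous matrix families -/

section Frames

variable {B : Type*} [TopologicalSpace B] {σ : B → B} {L : B → Type*} [∀ x, AddCommGroup (L x)]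
  [∀ x, Module ℂ (L x)] [∀ x, TopologicalSpace (L x)] [TopologicalSpace (TotalSpace ℂ L)]
  [FiberBundle ℂ L] [VectorBundle ℂ ℂ L] {φ : Conjugation σ L}

/-- The degrees of homogeneity of the three vectors of the frame `frame v`. -/
def wt : Fin 3 → ℤ := ![2, -1, -1]

theorem dualVec_smul {x : B} (c : ℂ) (v : L x) : dualVec (c • v) = c⁻¹ • dualVec v := by
  simp [dualVec, smul_smul, mul_comm]

theorem frame_smul {x : B} {c : ℂ} (v : L x) (i : Fin 3) :
    frame (c • v) i = c ^ wt i • frame v i := by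
  fin_cases i
  · simp [frame, wt, TensorProduct.smul_tmul', TensorProduct.tmul_smul, smul_smul, zpow_ofNat, sq]
  · simp [frame, wt, dualVec_smul]
  · simp [frame, wt, dualVec_smul]

/-- The linear coordinate on the fiber of `L` with value `1` at `v`. -/
noncomputable def fiberEquiv {x : B} (v : L x) (hv : v ≠ 0) : L x ≃ₗ[ℂ] ℂ :=
  let e := (trivializationAt ℂ L x).linearEquivAt ℂ x (FiberBundle.mem_baseSet_trivializationAt' x)
  e.trans (LinearEquiv.smulOfNeZero ℂ ℂ (e v)⁻¹ (inv_ne_zero (e.map_ne_zero_iff.2 hv)))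

theorem fiberEquiv_self {x : B} (v : L x) (hv : v ≠ 0) : fiberEquiv v hv v = 1 := by
  simp only [fiberEquiv, LinearEquiv.trans_apply, LinearEquiv.smulOfNeZero_apply, smul_eq_mul]
  exact inv_mul_cancel₀ ((LinearEquiv.map_ne_zero_iff _).2 hv)

/-- The triple of coordinates as a vector. -/
def tripleEquiv : (ℂ × ℂ × ℂ) ≃ₗ[ℂ] (Fin 3 → ℂ) where
  toFun p := ![p.1, p.2.1, p.2.2]
  invFun u := (u 0, u 1, u 2)
  map_add' p q := by ext i; fin_cases i <;> rfl
  map_smul' c p := by ext i; fin_cases i <;> rfl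
  left_inv p := rfl
  right_inv u := by ext i; fin_cases i <;> rfl

theorem tripleEquiv_apply (p : ℂ × ℂ × ℂ) : tripleEquiv p = ![p.1, p.2.1, p.2.2] := rfl

/-- A nonzero vector of the fiber at `x`. -/
noncomputable def baseVec (L : B → Type*) [∀ x, AddCommGroup (L x)]
    [∀ x, Module ℂ (L x)] [∀ x, TopologicalSpace (L x)] [TopologicalSpace (TotalSpace ℂ L)]
    [FiberBundle ℂ L] (x : B) : L x := (trivializationAt ℂ L x).symm x (1 : ℂ)

theorem baseVec_ne_zero (x : B) : baseVec L x ≠ 0 :=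
  locSec_snd_ne_zero (L := L) (FiberBundle.mem_baseSet_trivializationAt' (F := ℂ) (E := L) x)

/-- The linear coordinates on the fiber of `L^{⊗2} ⊕ L* ⊕ L*` determined by `frame v`. -/
noncomputable def frameEquiv {x : B} (v : L x) (hv : v ≠ 0) : SumFiber L x ≃ₗ[ℂ] (Fin 3 → ℂ) :=
  let e := fiberEquiv v hv
  let d : Module.Dual ℂ (L x) ≃ₗ[ℂ] ℂ :=
    e.symm.dualMap.trans (LinearMap.ringLmapEquivSelf ℂ ℂ ℂ)
  (LinearEquiv.prodCongr ((TensorProduct.congr e e).trans (TensorProduct.lid ℂ ℂ))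
    (LinearEquiv.prodCongr d d)).trans tripleEquiv

theorem frameEquiv_frame {x : B} (v : L x) (hv : v ≠ 0) (j : Fin 3) :
    frameEquiv v hv (frame v j) = Pi.single j 1 := by
  have h1 : (fiberEquiv v hv).symm 1 = v := by
    rw [LinearEquiv.symm_apply_eq, fiberEquiv_self]
  ext i
  fin_cases j <;> fin_cases i <;>
    simp [frameEquiv, frame, tripleEquiv_apply, fiberEquiv_self, h1, dualVec_self hv]

theorem RealIso.equiv_eq_mulVec (Ψ : RealIso φ) {x : B} (v : L x) (hv : v ≠ 0)
    (u : SumFiber L x) : Ψ.equiv x u = (Ψ.matrix v).mulVec (frameEquiv v hv u) := by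
  have : (Ψ.equiv x).toLinearMap ∘ₗ (frameEquiv v hv).symm.toLinearMap =
      (Ψ.matrix v).mulVecLin := by
    refine (Pi.basisFun ℂ (Fin 3)).ext fun j => ?_
    have h : (frameEquiv v hv).symm (Pi.single j 1) = frame v j := by
      rw [LinearEquiv.symm_apply_eq, frameEquiv_frame]
    ext i
    simp [h, RealIso.matrix]
  have h := LinearMap.congr_fun this (frameEquiv v hv u)
  simpa using h

theorem RealIso.det_matrix_ne_zero (Ψ : RealIso φ) {x : B} {v : L x} (hv : v ≠ 0) :
    (Ψ.matrix v).det ≠ 0 := by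
  have hinj : Function.Injective (Ψ.matrix v).mulVec := by
    intro a b hab
    have h1 := Ψ.equiv_eq_mulVec v hv ((frameEquiv v hv).symm a)
    have h2 := Ψ.equiv_eq_mulVec v hv ((frameEquiv v hv).symm b)
    simp only [LinearEquiv.apply_symm_apply] at h1 h2
    exact (frameEquiv v hv).symm.injective ((Ψ.equiv x).injective (h1.trans (hab.trans h2.symm)))
  exact ((Matrix.isUnit_iff_isUnit_det _).1 (Matrix.mulVec_injective_iff_isUnit.1 hinj)).ne_zero

theorem RealIso.matrix_smul (Ψ : RealIso φ) {x : B} (c : ℂ) (v : L x) (i j : Fin 3) :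
    Ψ.matrix (c • v) i j = c ^ wt j * Ψ.matrix v i j := by
  simp [RealIso.matrix, frame_smul]

theorem Conjugation.sumMap_add (φ : Conjugation σ L) (x : B) (u u' : SumFiber L x) :
    φ.sumMap x (u + u') = φ.sumMap x u + φ.sumMap x u' := by
  refine Prod.ext ?_ (Prod.ext ?_ ?_)
  · simp [Conjugation.sumMap]
  · ext; simp [Conjugation.sumMap, dualConj]
  · ext; simp [Conjugation.sumMap, dualConj]

theorem Conjugation.sumMap_smul (φ : Conjugation σ L) (x : B) (c : ℂ) (u : SumFiber L x) :
    φ.sumMap x (c • u) = starRingEnd ℂ c • φ.sumMap x u := by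
  refine Prod.ext ?_ (Prod.ext ?_ ?_)
  · simp [Conjugation.sumMap, LinearMap.map_smulₛₗ]
  · ext; simp [Conjugation.sumMap, dualConj]
  · ext; simp [Conjugation.sumMap, dualConj]

theorem dualVec_eq {x : B} {v : L x} (hv : v ≠ 0) {α : Module.Dual ℂ (L x)} (h : α v = 1) :
    α = dualVec v := by
  refine LinearMap.ext fun u => ?_
  have hu : u = fiberEquiv v hv u • v := by
    apply (fiberEquiv v hv).injective
    rw [map_smul, fiberEquiv_self, smul_eq_mul, mul_one]
  rw [hu, map_smul, map_smul, h, dualVec_self hv]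

theorem Conjugation.sumMap_frame (φ : Conjugation σ L) {x : B} {v : L x} (hv : v ≠ 0)
    (j : Fin 3) : φ.sumMap x (frame v j) = frame (φ.map x v) j := by
  have hv' : φ.map x v ≠ 0 := (φ.map x).map_ne_zero_iff.2 hv
  have hd : dualConj (φ.map x) (dualVec v) = dualVec (φ.map x v) := by
    apply dualVec_eq hv'
    simp [dualConj, dualVec_self hv]
  have h0 : dualConj (φ.map x) (0 : Module.Dual ℂ (L x)) = 0 := by
    ext; simp [dualConj]
  fin_cases j
  · simp [Conjugation.sumMap, frame, h0]
  · simp [Conjugation.sumMap, frame, h0, hd]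
  · simp [Conjugation.sumMap, frame, h0, hd]

theorem RealIso.matrix_conj (Ψ : RealIso φ) {x : B} {v : L x} (hv : v ≠ 0) (i j : Fin 3) :
    Ψ.matrix (φ.map x v) i j = starRingEnd ℂ (Ψ.matrix v i j) := by
  simp only [RealIso.matrix, Matrix.of_apply]
  rw [← φ.sumMap_frame hv, Ψ.equiv_conj]
  rfl

/-- The matrix of `Ψ` as a function on the total space. -/
noncomputable def RealIso.mat (Ψ : RealIso φ) (p : TotalSpace ℂ L) : Matrix (Fin 3) (Fin 3) ℂ :=
  Ψ.matrix p.2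

theorem RealIso.ext_mat {Ψ Ψ' : RealIso φ}
    (h : ∀ p : TotalSpace ℂ L, p.2 ≠ 0 → Ψ.mat p = Ψ'.mat p) : Ψ = Ψ' := by
  have : Ψ.equiv = Ψ'.equiv := by
    ext1 x
    refine LinearEquiv.ext fun u => ?_
    rw [Ψ.equiv_eq_mulVec _ (baseVec_ne_zero x), Ψ'.equiv_eq_mulVec _ (baseVec_ne_zero x)]
    exact congrArg (fun M : Matrix (Fin 3) (Fin 3) ℂ => M.mulVec _)
      (h ⟨x, baseVec L x⟩ (baseVec_ne_zero x))
  cases Ψ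
  cases Ψ'
  congr

variable {T : Type*} [TopologicalSpace T] {f : T → B} {A : Set T} {τ : T → T}
  {M : T → TotalSpace ℂ L → Matrix (Fin 3) (Fin 3) ℂ}

/-- A family of matrices of isomorphisms of real bundle pairs between `L^{⊗2} ⊕ 2L*` and the trivial
one, along `f` and over the subset `A` of the base. -/
structure IsFrameFamily (φ : Conjugation σ L) (f : T → B) (τ : T → T) (A : Set T)
    (M : T → TotalSpace ℂ L → Matrix (Fin 3) (Fin 3) ℂ) : Prop where
  sec : IsSec f (fun k : Fin 3 × Fin 3 => wt k.2) A fun t p k => M t p k.1 k.2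
  real : IsRealSec φ f τ A fun t p (k : Fin 3 × Fin 3) => M t p k.1 k.2
  det_ne_zero : ∀ t ∈ A, ∀ p : TotalSpace ℂ L, p.1 = f t → p.2 ≠ 0 → (M t p).det ≠ 0

theorem RealIso.isFrameFamily_of_continuousFamily {Y : Type*} [TopologicalSpace Y]
    (H : Y → RealIso φ)
    (hH : ContinuousFamily (fun p : Y × B => p.2) fun p => ((H p.1).equiv p.2).toLinearMap) :
    IsFrameFamily φ (fun p : Y × B => p.2) (fun p => (p.1, σ p.2)) Set.univ
      fun t p => (H t.1).mat p := by
  refine ⟨⟨fun t _ p hp _ c _ k => (H t.1).matrix_smul c p.2 k.1 k.2, fun a => ?_⟩,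
    fun t _ p hp hp0 k => (H t.1).matrix_conj hp0 k.1 k.2,
    fun t _ p hp hp0 => (H t.1).det_matrix_ne_zero hp0⟩
  refine continuousOn_pi.2 fun k => ?_
  exact (continuous_apply k.1).comp_continuousOn ((hH a k.2).mono Set.inter_subset_right)

theorem RealIso.isFrameFamily (Ψ : RealIso φ) :
    IsFrameFamily φ (fun x => x) σ Set.univ fun _ p => Ψ.mat p := by
  refine ⟨⟨fun t _ p hp _ c _ k => Ψ.matrix_smul c p.2 k.1 k.2, fun a => ?_⟩,
    fun t _ p hp hp0 k => Ψ.matrix_conj hp0 k.1 k.2,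
    fun t _ p hp hp0 => Ψ.det_matrix_ne_zero hp0⟩
  refine continuousOn_pi.2 fun k => ?_
  exact (continuous_apply k.1).comp_continuousOn
    ((Ψ.continuous_equiv a k.2).mono Set.inter_subset_right)

/-- The fiberwise linear isomorphism with the given family of matrices. -/
noncomputable def matEquiv (N : TotalSpace ℂ L → Matrix (Fin 3) (Fin 3) ℂ)
    (hN : ∀ p : TotalSpace ℂ L, p.2 ≠ 0 → (N p).det ≠ 0) (x : B) :
    SumFiber L x ≃ₗ[ℂ] (Fin 3 → ℂ) :=
  (frameEquiv (baseVec L x) (baseVec_ne_zero x)).trans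
    (Matrix.toLinearEquiv' (N ⟨x, baseVec L x⟩)
      (Matrix.invertibleOfIsUnitDet _ (hN ⟨x, baseVec L x⟩ (baseVec_ne_zero x)).isUnit))

/-- The isomorphism is defined by the matrix at one chosen vector of each fiber. Homogeneity makes
the formula independent of that choice. -/
theorem matEquiv_frame {N : TotalSpace ℂ L → Matrix (Fin 3) (Fin 3) ℂ}
    (hN : ∀ p : TotalSpace ℂ L, p.2 ≠ 0 → (N p).det ≠ 0)
    (hom : ∀ p : TotalSpace ℂ L, p.2 ≠ 0 → ∀ c : ℂ, c ≠ 0 → ∀ i j,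
      N (scale c p) i j = c ^ wt j * N p i j) {x : B} {v : L x} (hv : v ≠ 0) (i j : Fin 3) :
    matEquiv N hN x (frame v j) i = N ⟨x, v⟩ i j := by
  obtain ⟨c, hc, h⟩ := exists_scale_eq (p := ⟨x, baseVec L x⟩) (q := ⟨x, v⟩) rfl
    (baseVec_ne_zero x) hv
  have hvc : v = c • baseVec L x := by
    simp only [scale] at h
    exact eq_of_heq (TotalSpace.mk.inj h).2
  have h1 : matEquiv N hN x (frame (baseVec L x) j) i = N ⟨x, baseVec L x⟩ i j := by
    have h0 : matEquiv N hN x (frame (baseVec L x) j) =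
        (N ⟨x, baseVec L x⟩).mulVec (Pi.single j 1) := by
      simp only [matEquiv, LinearEquiv.trans_apply, frameEquiv_frame]
      exact Matrix.toLin'_apply _ _
    rw [h0, Matrix.mulVec_single_one]
    rfl
  rw [h, hom ⟨x, baseVec L x⟩ (baseVec_ne_zero x) c hc, hvc, ← h1, frame_smul]
  exact congrFun ((matEquiv N hN x).map_smul _ _) i

/-- The isomorphism of real bundle pairs with the given family of matrices. -/
noncomputable def realIsoOfMat (N : TotalSpace ℂ L → Matrix (Fin 3) (Fin 3) ℂ)
    (hN : IsFrameFamily φ (fun x => x) σ Set.univ fun _ p => N p) : RealIso φ :=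
  have hdet : ∀ p : TotalSpace ℂ L, p.2 ≠ 0 → (N p).det ≠ 0 := fun p hp =>
    hN.det_ne_zero p.1 trivial p rfl hp
  have hom : ∀ p : TotalSpace ℂ L, p.2 ≠ 0 → ∀ c : ℂ, c ≠ 0 → ∀ i j,
      N (scale c p) i j = c ^ wt j * N p i j := fun p hp c hc i j =>
    hN.sec.hom p.1 trivial p rfl hp c hc (i, j)
  { equiv := matEquiv N hdet
    continuous_equiv := by
      intro a j
      refine continuousOn_pi.2 fun i => ?_
      have h := (continuous_apply (i, j)).comp_continuousOn (hN.sec.cont a)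
      refine (h.mono fun x hx => ⟨trivial, hx⟩).congr fun x hx => ?_
      exact matEquiv_frame hdet hom (locSec_snd_ne_zero hx) i j
    equiv_conj := by
      intro x u
      have hv := baseVec_ne_zero (L := L) x
      set v := baseVec L x
      have hu : u = ∑ j, frameEquiv v hv u j • frame v j := by
        apply (frameEquiv v hv).injective
        rw [map_sum]
        simp only [map_smul, frameEquiv_frame]
        ext i
        simp [Finset.sum_apply, Pi.single_apply]
      have hs : φ.sumMap x (∑ j, frameEquiv v hv u j • frame v j) =
          ∑ j, starRingEnd ℂ (frameEquiv v hv u j) • frame (φ.map x v) j := by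
        simp only [Fin.sum_univ_three, φ.sumMap_add, φ.sumMap_smul, φ.sumMap_frame hv]
      have hv' : φ.map x v ≠ 0 := (φ.map x).map_ne_zero_iff.2 hv
      ext i
      conv_lhs => rw [hu, hs]
      conv_rhs => rw [hu]
      simp only [map_sum, map_smul, Finset.sum_apply, Pi.smul_apply, Pi.star_apply, smul_eq_mul,
        star_sum, star_mul', matEquiv_frame hdet hom hv, matEquiv_frame hdet hom hv']
      refine Finset.sum_congr rfl fun j _ => ?_
      congr 1
      exact hN.real x trivial ⟨x, v⟩ rfl hv (i, j) }

theorem realIsoOfMat_mat {N : TotalSpace ℂ L → Matrix (Fin 3) (Fin 3) ℂ}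
    (hN : IsFrameFamily φ (fun x => x) σ Set.univ fun _ p => N p) {p : TotalSpace ℂ L}
    (hp : p.2 ≠ 0) : (realIsoOfMat N hN).mat p = N p := by
  ext i j
  exact matEquiv_frame (fun p hp => hN.det_ne_zero p.1 trivial p rfl hp)
    (fun p hp c hc i j => hN.sec.hom p.1 trivial p rfl hp c hc (i, j)) hp i j

theorem IsSec.comp {κ : Type*} {w : κ → ℤ} {r : T → TotalSpace ℂ L → κ → ℂ} (h : IsSec f w A r)
    {T' : Type*} [TopologicalSpace T'] {s : T' → T} (hs : Continuous s) :
    IsSec (fun t => f (s t)) w (s ⁻¹' A) fun t => r (s t) :=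
  ⟨fun t ht => h.hom (s t) ht, fun a => (h.cont a).comp hs.continuousOn fun _ ht => ht⟩

theorem IsFrameFamily.comp (h : IsFrameFamily φ f τ A M) {T' : Type*} [TopologicalSpace T']
    {s : T' → T} (hs : Continuous s) {τ' : T' → T'} (hτ : ∀ t, s (τ' t) = τ (s t)) :
    IsFrameFamily φ (fun t => f (s t)) τ' (s ⁻¹' A) fun t => M (s t) :=
  ⟨h.sec.comp hs, fun t ht p hp hp0 k => by
    simp only [hτ]
    exact h.real (s t) ht p hp hp0 k, fun t ht => h.det_ne_zero (s t) ht⟩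

theorem IsSec.union {κ : Type*} {w : κ → ℤ} {r : T → TotalSpace ℂ L → κ → ℂ} {A' : Set T}
    (h : IsSec f w A r) (h' : IsSec f w A' r) (hA : IsClosed A) (hA' : IsClosed A') :
    IsSec f w (A ∪ A') r := by
  refine ⟨fun t ht => ht.elim (h.hom t) (h'.hom t), fun a => ?_⟩
  rintro t ⟨ht, hta⟩
  rw [Set.union_inter_distrib_right]
  have key : ∀ {C : Set T}, IsSec f w C r → IsClosed C →
      ContinuousWithinAt (fun t => r t (locSec L a (f t)))
        (C ∩ f ⁻¹' (trivializationAt ℂ L a).baseSet) t := by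
    intro C hC hCc
    by_cases htC : t ∈ C
    · exact hC.cont a t ⟨htC, hta⟩
    · have : t ∉ closure (C ∩ f ⁻¹' (trivializationAt ℂ L a).baseSet) := fun h =>
        htC (hCc.closure_subset (closure_mono Set.inter_subset_left h))
      exact continuousWithinAt_of_notMem_closure this
  exact (key h hA).union (key h' hA')

theorem IsFrameFamily.union {A' : Set T} (h : IsFrameFamily φ f τ A M)
    (h' : IsFrameFamily φ f τ A' M) (hA : IsClosed A) (hA' : IsClosed A') :
    IsFrameFamily φ f τ (A ∪ A') M :=
  ⟨h.sec.union h'.sec hA hA', fun t ht => ht.elim (h.real t) (h'.real t),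
    fun t ht => ht.elim (h.det_ne_zero t) (h'.det_ne_zero t)⟩

theorem IsFrameFamily.congr {M' : T → TotalSpace ℂ L → Matrix (Fin 3) (Fin 3) ℂ}
    (h : IsFrameFamily φ f τ A M) (hτ : ∀ t ∈ A, τ t ∈ A) (hfτ : ∀ t, f (τ t) = σ (f t))
    (hM : ∀ t ∈ A, ∀ p : TotalSpace ℂ L, p.1 = f t → p.2 ≠ 0 → M' t p = M t p) :
    IsFrameFamily φ f τ A M' :=
  ⟨h.sec.congr fun t ht p hp hp0 => by simp only [hM t ht p hp hp0],
    fun t ht p hp hp0 k => by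
      simp only [hM t ht p hp hp0,
        hM (τ t) (hτ t ht) (φ.tot p) (by rw [φ.tot_proj, hp, hfτ]) (φ.tot_snd_ne_zero hp0)]
      exact h.real t ht p hp hp0 k,
    fun t ht p hp hp0 => by
      rw [hM t ht p hp hp0]
      exact h.det_ne_zero t ht p hp hp0⟩

/-- Turns a path of isomorphisms into one matrix family over `I × B`, to which the extension and
perturbation results apply. -/
theorem RealIso.homotopic_iff {Ψ₀ Ψ₁ : RealIso φ} : Ψ₀.Homotopic Ψ₁ ↔
    ∃ M : unitInterval × B → TotalSpace ℂ L → Matrix (Fin 3) (Fin 3) ℂ,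
      IsFrameFamily φ (fun t => t.2) (fun t => (t.1, σ t.2)) Set.univ M ∧
      ∀ p : TotalSpace ℂ L, p.2 ≠ 0 → M (0, p.1) p = Ψ₀.mat p ∧ M (1, p.1) p = Ψ₁.mat p := by
  constructor
  · rintro ⟨H, rfl, rfl, hH⟩
    exact ⟨_, isFrameFamily_of_continuousFamily H hH, fun p _ => ⟨rfl, rfl⟩⟩
  · rintro ⟨M, hM, hM01⟩
    have hMt : ∀ t : unitInterval,
        IsFrameFamily φ (fun x => x) σ Set.univ fun _ p => M (t, p.1) p := by
      intro t
      have h1 := hM.comp (s := fun x : B => (t, x)) (by fun_prop) (τ' := σ) fun _ => rfl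
      have h2 : IsFrameFamily φ (fun x => x) σ Set.univ fun x p => M (t, x) p := h1
      exact h2.congr (fun _ _ => trivial) (fun _ => rfl) fun x _ p hp _ => by rw [hp]
    refine ⟨fun t => realIsoOfMat _ (hMt t), RealIso.ext_mat fun p hp => ?_,
      RealIso.ext_mat fun p hp => ?_, ?_⟩
    · rw [realIsoOfMat_mat (hMt 0) hp]
      exact (hM01 p hp).1
    · rw [realIsoOfMat_mat (hMt 1) hp]
      exact (hM01 p hp).2
    · intro a j
      refine continuousOn_pi.2 fun i => ?_
      have h := (continuous_apply (i, j)).comp_continuousOn (hM.sec.cont a)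
      refine (h.mono fun x hx => ⟨trivial, hx⟩).congr fun x hx => ?_
      have := realIsoOfMat_mat (hMt x.1) (locSec_snd_ne_zero hx)
      exact congrFun (congrFun this i) j

theorem RealIso.Homotopic.symm {Ψ₀ Ψ₁ : RealIso φ} (h : Ψ₀.Homotopic Ψ₁) : Ψ₁.Homotopic Ψ₀ := by
  obtain ⟨M, hM, hM01⟩ := homotopic_iff.1 h
  refine homotopic_iff.2 ⟨fun t => M (unitInterval.symm t.1, t.2),
    hM.comp (s := fun t : unitInterval × B => (unitInterval.symm t.1, t.2)) (by fun_prop)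
      (τ' := fun t => (t.1, σ t.2)) fun _ => rfl, fun p hp => ?_⟩
  simpa using (hM01 p hp).symm

theorem RealIso.Homotopic.trans {Ψ₀ Ψ₁ Ψ₂ : RealIso φ} (h : Ψ₀.Homotopic Ψ₁)
    (h' : Ψ₁.Homotopic Ψ₂) : Ψ₀.Homotopic Ψ₂ := by
  obtain ⟨M, hM, hM01⟩ := homotopic_iff.1 h
  obtain ⟨N, hN, hN01⟩ := homotopic_iff.1 h'
  let a : unitInterval → unitInterval := fun t => Set.projIcc 0 1 zero_le_one (2 * t.1)
  let b : unitInterval → unitInterval := fun t => Set.projIcc 0 1 zero_le_one (2 * t.1 - 1)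
  have ha : Continuous a := continuous_projIcc.comp (by fun_prop)
  have hb : Continuous b := continuous_projIcc.comp (by fun_prop)
  let F : unitInterval × B → TotalSpace ℂ L → Matrix (Fin 3) (Fin 3) ℂ := fun t p =>
    if t.1.1 ≤ 1 / 2 then M (a t.1, t.2) p else N (b t.1, t.2) p
  have e1 : IsFrameFamily φ (fun t : unitInterval × B => t.2) (fun t => (t.1, σ t.2))
      {t | t.1.1 ≤ 1 / 2} F := by
    have h1 := hM.comp (s := fun t : unitInterval × B => (a t.1, t.2)) (by fun_prop)
      (τ' := fun t => (t.1, σ t.2)) fun _ => rfl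
    have h2 : IsFrameFamily φ (fun t : unitInterval × B => t.2) (fun t => (t.1, σ t.2))
      {t | t.1.1 ≤ 1 / 2} fun t => M (a t.1, t.2) := ⟨h1.sec.mono (Set.subset_univ _),
        fun t _ => h1.real t trivial, fun t _ => h1.det_ne_zero t trivial⟩
    exact h2.congr (fun t ht => ht) (fun _ => rfl) fun t ht p _ _ => if_pos ht
  have e2 : IsFrameFamily φ (fun t : unitInterval × B => t.2) (fun t => (t.1, σ t.2))
      {t | 1 / 2 ≤ t.1.1} F := by
    have h1 := hN.comp (s := fun t : unitInterval × B => (b t.1, t.2)) (by fun_prop)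
      (τ' := fun t => (t.1, σ t.2)) fun _ => rfl
    have h2 : IsFrameFamily φ (fun t : unitInterval × B => t.2) (fun t => (t.1, σ t.2))
      {t | 1 / 2 ≤ t.1.1} fun t => N (b t.1, t.2) := ⟨h1.sec.mono (Set.subset_univ _),
        fun t _ => h1.real t trivial, fun t _ => h1.det_ne_zero t trivial⟩
    -- At time `1 / 2` the case distinction uses the first homotopy. It agrees with the second
    -- there, since both give `Ψ₁`.
    refine h2.congr (fun t ht => ht) (fun _ => rfl) fun t ht p hp hp0 => ?_
    by_cases htl : t.1.1 ≤ 1 / 2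
    · have hte : t.1.1 = 1 / 2 := le_antisymm htl ht
      have ha1 : a t.1 = 1 := by
        simp only [a, hte]
        norm_num
      have hb0 : b t.1 = 0 := by
        simp only [b, hte]
        norm_num
      rw [show F t p = M (a t.1, t.2) p from if_pos htl, ha1, hb0, ← hp, (hM01 p hp0).2,
        (hN01 p hp0).1]
    · exact if_neg htl
  have hcover : ({t : unitInterval × B | t.1.1 ≤ 1 / 2} ∪ {t | 1 / 2 ≤ t.1.1}) = Set.univ :=
    Set.eq_univ_of_forall fun t => le_total t.1.1 (1 / 2)
  refine homotopic_iff.2 ⟨F, hcover ▸ e1.union e2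
    (isClosed_le (by fun_prop) continuous_const) (isClosed_le continuous_const (by fun_prop)),
    fun p hp => ⟨?_, ?_⟩⟩
  · have : F (0, p.1) p = M (a 0, p.1) p := if_pos (by norm_num)
    have ha0 : a 0 = 0 := by simp [a]
    rw [this, ha0, (hM01 p hp).1]
  · have : F (1, p.1) p = N (b 1, p.1) p := if_neg (by norm_num)
    have hb1 : b 1 = 1 := by
      simp only [b]
      norm_num
    rw [this, hb1, (hN01 p hp).2]

end Frames

/-! ### Two independent rows and their completion to determinant 1 -/

section Rows

/-- The cross product of the two rows of a `2 × 3`-matrix. -/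
def rowCross (v : Fin 2 × Fin 3 → ℂ) : Fin 3 → ℂ :=
  ![v (0, 1) * v (1, 2) - v (0, 2) * v (1, 1), v (0, 2) * v (1, 0) - v (0, 0) * v (1, 2),
    v (0, 0) * v (1, 1) - v (0, 1) * v (1, 0)]

theorem continuous_rowCross : Continuous rowCross := by
  refine continuous_pi fun i => ?_
  fin_cases i <;> simp [rowCross] <;> fun_prop

/-- The column degrees sum to zero, so two columns together have degree opposite to that of the
remaining one. -/
theorem rowCross_scale {c : ℂ} (hc : c ≠ 0) (v : Fin 2 × Fin 3 → ℂ) (j : Fin 3) :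
    rowCross (fun k => c ^ wt k.2 * v k) j = c ^ (-wt j) * rowCross v j := by
  have h2 : c ^ (2 : ℤ) = c ^ 2 := by norm_cast
  fin_cases j <;> simp [rowCross, wt, h2, zpow_neg] <;> field_simp

theorem rowCross_conj (v : Fin 2 × Fin 3 → ℂ) (j : Fin 3) :
    rowCross (fun k => starRingEnd ℂ (v k)) j = starRingEnd ℂ (rowCross v j) := by
  fin_cases j <;> simp [rowCross]

/-- The pairs of linearly dependent rows. -/
def dependentRows : Set (Fin 2 × Fin 3 → ℂ) := {v | rowCross v = 0}

theorem isClosed_dependentRows : IsClosed dependentRows :=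
  isClosed_eq continuous_rowCross continuous_const

theorem isInvariant_dependentRows :
    IsInvariant (fun k : Fin 2 × Fin 3 => wt k.2) dependentRows := by
  refine ⟨fun c hc v hv => ?_, fun v hv => ?_⟩
  · ext j
    rw [rowCross_scale hc, show rowCross v = 0 from hv]
    simp
  · ext j
    rw [rowCross_conj, show rowCross v = 0 from hv]
    simp

/-- Either the second row is a multiple of the first, which is parametrized by real dimension `2 +
6`, or the first row vanishes, which leaves dimension `6`. Since `3 + 8 < 12`, a source of dimension
up to 3 can avoid both. -/
theorem avoidable_dependentRows {E : Type*} [NormedAddCommGroup E] [NormedSpace ℝ E]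
    [FiniteDimensional ℝ E] (hE : Module.finrank ℝ E ≤ 3) : Avoidable E dependentRows := by
  have h6 : Module.finrank ℝ (Fin 3 → ℂ) = 6 := by
    rw [Module.finrank_pi_fintype]; simp
  have h12 : Module.finrank ℝ (Fin 2 × Fin 3 → ℂ) = 12 := by
    rw [Module.finrank_pi_fintype]; simp
  refine avoidable_of_subset_range (F₁ := ℂ × (Fin 3 → ℂ)) (F₂ := Fin 3 → ℂ)
    (q₁ := fun y k => ![1, y.1] k.1 * y.2 k.2) (q₂ := fun u k => ![0, 1] k.1 * u k.2) ?_ ?_ ?_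
    ?_ ?_
  · refine contDiff_pi.2 fun k => ContDiff.mul ?_ ?_
    · obtain ⟨i, j⟩ := k
      fin_cases i
      · simpa using contDiff_const
      · simpa using contDiff_fst
    · exact (contDiff_apply ℝ ℂ k.2).comp contDiff_snd
  · exact contDiff_pi.2 fun k => contDiff_const.mul (contDiff_apply ℝ ℂ k.2)
  · intro v hv
    have hv' : rowCross v = 0 := hv
    have e0 := congrFun hv' 0
    have e1 := congrFun hv' 1
    have e2 := congrFun hv' 2
    simp [rowCross] at e0 e1 e2
    by_cases h : ∃ j, v (0, j) ≠ 0
    · left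
      obtain ⟨j, hj⟩ := h
      refine ⟨(v (1, j) / v (0, j), fun i => v (0, i)), ?_⟩
      ext ⟨i, l⟩
      fin_cases i
      · simp
      · have : v (1, j) * v (0, l) = v (1, l) * v (0, j) := by
          fin_cases j <;> fin_cases l <;> simp only [Fin.zero_eta, Fin.mk_one, Fin.reduceFinMk] <;>
            first
            | rfl
            | linear_combination e0
            | linear_combination -e0
            | linear_combination e1
            | linear_combination -e1
            | linear_combination e2
            | linear_combination -e2
        simp only [Fin.mk_one, Matrix.cons_val_one, Matrix.cons_val_fin_one]
        rw [div_mul_eq_mul_div, this, mul_div_cancel_right₀ _ hj]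
    · right
      push Not at h
      refine ⟨fun i => v (1, i), ?_⟩
      ext ⟨i, l⟩
      fin_cases i
      · simp [h]
      · simp
  · rw [Module.finrank_prod, h6, h12, Complex.finrank_real_complex]
    omega
  · rw [h6, h12]
    omega

/-- The square matrix with the given first two rows and third row. -/
def rows (v : Fin 2 × Fin 3 → ℂ) (c : Fin 3 → ℂ) : Matrix (Fin 3) (Fin 3) ℂ :=
  ![fun j => v (0, j), fun j => v (1, j), c]

theorem det_rows (v : Fin 2 × Fin 3 → ℂ) (c : Fin 3 → ℂ) :
    (rows v c).det = ∑ j, rowCross v j * c j := by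
  rw [Matrix.det_fin_three]
  simp [rows, rowCross, Fin.sum_univ_three]
  ring

/-- The first two rows of a square matrix. -/
def topRows (M : Matrix (Fin 3) (Fin 3) ℂ) (k : Fin 2 × Fin 3) : ℂ := M k.1.castSucc k.2

theorem rows_topRows (M : Matrix (Fin 3) (Fin 3) ℂ) : rows (topRows M) (M 2) = M := by
  ext i j
  fin_cases i <;> rfl

theorem topRows_notMem {M : Matrix (Fin 3) (Fin 3) ℂ} (h : M.det ≠ 0) :
    topRows M ∉ dependentRows := by
  intro hM
  apply h
  rw [← rows_topRows M, det_rows, show rowCross (topRows M) = 0 from hM]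
  simp

/-- The square of the norm of the cross product of the rows, for a line bundle metric of value
`n`. -/
noncomputable def crossNorm (n : ℝ) (v : Fin 2 × Fin 3 → ℂ) : ℝ :=
  ∑ j, ‖rowCross v j‖ ^ 2 * n ^ wt j

theorem crossNorm_pos {n : ℝ} (hn : 0 < n) {v : Fin 2 × Fin 3 → ℂ} (hv : v ∉ dependentRows) :
    0 < crossNorm n v := by
  obtain ⟨j, hj⟩ := Function.ne_iff.1 hv
  refine Finset.sum_pos' (fun i _ => by positivity) ⟨j, Finset.mem_univ _, ?_⟩
  have : 0 < ‖rowCross v j‖ := norm_pos_iff.2 hj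
  positivity

/-- A third row completing two linearly independent rows to a matrix of determinant `1`. -/
noncomputable def complRow (n : ℝ) (v : Fin 2 × Fin 3 → ℂ) (j : Fin 3) : ℂ :=
  starRingEnd ℂ (rowCross v j) * ((n ^ wt j / crossNorm n v : ℝ) : ℂ)

theorem sum_rowCross_mul_complRow {n : ℝ} (hn : 0 < n) {v : Fin 2 × Fin 3 → ℂ}
    (hv : v ∉ dependentRows) : ∑ j, rowCross v j * complRow n v j = 1 := by
  have h : ∀ j, rowCross v j * complRow n v j =
      ((‖rowCross v j‖ ^ 2 * n ^ wt j / crossNorm n v : ℝ) : ℂ) := by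
    intro j
    rw [complRow, ← mul_assoc, Complex.mul_conj, Complex.normSq_eq_norm_sq]
    push_cast
    ring
  simp only [h]
  rw [← Complex.ofReal_sum, ← Finset.sum_div]
  rw [show ∑ j, ‖rowCross v j‖ ^ 2 * n ^ wt j = crossNorm n v from rfl,
    div_self (crossNorm_pos hn hv).ne', Complex.ofReal_one]

theorem crossNorm_scale {c : ℂ} (hc : c ≠ 0) (n : ℝ) (v : Fin 2 × Fin 3 → ℂ) :
    crossNorm (‖c‖ ^ 2 * n) (fun k => c ^ wt k.2 * v k) = crossNorm n v := by
  refine Finset.sum_congr rfl fun j _ => ?_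
  have hc' : ‖c‖ ≠ 0 := norm_ne_zero_iff.2 hc
  rw [rowCross_scale hc, norm_mul, mul_zpow, norm_zpow, zpow_neg, mul_pow, inv_pow, ← zpow_natCast,
    ← zpow_natCast, ← zpow_natCast, ← zpow_mul, ← zpow_mul, mul_comm (wt j)]
  field_simp

/-- The conjugated cross product has the inverse conjugate power of `c` as its factor. The metric
contributes a power of `‖c‖² = c · conj c`, which cancels it and leaves the power of `c` required of
a row. -/
theorem complRow_scale {c : ℂ} (hc : c ≠ 0) (n : ℝ) (v : Fin 2 × Fin 3 → ℂ) (j : Fin 3) :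
    complRow (‖c‖ ^ 2 * n) (fun k => c ^ wt k.2 * v k) j = c ^ wt j * complRow n v j := by
  rw [complRow, complRow, crossNorm_scale hc, rowCross_scale hc, mul_zpow]
  have h : (((‖c‖ ^ 2) ^ wt j : ℝ) : ℂ) = c ^ wt j * starRingEnd ℂ (c ^ wt j) := by
    rw [← Complex.normSq_eq_norm_sq, Complex.ofReal_zpow, ← Complex.mul_conj, mul_zpow, map_zpow₀]
  have h0 : starRingEnd ℂ (c ^ wt j) ≠ 0 := (map_ne_zero _).2 (zpow_ne_zero _ hc)
  rw [mul_div_assoc, Complex.ofReal_mul, h, map_mul, zpow_neg, map_inv₀]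
  field_simp

theorem complRow_conj (n : ℝ) (v : Fin 2 × Fin 3 → ℂ) (j : Fin 3) :
    complRow n (fun k => starRingEnd ℂ (v k)) j = starRingEnd ℂ (complRow n v j) := by
  have h : crossNorm n (fun k => starRingEnd ℂ (v k)) = crossNorm n v := by
    refine Finset.sum_congr rfl fun j _ => ?_
    rw [rowCross_conj, RCLike.norm_conj]
  rw [complRow, complRow, h, rowCross_conj, map_mul, Complex.conj_ofReal]

end Rows

/-! ### Rows, determinants and real quotients of matrix families -/

section RowFamilies

variable {B : Type*} [TopologicalSpace B] {σ : B → B} {L : B → Type*} [∀ x, AddCommGroup (L x)]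
  [∀ x, Module ℂ (L x)] [∀ x, TopologicalSpace (L x)] [TopologicalSpace (TotalSpace ℂ L)]
  [FiberBundle ℂ L] [VectorBundle ℂ ℂ L] {φ : Conjugation σ L}
  {T : Type*} [TopologicalSpace T] {f : T → B} {A : Set T} {τ : T → T}
  {M : T → TotalSpace ℂ L → Matrix (Fin 3) (Fin 3) ℂ}

theorem IsFrameFamily.topRows (h : IsFrameFamily φ f τ A M) :
    IsSec f (fun k : Fin 2 × Fin 3 => wt k.2) A (fun t p => topRows (M t p)) ∧
      IsRealSec φ f τ A fun t p => RealPairs.topRows (M t p) := by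
  refine ⟨⟨fun t ht p hp hp0 c hc k => h.sec.hom t ht p hp hp0 c hc (k.1.castSucc, k.2),
    fun a => continuousOn_pi.2 fun k => ?_⟩,
    fun t ht p hp hp0 k => h.real t ht p hp hp0 (k.1.castSucc, k.2)⟩
  exact (continuous_apply (k.1.castSucc, k.2)).comp_continuousOn (h.sec.cont a)

theorem IsFrameFamily.row (h : IsFrameFamily φ f τ A M) (i : Fin 3) :
    IsSec f wt A (fun t p => M t p i) ∧ IsRealSec φ f τ A fun t p => M t p i := by
  refine ⟨⟨fun t ht p hp hp0 c hc k => h.sec.hom t ht p hp hp0 c hc (i, k),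
    fun a => continuousOn_pi.2 fun k => ?_⟩, fun t ht p hp hp0 k => h.real t ht p hp hp0 (i, k)⟩
  exact (continuous_apply (i, k)).comp_continuousOn (h.sec.cont a)

theorem isFrameFamily_rows {R : T → TotalSpace ℂ L → Fin 2 × Fin 3 → ℂ}
    {C : T → TotalSpace ℂ L → Fin 3 → ℂ}
    (hR : IsSec f (fun k : Fin 2 × Fin 3 => wt k.2) A R) (hR' : IsRealSec φ f τ A R)
    (hC : IsSec f wt A C) (hC' : IsRealSec φ f τ A C)
    (hdet : ∀ t ∈ A, ∀ p : TotalSpace ℂ L, p.1 = f t → p.2 ≠ 0 → (rows (R t p) (C t p)).det ≠ 0) :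
    IsFrameFamily φ f τ A fun t p => rows (R t p) (C t p) := by
  refine ⟨⟨fun t ht p hp hp0 c hc k => ?_, fun a => continuousOn_pi.2 fun k => ?_⟩,
    fun t ht p hp hp0 k => ?_, hdet⟩
  · obtain ⟨i, j⟩ := k
    fin_cases i
    · exact hR.hom t ht p hp hp0 c hc (0, j)
    · exact hR.hom t ht p hp hp0 c hc (1, j)
    · exact hC.hom t ht p hp hp0 c hc j
  · obtain ⟨i, j⟩ := k
    fin_cases i
    · exact (continuous_apply (0, j)).comp_continuousOn (hR.cont a)
    · exact (continuous_apply (1, j)).comp_continuousOn (hR.cont a)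
    · exact (continuous_apply j).comp_continuousOn (hC.cont a)
  · obtain ⟨i, j⟩ := k
    fin_cases i
    · exact hR' t ht p hp hp0 (0, j)
    · exact hR' t ht p hp hp0 (1, j)
    · exact hC' t ht p hp hp0 j

/-- An invariant Hermitian metric on the line bundle. -/
structure IsMetric (φ : Conjugation σ L) (ν : TotalSpace ℂ L → ℝ) : Prop where
  continuous : Continuous ν
  pos : ∀ p, p.2 ≠ 0 → 0 < ν p
  scale : ∀ c p, ν (scale c p) = ‖c‖ ^ 2 * ν p
  tot : ∀ p, ν (φ.tot p) = ν p

theorem isSec_complRow {ν : TotalSpace ℂ L → ℝ} (hν : IsMetric φ ν) (hf : Continuous f)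
    {R : T → TotalSpace ℂ L → Fin 2 × Fin 3 → ℂ}
    (hR : IsSec f (fun k : Fin 2 × Fin 3 => wt k.2) A R) (hR' : IsRealSec φ f τ A R)
    (hav : ∀ t ∈ A, AvoidsAt f R dependentRows t) :
    IsSec f wt A (fun t p => complRow (ν p) (R t p)) ∧
      IsRealSec φ f τ A fun t p => complRow (ν p) (R t p) := by
  refine ⟨IsSec.of_continuousOn (fun t ht p hp hp0 c hc k => ?_) hf
    fun Q q hQ hq hqf hq0 => ?_, fun t ht p hp hp0 k => ?_⟩
  · have : R t (scale c p) = fun k => c ^ wt k.2 * R t p k := by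
      ext k
      exact hR.hom t ht p hp hp0 c hc k
    rw [hν.scale, this, complRow_scale hc]
  · have h1 : ContinuousOn (fun z => R z (q z)) Q :=
      hR.continuousOn_comp (s := fun z => z) continuousOn_id hq (fun z hz => hQ hz) hqf hq0
    have h2 : ContinuousOn (fun z => rowCross (R z (q z))) Q :=
      continuous_rowCross.comp_continuousOn h1
    have h2' : ∀ j, ContinuousOn (fun z => rowCross (R z (q z)) j) Q := fun j =>
      (continuous_apply j).comp_continuousOn h2
    have h3 : ∀ j, ContinuousOn (fun z => ν (q z) ^ wt j) Q := fun j =>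
      (hν.continuous.comp_continuousOn hq).zpow₀ _ fun z hz => Or.inl (hν.pos _ (hq0 z hz)).ne'
    have h4 : ContinuousOn (fun z => crossNorm (ν (q z)) (R z (q z))) Q :=
      continuousOn_finsetSum _ fun j _ => ((h2' j).norm.pow 2).mul (h3 j)
    refine continuousOn_pi.2 fun j => ?_
    exact (Complex.continuous_conj.comp_continuousOn (h2' j)).mul
      (Complex.continuous_ofReal.comp_continuousOn ((h3 j).div h4 fun z hz =>
        (crossNorm_pos (hν.pos _ (hq0 z hz)) (hav z (hQ hz) _ (hqf z hz) (hq0 z hz))).ne'))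
  · have : R (τ t) (φ.tot p) = fun k => starRingEnd ℂ (R t p k) := by
      ext k
      exact hR' t ht p hp hp0 k
    show complRow (ν (φ.tot p)) (R (τ t) (φ.tot p)) k = _
    rw [hν.tot, this, complRow_conj]

/-- The determinant as a function on the base. -/
theorem IsFrameFamily.exists_det (h : IsFrameFamily φ f τ Set.univ M) (hf : Continuous f)
    (hfτ : ∀ t, f (τ t) = σ (f t)) :
    ∃ D : C(T, ℂ), (∀ t, D t ≠ 0) ∧ (∀ t, D (τ t) = starRingEnd ℂ (D t)) ∧
      ∀ t, ∀ p : TotalSpace ℂ L, p.1 = f t → p.2 ≠ 0 → (M t p).det = D t := by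
  have hb : ∀ t, (⟨f t, baseVec L (f t)⟩ : TotalSpace ℂ L).2 ≠ 0 := fun t => baseVec_ne_zero _
  let D : T → ℂ := fun t => (M t ⟨f t, baseVec L (f t)⟩).det
  have hD : ∀ t, ∀ p : TotalSpace ℂ L, p.1 = f t → p.2 ≠ 0 → (M t p).det = D t := by
    intro t p hp hp0
    obtain ⟨c, hc, rfl⟩ := exists_scale_eq (p := ⟨f t, baseVec L (f t)⟩) (q := p) hp.symm (hb t) hp0
    have : ∀ i j, M t (scale c ⟨f t, baseVec L (f t)⟩) i j =
        c ^ wt j * M t ⟨f t, baseVec L (f t)⟩ i j := fun i j =>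
      h.sec.hom t trivial ⟨f t, baseVec L (f t)⟩ rfl (hb t) c hc (i, j)
    simp only [D, Matrix.det_fin_three, this, wt]
    have h2 : c ^ (2 : ℤ) = c ^ 2 := by norm_cast
    simp [h2]
    field_simp
  have hc : Continuous D := by
    refine continuous_iff_continuousAt.2 fun t => ?_
    have ha : f t ∈ (trivializationAt ℂ L (f t)).baseSet :=
      FiberBundle.mem_baseSet_trivializationAt' _
    have ho := ((trivializationAt ℂ L (f t)).open_baseSet.preimage hf).mem_nhds ha
    have h1 : ContinuousAt (fun s => fun k : Fin 3 × Fin 3 =>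
        M s (locSec L (f t) (f s)) k.1 k.2) t :=
      ((h.sec.cont (f t)).mono fun s hs => ⟨trivial, hs⟩).continuousAt ho
    have h2 : ContinuousAt (fun s => M s (locSec L (f t) (f s))) t :=
      continuousAt_pi.2 fun i => continuousAt_pi.2 fun j =>
        (continuous_apply (i, j)).continuousAt.comp h1
    have h3 : ContinuousAt (fun s => (M s (locSec L (f t) (f s))).det) t :=
      (Continuous.matrix_det continuous_id).continuousAt.comp h2
    refine h3.congr ?_
    filter_upwards [ho] with s hs using hD s _ rfl (locSec_snd_ne_zero hs)
  refine ⟨⟨D, hc⟩, fun t => h.det_ne_zero t trivial _ rfl (hb t), fun t => ?_, hD⟩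
  have := hD (τ t) (φ.tot ⟨f t, baseVec L (f t)⟩) (hfτ t).symm (φ.tot_snd_ne_zero (hb t))
  show D (τ t) = starRingEnd ℂ (D t)
  rw [← this]
  have hm : M (τ t) (φ.tot ⟨f t, baseVec L (f t)⟩) =
      (starRingEnd ℂ).mapMatrix (M t ⟨f t, baseVec L (f t)⟩) := by
    ext i j
    exact h.real t trivial _ rfl (hb t) (i, j)
  rw [hm, ← RingHom.map_det]

theorem continuousAt_matrix_inv {𝕜 : Type*} [RCLike 𝕜] {N : Matrix (Fin 3) (Fin 3) 𝕜} (hN : N.det ≠ 0) :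
    ContinuousAt (fun N : Matrix (Fin 3) (Fin 3) 𝕜 => N⁻¹) N := by
  have h : (fun N : Matrix (Fin 3) (Fin 3) 𝕜 => N⁻¹) = fun N => (N.det)⁻¹ • N.adjugate := by
    ext1 N
    rw [Matrix.inv_def, Ring.inverse_eq_inv']
  rw [h]
  exact ((Continuous.matrix_det continuous_id).continuousAt.inv₀ hN).smul
    (Continuous.matrix_adjugate continuous_id).continuousAt

/-- Over a base of fixed points, two families differ by a real matrix-valued function. -/
theorem IsFrameFamily.exists_real_quotient {N : T → TotalSpace ℂ L → Matrix (Fin 3) (Fin 3) ℂ}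
    (hM : IsFrameFamily φ f id Set.univ M) (hN : IsFrameFamily φ f id Set.univ N)
    (hf : Continuous f) (hσ : ∀ t, σ (f t) = f t) :
    ∃ γ : C(T, Matrix (Fin 3) (Fin 3) ℝ), (∀ t, (γ t).det ≠ 0) ∧
      ∀ t, ∀ p : TotalSpace ℂ L, p.1 = f t → p.2 ≠ 0 →
        (γ t).map Complex.ofReal * N t p = M t p := by
  have hb : ∀ t, (⟨f t, baseVec L (f t)⟩ : TotalSpace ℂ L).2 ≠ 0 := fun t => baseVec_ne_zero _
  -- The diagonal matrix of powers of `c` cancels in `M N⁻¹`, so the quotient does not depend on the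
  -- vector. Local sections then give its continuity and conjugate vectors its reality.
  let G : T → Matrix (Fin 3) (Fin 3) ℂ := fun t =>
    M t ⟨f t, baseVec L (f t)⟩ * (N t ⟨f t, baseVec L (f t)⟩)⁻¹
  have hNu : ∀ t, ∀ p : TotalSpace ℂ L, p.1 = f t → p.2 ≠ 0 → IsUnit (N t p).det :=
    fun t p hp hp0 => (hN.det_ne_zero t trivial p hp hp0).isUnit
  have hG : ∀ t, ∀ p : TotalSpace ℂ L, p.1 = f t → p.2 ≠ 0 → G t * N t p = M t p := by
    intro t p hp hp0
    obtain ⟨c, hc, rfl⟩ := exists_scale_eq (p := ⟨f t, baseVec L (f t)⟩) (q := p) hp.symm (hb t) hp0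
    have e : ∀ {F : T → TotalSpace ℂ L → Matrix (Fin 3) (Fin 3) ℂ},
        IsFrameFamily φ f id Set.univ F → F t (scale c ⟨f t, baseVec L (f t)⟩) =
          F t ⟨f t, baseVec L (f t)⟩ * Matrix.diagonal fun j => c ^ wt j := by
      intro F hF
      ext i j
      rw [Matrix.mul_diagonal, mul_comm]
      exact hF.sec.hom t trivial _ rfl (hb t) c hc (i, j)
    rw [e hN, e hM, ← Matrix.mul_assoc]
    congr 1
    simp only [G]
    rw [Matrix.mul_assoc, Matrix.nonsing_inv_mul _ (hNu t ⟨f t, baseVec L (f t)⟩ rfl (hb t)),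
      Matrix.mul_one]
  have hGeq : ∀ t, ∀ p : TotalSpace ℂ L, p.1 = f t → p.2 ≠ 0 → G t = M t p * (N t p)⁻¹ := by
    intro t p hp hp0
    rw [← hG t p hp hp0, Matrix.mul_assoc, Matrix.mul_nonsing_inv _ (hNu t p hp hp0),
      Matrix.mul_one]
  have hGreal : ∀ t i j, starRingEnd ℂ (G t i j) = G t i j := by
    intro t i j
    have hp : (φ.tot ⟨f t, baseVec L (f t)⟩).1 = f t := hσ t
    have hp0 := φ.tot_snd_ne_zero (hb t)
    have e : ∀ {F : T → TotalSpace ℂ L → Matrix (Fin 3) (Fin 3) ℂ},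
        IsFrameFamily φ f id Set.univ F → F t (φ.tot ⟨f t, baseVec L (f t)⟩) =
          (starRingEnd ℂ).mapMatrix (F t ⟨f t, baseVec L (f t)⟩) := by
      intro F hF
      ext i j
      exact hF.real t trivial _ rfl (hb t) (i, j)
    have h1 : (starRingEnd ℂ).mapMatrix (G t) * N t (φ.tot ⟨f t, baseVec L (f t)⟩) =
        M t (φ.tot ⟨f t, baseVec L (f t)⟩) := by
      rw [e hN, e hM, ← map_mul, hG t _ rfl (hb t)]
    have h2 : (starRingEnd ℂ).mapMatrix (G t) = G t := by
      conv_rhs => rw [hGeq t _ hp hp0, ← h1, Matrix.mul_assoc,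
        Matrix.mul_nonsing_inv _ (hNu t _ hp hp0), Matrix.mul_one]
    exact congrFun (congrFun h2 i) j
  have hGc : Continuous G := by
    refine continuous_iff_continuousAt.2 fun t => ?_
    have ha : f t ∈ (trivializationAt ℂ L (f t)).baseSet :=
      FiberBundle.mem_baseSet_trivializationAt' _
    have ho := ((trivializationAt ℂ L (f t)).open_baseSet.preimage hf).mem_nhds ha
    have e : ∀ {F : T → TotalSpace ℂ L → Matrix (Fin 3) (Fin 3) ℂ},
        IsFrameFamily φ f id Set.univ F →
          ContinuousAt (fun s => F s (locSec L (f t) (f s))) t := by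
      intro F hF
      have h1 : ContinuousAt (fun s => fun k : Fin 3 × Fin 3 =>
          F s (locSec L (f t) (f s)) k.1 k.2) t :=
        ((hF.sec.cont (f t)).mono fun s hs => ⟨trivial, hs⟩).continuousAt ho
      exact continuousAt_pi.2 fun i => continuousAt_pi.2 fun j =>
        (continuous_apply (i, j)).continuousAt.comp h1
    have h3 : ContinuousAt (fun s => (N s (locSec L (f t) (f s)))⁻¹) t :=
      ContinuousAt.comp (g := fun N : Matrix (Fin 3) (Fin 3) ℂ => N⁻¹)
        (continuousAt_matrix_inv (hN.det_ne_zero t trivial _ rfl (locSec_snd_ne_zero ha))) (e hN)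
    refine ((e hM).mul h3).congr ?_
    filter_upwards [ho] with s hs using (hGeq s _ rfl (locSec_snd_ne_zero hs)).symm
  have hmap : ∀ t, ((G t).map Complex.re).map Complex.ofReal = G t := by
    intro t
    ext i j
    simpa using Complex.conj_eq_iff_re.1 (hGreal t i j)
  refine ⟨⟨fun t => (G t).map Complex.re, ?_⟩, fun t h0 => ?_, fun t p hp hp0 => ?_⟩
  · exact hGc.matrix_map Complex.continuous_re
  · have h1 : (G t).det = 0 := by
      rw [← hmap t]
      have := RingHom.map_det Complex.ofRealHom ((G t).map Complex.re)
      rw [show ((G t).map Complex.re).det = 0 from h0, map_zero] at this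
      exact this.symm
    have h2 := congrArg Matrix.det (hG t ⟨f t, baseVec L (f t)⟩ rfl (hb t))
    rw [Matrix.det_mul, h1, zero_mul] at h2
    exact hM.det_ne_zero t trivial _ rfl (hb t) h2.symm
  · show ((G t).map Complex.re).map Complex.ofReal * N t p = M t p
    rw [hmap]
    exact hG t p hp hp0

end RowFamilies

/-- The family `γ` of real invertible matrices is homotopic to the identity. -/
def Null {Z : Type*} [TopologicalSpace Z] (γ : Z → Matrix (Fin 3) (Fin 3) ℝ) : Prop :=
  ∃ H : C(unitInterval × Z, Matrix (Fin 3) (Fin 3) ℝ), (∀ p, (H p).det ≠ 0) ∧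
    (∀ z, H (0, z) = 1) ∧ ∀ z, H (1, z) = γ z

theorem det_map_ofReal (M : Matrix (Fin 3) (Fin 3) ℝ) :
    (M.map Complex.ofReal).det = (M.det : ℂ) :=
  (RingHom.map_det Complex.ofRealHom M).symm

theorem map_ofReal_mul (M N : Matrix (Fin 3) (Fin 3) ℝ) :
    (M * N).map Complex.ofReal = M.map Complex.ofReal * N.map Complex.ofReal :=
  map_mul Complex.ofRealHom.mapMatrix M N

theorem map_ofReal_one : (1 : Matrix (Fin 3) (Fin 3) ℝ).map Complex.ofReal = 1 :=
  map_one Complex.ofRealHom.mapMatrix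

theorem map_ofReal_injective {M N : Matrix (Fin 3) (Fin 3) ℝ}
    (h : M.map Complex.ofReal = N.map Complex.ofReal) : M = N :=
  Matrix.map_injective Complex.ofReal_injective h

theorem eq_of_map_ofReal_mul_eq {M N : Matrix (Fin 3) (Fin 3) ℝ} {P : Matrix (Fin 3) (Fin 3) ℂ}
    (hP : P.det ≠ 0) (h : M.map Complex.ofReal * P = N.map Complex.ofReal * P) : M = N := by
  have := congrArg (· * P⁻¹) h
  simp only [Matrix.mul_assoc, Matrix.mul_nonsing_inv _ hP.isUnit, Matrix.mul_one] at this
  exact map_ofReal_injective this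

theorem det_rows_combination (v : Fin 2 × Fin 3 → ℂ) (a b : Fin 3 → ℂ) (x y : ℂ) :
    (rows v fun j => x * a j + y * b j).det =
      x * ∑ j, rowCross v j * a j + y * ∑ j, rowCross v j * b j := by
  simp only [det_rows, Fin.sum_univ_three]
  ring

/-! ### Isomorphisms are determined by their real parts -/

section Core

variable {B : Type*} [TopologicalSpace B] {σ : B → B} {L : B → Type*} [∀ x, AddCommGroup (L x)]
  [∀ x, Module ℂ (L x)] [∀ x, TopologicalSpace (L x)] [TopologicalSpace (TotalSpace ℂ L)]
  [FiberBundle ℂ L] [VectorBundle ℂ ℂ L] {φ : Conjugation σ L}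
  {T : Type*} [TopologicalSpace T] {f : T → B} {A : Set T} {τ : T → T}
  {M : T → TotalSpace ℂ L → Matrix (Fin 3) (Fin 3) ℂ}

/-- The space `S` over `T` is locally embedded into `T` and into `E` away from `A`. -/
structure IsSpread {S T : Type*} [TopologicalSpace S] [TopologicalSpace T] (E : Type*)
    [TopologicalSpace E] (q : S → T) (A : Set T) : Prop where
  continuous : Continuous q
  surjective : Function.Surjective q
  exists_nhds : ∀ x, q x ∉ A → ∃ K ∈ 𝓝 x, Set.InjOn q K ∧
    ∃ j : S → E, ContinuousOn j K ∧ Set.InjOn j K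

theorem IsSpread.prod {S T : Type*} [TopologicalSpace S] [TopologicalSpace T] {E : Type*}
    [TopologicalSpace E] {q : S → T} {A : Set T} (h : IsSpread E q A)
    {A' : Set (unitInterval × T)} (hA : ∀ t, t.2 ∈ A → t ∈ A') :
    IsSpread (ℝ × E) (fun x : unitInterval × S => (x.1, q x.2)) A' := by
  refine ⟨by have := h.continuous; fun_prop, fun t => ?_, fun x hx => ?_⟩
  · obtain ⟨y, hy⟩ := h.surjective t.2
    exact ⟨(t.1, y), by simp [hy]⟩
  · obtain ⟨K, hK, hKi, j, hj, hji⟩ := h.exists_nhds x.2 fun h => hx (hA _ h)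
    refine ⟨Prod.snd ⁻¹' K, continuous_snd.continuousAt.preimage_mem_nhds hK, ?_,
      fun y => (y.1.1, j y.2), ?_, ?_⟩
    · intro y hy z hz hyz
      simp only [Prod.mk.injEq] at hyz
      exact Prod.ext hyz.1 (hKi hy hz hyz.2)
    · exact (by fun_prop : Continuous fun y : unitInterval × S => y.1.1).continuousOn.prodMk
        (hj.comp continuousOn_snd fun y hy => hy)
    · intro y hy z hz hyz
      simp only [Prod.mk.injEq] at hyz
      exact Prod.ext (Subtype.ext hyz.1) (hji hy hz hyz.2)

theorem IsFrameFamily.mul_left (h : IsFrameFamily φ f τ Set.univ M)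
    {g : T → Matrix (Fin 3) (Fin 3) ℝ} (hg : Continuous g) (hgτ : ∀ t, g (τ t) = g t)
    (hdet : ∀ t, (g t).det ≠ 0) :
    IsFrameFamily φ f τ Set.univ fun t p => (g t).map Complex.ofReal * M t p := by
  refine ⟨⟨fun t ht p hp hp0 c hc k => ?_, fun a => continuousOn_pi.2 fun k => ?_⟩,
    fun t ht p hp hp0 k => ?_, fun t ht p hp hp0 => ?_⟩
  · simp only [Matrix.mul_apply, Finset.mul_sum]
    refine Finset.sum_congr rfl fun j _ => ?_
    rw [h.sec.hom t ht p hp hp0 c hc (j, k.2)]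
    ring
  · simp only [Matrix.mul_apply, Matrix.map_apply]
    refine continuousOn_finsetSum _ fun j _ => ContinuousOn.mul ?_ ?_
    · exact (Complex.continuous_ofReal.comp (hg.matrix_elem k.1 j)).continuousOn
    · exact (continuous_apply (j, k.2)).comp_continuousOn (h.sec.cont a)
  · simp only [Matrix.mul_apply, hgτ, map_sum, map_mul, Matrix.map_apply, Complex.conj_ofReal]
    refine Finset.sum_congr rfl fun j _ => ?_
    exact congrArg (fun z => ((g t k.1 j : ℝ) : ℂ) * z) (h.real t ht p hp hp0 (j, k.2))
  · rw [Matrix.det_mul, det_map_ofReal]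
    exact mul_ne_zero (Complex.ofReal_ne_zero.2 (hdet t)) (h.det_ne_zero t ht p hp hp0)

open Classical in
theorem IsFrameFamily.of_subtype {C : Set T} {N : C → TotalSpace ℂ L → Matrix (Fin 3) (Fin 3) ℂ}
    (hC : ∀ t ∈ C, τ t = t) (h : IsFrameFamily φ (fun c : C => f c) id Set.univ N) :
    IsFrameFamily φ f τ C fun t p => if ht : t ∈ C then N ⟨t, ht⟩ p else 0 := by
  refine ⟨⟨fun t ht p hp hp0 c hc k => ?_, fun a => ?_⟩, fun t ht p hp hp0 k => ?_,
    fun t ht p hp hp0 => ?_⟩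
  · simp only [dif_pos ht]
    exact h.sec.hom ⟨t, ht⟩ trivial p hp hp0 c hc k
  · have h1 := h.sec.cont a
    rw [Set.univ_inter] at h1
    intro t ht
    have h2 := h1 ⟨t, ht.1⟩ ht.2
    have h3 := (h2.comp (f := fun s : ↥(C ∩ f ⁻¹' (trivializationAt ℂ L a).baseSet) =>
      (⟨s.1, s.2.1⟩ : C)) (s := Set.univ) (x := ⟨t, ht⟩)
      (Continuous.continuousWithinAt (by fun_prop)) fun s _ => s.2.2)
    rw [continuousWithinAt_univ] at h3
    refine (continuousWithinAt_iff_continuousAt_domRestrict _ ht).2 (h3.congr ?_)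
    filter_upwards with s
    simp [Set.domRestrict, s.2.1]
  · have hF : τ t = t := hC t ht
    simp only [hF, dif_pos ht]
    exact h.real ⟨t, ht⟩ trivial p hp hp0 k
  · simp only [dif_pos ht]
    exact h.det_ne_zero ⟨t, ht⟩ trivial p hp hp0

theorem IsRealSec.mul {κ : Type*} {r : T → TotalSpace ℂ L → κ → ℂ} (h : IsRealSec φ f τ A r)
    {g : T → ℂ} (hg : ∀ t ∈ A, g (τ t) = starRingEnd ℂ (g t)) :
    IsRealSec φ f τ A fun t p k => g t * r t p k := by
  intro t ht p hp hp0 k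
  simp only [hg t ht, h t ht p hp hp0 k, map_mul]

theorem IsRealSec.add {κ : Type*} {r r' : T → TotalSpace ℂ L → κ → ℂ}
    (h : IsRealSec φ f τ A r) (h' : IsRealSec φ f τ A r') :
    IsRealSec φ f τ A fun t p k => r t p k + r' t p k := by
  intro t ht p hp hp0 k
  simp only [h t ht p hp hp0 k, h' t ht p hp hp0 k, map_add]

theorem IsFrameFamily.avoidsAt (h : IsFrameFamily φ f τ A M) {t : T} (ht : t ∈ A) :
    AvoidsAt f (fun t p => RealPairs.topRows (M t p)) dependentRows t :=
  fun p hp hp0 => topRows_notMem (h.det_ne_zero t ht p hp hp0)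

/-- The determinant `D` along the homotopy, normalized by its initial value, multiplies the given
homotopy of functions. The factor is `1` at time `0` and the ratio of the two determinants at time
`1`. -/
theorem RealIso.HasCanonicalDet.of_homotopic {Ψ₀ Ψ₁ : RealIso φ}
    (h₀ : Ψ₀.HasCanonicalDet) (h : Ψ₀.Homotopic Ψ₁) : Ψ₁.HasCanonicalDet := by
  obtain ⟨k, hk0, hkσ, hk1, hkd⟩ := h₀
  obtain ⟨M, hM, hM01⟩ := homotopic_iff.1 h
  obtain ⟨D, hD0, hDσ, hD⟩ := hM.exists_det continuous_snd fun _ => rfl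
  refine ⟨⟨fun t => k t * (D t / D (0, t.2)), ?_⟩, fun t => ?_, fun t x => ?_, fun x => ?_,
    fun x v hv => ?_⟩
  · refine k.continuous.mul (D.continuous.div (by fun_prop) fun t => hD0 _)
  · exact mul_ne_zero (hk0 t) (div_ne_zero (hD0 _) (hD0 _))
  · show k (t, σ x) * (D (t, σ x) / D (0, σ x)) = starRingEnd ℂ (k (t, x) * (D (t, x) / D (0, x)))
    rw [hkσ, hDσ (t, x), hDσ (0, x), map_mul, map_div₀]
  · show k (0, x) * (D (0, x) / D (0, x)) = 1
    rw [hk1, div_self (hD0 _), mul_one]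
  · show k (1, x) * (D (1, x) / D (0, x)) = _
    have e0 : D (0, x) = (Ψ₀.matrix v).det := by
      rw [← hD (0, x) ⟨x, v⟩ rfl hv]
      exact congrArg Matrix.det (hM01 ⟨x, v⟩ hv).1
    have e1 : D (1, x) = (Ψ₁.matrix v).det := by
      rw [← hD (1, x) ⟨x, v⟩ rfl hv]
      exact congrArg Matrix.det (hM01 ⟨x, v⟩ hv).2
    rw [hkd x v hv, ← e0, mul_div_cancel₀ _ (hD0 _), e1]

theorem RealIso.hasCanonicalDet_of_det_eq_one {Ψ : RealIso φ}
    (h : ∀ p : TotalSpace ℂ L, p.2 ≠ 0 → (Ψ.mat p).det = 1) : Ψ.HasCanonicalDet :=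
  ⟨1, fun _ => one_ne_zero, fun _ _ => by simp, fun _ => rfl, fun x v hv => (h ⟨x, v⟩ hv).symm⟩

/-- Over the fixed locus the homotopy divided by its initial isomorphism is a path of real matrices
starting at `1`. -/
theorem RealIso.Homotopic.exists_null {Ψ₀ Ψ₁ : RealIso φ}
    (h : Ψ₀.Homotopic Ψ₁) : ∃ γ : Function.fixedPoints σ → Matrix (Fin 3) (Fin 3) ℝ, Null γ ∧
      ∀ y : Function.fixedPoints σ, ∀ p : TotalSpace ℂ L, p.1 = y → p.2 ≠ 0 →
        (γ y).map Complex.ofReal * Ψ₀.mat p = Ψ₁.mat p := by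
  obtain ⟨M, hM, hM01⟩ := homotopic_iff.1 h
  have hM' := hM.comp (s := fun t : unitInterval × Function.fixedPoints σ => (t.1, t.2.1))
    (by fun_prop) (τ' := id) fun t => Prod.ext rfl t.2.2.symm
  have hN := Ψ₀.isFrameFamily.comp (s := fun t : unitInterval × Function.fixedPoints σ => t.2.1)
    (by fun_prop) (τ' := id) fun t => t.2.2.symm
  obtain ⟨γ, hγ0, hγ⟩ := hM'.exists_real_quotient hN (by fun_prop) fun t => t.2.2
  refine ⟨fun y => γ (1, y), ⟨γ, hγ0, fun y => ?_, fun _ => rfl⟩, fun y p hp hp0 => ?_⟩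
  · have hb := baseVec_ne_zero (L := L) y.1
    refine eq_of_map_ofReal_mul_eq (P := Ψ₀.mat ⟨y.1, baseVec L y.1⟩) (Ψ₀.det_matrix_ne_zero hb) ?_
    rw [map_ofReal_one, Matrix.one_mul, hγ (0, y) ⟨y.1, baseVec L y.1⟩ rfl hb]
    exact (hM01 ⟨y.1, baseVec L y.1⟩ hb).1
  · rw [hγ (1, y) p hp hp0, ← hp]
    exact (hM01 p hp0).2

variable [CompactSpace B] [T2Space B]

/-- With the first two rows fixed, the determinant is linear in the third. The third row can
therefore be moved to the standard one while the determinant follows the given homotopy to `1`. -/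
theorem RealIso.HasCanonicalDet.exists_homotopic_rows {ν : TotalSpace ℂ L → ℝ}
    (hν : IsMetric φ ν) {Ψ : RealIso φ} (hΨ : Ψ.HasCanonicalDet) :
    ∃ Ψ' : RealIso φ, Ψ.Homotopic Ψ' ∧ ∀ p : TotalSpace ℂ L, p.2 ≠ 0 →
      Ψ'.mat p = rows (topRows (Ψ.mat p)) (complRow (ν p) (topRows (Ψ.mat p))) := by
  have hF := Ψ.isFrameFamily
  have hR := hF.topRows
  have hC := isSec_complRow hν continuous_id hR.1 hR.2 fun t ht => hF.avoidsAt ht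
  have hdet : ∀ p : TotalSpace ℂ L, p.2 ≠ 0 →
      (rows (topRows (Ψ.mat p)) (complRow (ν p) (topRows (Ψ.mat p)))).det = 1 := fun p hp => by
    rw [det_rows, sum_rowCross_mul_complRow (hν.pos p hp)
      (topRows_notMem (M := Ψ.mat p) (Ψ.det_matrix_ne_zero hp))]
  have hF' : IsFrameFamily φ (fun x => x) σ Set.univ fun _ p =>
      rows (topRows (Ψ.mat p)) (complRow (ν p) (topRows (Ψ.mat p))) :=
    isFrameFamily_rows hR.1 hR.2 hC.1 hC.2 fun t _ p _ hp0 => by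
      rw [hdet p hp0]
      exact one_ne_zero
  refine ⟨realIsoOfMat _ hF', homotopic_iff.2 ?_, fun p hp => realIsoOfMat_mat hF' hp⟩
  obtain ⟨k, hk0, hkσ, hk1, hkd⟩ := hΨ
  -- The original third row gives determinant `k (1, x)` and the standard one gives `1`. With these
  -- coefficients the determinant at time `t` is `k (1 - t, x)`, which never vanishes.
  let g₀ : unitInterval × B → ℂ := fun t =>
    (1 - (t.1.1 : ℂ)) * (k (unitInterval.symm t.1, t.2) / k (1, t.2))
  let g₁ : unitInterval × B → ℂ := fun t => (t.1.1 : ℂ) * k (unitInterval.symm t.1, t.2)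
  have hg₀ : Continuous g₀ := by
    refine Continuous.mul (by fun_prop) (Continuous.div (by fun_prop) (by fun_prop) fun t => hk0 _)
  have hg₁ : Continuous g₁ := by fun_prop
  have hg₀σ : ∀ t, g₀ (t.1, σ t.2) = starRingEnd ℂ (g₀ t) := fun t => by
    simp only [g₀, hkσ, map_mul, map_div₀, map_sub, map_one, Complex.conj_ofReal]
  have hg₁σ : ∀ t, g₁ (t.1, σ t.2) = starRingEnd ℂ (g₁ t) := fun t => by
    simp only [g₁, hkσ, map_mul, Complex.conj_ofReal]
  have hFI := hF.comp (s := fun t : unitInterval × B => t.2) continuous_snd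
    (τ' := fun t => (t.1, σ t.2)) fun _ => rfl
  have hFI' := hF'.comp (s := fun t : unitInterval × B => t.2) continuous_snd
    (τ' := fun t => (t.1, σ t.2)) fun _ => rfl
  have hrows := isFrameFamily_rows (hFI.topRows).1 (hFI.topRows).2
    (((hFI.row 2).1.mul (g := fun t _ => g₀ t)
      (continuous_pi fun _ => hg₀).continuousOn).add ((hFI'.row 2).1.mul (g := fun t _ => g₁ t)
      (continuous_pi fun _ => hg₁).continuousOn))
    (((hFI.row 2).2.mul fun t _ => hg₀σ t).add ((hFI'.row 2).2.mul fun t _ => hg₁σ t))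
    (fun t _ p hp hp0 => by
      have e1 : ∑ j, rowCross (topRows (Ψ.mat p)) j * Ψ.mat p 2 j = k (1, t.2) := by
        rw [← det_rows, rows_topRows]
        obtain ⟨x, v⟩ := p
        obtain rfl : x = t.2 := hp
        exact (hkd _ v hp0).symm
      have e2 := hdet p hp0
      rw [det_rows] at e2
      have e3 : (rows (topRows (Ψ.mat p)) fun j => g₀ t * Ψ.mat p 2 j + g₁ t *
          rows (topRows (Ψ.mat p)) (complRow (ν p) (topRows (Ψ.mat p))) 2 j).det =
          g₀ t * k (1, t.2) + g₁ t := by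
        rw [det_rows_combination, e1]
        exact (congrArg (fun z => g₀ t * k (1, t.2) + g₁ t * z) e2).trans (by rw [mul_one])
      rw [e3]
      have e4 : g₀ t * k (1, t.2) + g₁ t = k (unitInterval.symm t.1, t.2) := by
        simp only [g₀, g₁]
        field_simp [hk0 (1, t.2)]
        ring
      rw [e4]
      exact hk0 _)
  refine ⟨_, hrows, fun p hp => ⟨?_, ?_⟩⟩
  · have : (fun j => g₀ (0, p.1) * Ψ.mat p 2 j + g₁ (0, p.1) *
        rows (topRows (Ψ.mat p)) (complRow (ν p) (topRows (Ψ.mat p))) 2 j) = Ψ.mat p 2 := by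
      ext j
      simp [g₀, g₁, hk0]
    simp only [this, rows_topRows]
  · rw [realIsoOfMat_mat hF' hp]
    have : (fun j => g₀ (1, p.1) * Ψ.mat p 2 j + g₁ (1, p.1) *
        rows (topRows (Ψ.mat p)) (complRow (ν p) (topRows (Ψ.mat p))) 2 j) =
        complRow (ν p) (topRows (Ψ.mat p)) := by
      ext j
      simp [g₀, g₁, hk1, rows]
    simp only [this]

variable {S : Type*} [TopologicalSpace S] [CompactSpace S] [T2Space S] {q : S → B}

theorem isClosed_fixedPoints' (hσ : Continuous σ) : IsClosed (Function.fixedPoints σ) :=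
  isClosed_eq hσ continuous_id

/-- Isomorphisms with canonical determinant are classified by their restrictions to the real
parts. -/
theorem RealIso.homotopic_of_null (hσ : Continuous σ) (hσσ : Function.Involutive σ)
    (hq : IsSpread (EuclideanSpace ℝ (Fin 2)) q (Function.fixedPoints σ)) {Ψ₀ Ψ₁ : RealIso φ}
    (h₀ : Ψ₀.HasCanonicalDet) (h₁ : Ψ₁.HasCanonicalDet)
    {γ : Function.fixedPoints σ → Matrix (Fin 3) (Fin 3) ℝ} (hγ : Null γ)
    (hγΨ : ∀ y : Function.fixedPoints σ, ∀ p : TotalSpace ℂ L, p.1 = y → p.2 ≠ 0 →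
        (γ y).map Complex.ofReal * Ψ₀.mat p = Ψ₁.mat p) : Ψ₀.Homotopic Ψ₁ := by
  classical
  obtain ⟨ν, hν1, hν2, hν3, hν4⟩ := exists_metric φ
  have hν : IsMetric φ ν := ⟨hν1, hν2, hν3, hν4⟩
  obtain ⟨Ψ₀', hh₀, hΨ₀'⟩ := h₀.exists_homotopic_rows hν
  obtain ⟨Ψ₁', hh₁, hΨ₁'⟩ := h₁.exists_homotopic_rows hν
  -- After this normalization the third rows are functions of the first two, so only the first two
  -- rows need to be deformed.
  refine hh₀.trans (Homotopic.trans ?_ hh₁.symm)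
  obtain ⟨H, hH, hH0, hH1⟩ := hγ
  let f : unitInterval × B → B := fun t => t.2
  let τ : unitInterval × B → unitInterval × B := fun t => (t.1, σ t.2)
  have hfτ : ∀ t, f (τ t) = σ (f t) := fun _ => rfl
  have hτ : Continuous τ := by fun_prop
  have hττ : Function.Involutive τ := fun t => Prod.ext rfl (hσσ t.2)
  let C : Set (unitInterval × B) := {t | t.2 ∈ Function.fixedPoints σ}
  have hCc : IsClosed C := (isClosed_fixedPoints' hσ).preimage continuous_snd
  let G : C → TotalSpace ℂ L → Matrix (Fin 3) (Fin 3) ℂ := fun c p =>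
    (H (c.1.1, ⟨c.1.2, c.2⟩)).map Complex.ofReal * Ψ₀.mat p
  have hG : IsFrameFamily φ (fun c : C => f c) id Set.univ G :=
    (Ψ₀.isFrameFamily.comp (s := fun c : C => c.1.2) (by fun_prop) (τ' := id)
      fun c => c.2.symm).mul_left (g := fun c => H (c.1.1, ⟨c.1.2, c.2⟩)) (by fun_prop)
      (fun _ => rfl) fun _ => hH _
  have hG' := hG.of_subtype (C := C) (f := f) (τ := τ) fun t ht => Prod.ext rfl ht
  have hI := fun Ψ : RealIso φ => Ψ.isFrameFamily.comp (s := f) continuous_snd (τ' := τ)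
    fun _ => rfl
  -- The prescribed values on both ends and over the fixed locus. They agree on overlaps because `H`
  -- runs from `1` to `γ`, and `γ` carries `Ψ₀` to `Ψ₁`.
  let F : unitInterval × B → TotalSpace ℂ L → Matrix (Fin 3) (Fin 3) ℂ := fun t p =>
    if t.1 = 0 then Ψ₀.mat p else if t.1 = 1 then Ψ₁.mat p else
      if ht : t ∈ C then G ⟨t, ht⟩ p else 0
  have hF0 : IsFrameFamily φ f τ {t | t.1 = 0} F := by
    refine IsFrameFamily.congr (M := fun _ p => Ψ₀.mat p) ⟨(hI Ψ₀).sec.mono (Set.subset_univ _),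
      fun t _ => (hI Ψ₀).real t trivial, fun t _ => (hI Ψ₀).det_ne_zero t trivial⟩
      (fun t ht => ht) hfτ fun t ht p hp hp0 => ?_
    exact if_pos ht
  have hF1 : IsFrameFamily φ f τ {t | t.1 = 1} F := by
    refine IsFrameFamily.congr (M := fun _ p => Ψ₁.mat p) ⟨(hI Ψ₁).sec.mono (Set.subset_univ _),
      fun t _ => (hI Ψ₁).real t trivial, fun t _ => (hI Ψ₁).det_ne_zero t trivial⟩
      (fun t ht => ht) hfτ fun t ht p hp hp0 => ?_
    have h1 : t.1 = 1 := ht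
    simp [F, h1]
  have hFC : IsFrameFamily φ f τ C F := by
    refine hG'.congr (fun t ht => by
      show σ (σ t.2) = σ t.2
      rw [hσσ t.2]
      exact ht.symm) hfτ fun t ht p hp hp0 => ?_
    simp only [F, dif_pos ht]
    split_ifs with h0 h1
    · have : H (t.1, ⟨t.2, ht⟩) = 1 := by rw [h0]; exact hH0 _
      simp only [G, this, map_ofReal_one, Matrix.one_mul]
    · have : H (t.1, ⟨t.2, ht⟩) = γ ⟨t.2, ht⟩ := by rw [h1]; exact hH1 _
      simp only [G, this]
      exact (hγΨ ⟨t.2, ht⟩ p hp hp0).symm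
    · rfl
  have hc0 : IsClosed {t : unitInterval × B | t.1 = 0} :=
    isClosed_eq continuous_fst continuous_const
  have hc1 : IsClosed {t : unitInterval × B | t.1 = 1} :=
    isClosed_eq continuous_fst continuous_const
  let A : Set (unitInterval × B) := ({t | t.1 = 0} ∪ {t | t.1 = 1}) ∪ C
  have hFA : IsFrameFamily φ f τ A F := (hF0.union hF1 hc0 hc1).union hFC (hc0.union hc1) hCc
  have hAc : IsClosed A := (hc0.union hc1).union hCc
  have hA : ∀ t ∈ A, τ t ∈ A := by
    rintro t ((ht | ht) | ht)
    · exact Or.inl (Or.inl ht)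
    · exact Or.inl (Or.inr ht)
    · refine Or.inr ?_
      show σ (σ t.2) = σ t.2
      rw [hσσ t.2]
      exact ht.symm
  obtain ⟨r, hr, hr', hrA⟩ := exists_isSec_extension φ (continuous_snd : Continuous f) hτ hττ hfτ
    hAc hA hFA.topRows.1 hFA.topRows.2
  have hspread := hq.prod (A' := A) fun t ht => Or.inr ht
  -- This is where the dimension of `I × Σ`, at most 3, is used. The involution is free off `A`
  -- because `A` contains the whole cylinder over the fixed locus.
  obtain ⟨R, hR, hR', hRA, hRav⟩ := exists_avoiding (E := ℝ × EuclideanSpace ℝ (Fin 2)) φ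
    (continuous_snd : Continuous f) hτ hττ hfτ hAc hA isInvariant_dependentRows
    isClosed_dependentRows (avoidable_dependentRows (by simp [Module.finrank_prod])) hr hr'
    (fun t ht p hp hp0 => by
      rw [hrA t ht p hp hp0]
      exact hFA.avoidsAt ht p hp hp0)
    (exists_pieces hspread.continuous hspread.surjective continuous_snd hτ hAc
      (fun t ht h => ht (Or.inr (congrArg Prod.snd h))) hspread.exists_nhds)
  have hCR := isSec_complRow hν continuous_snd hR hR' fun t _ => hRav t
  refine homotopic_iff.2 ⟨_, isFrameFamily_rows hR hR' hCR.1 hCR.2 fun t _ p hp hp0 => ?_,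
    fun p hp => ⟨?_, ?_⟩⟩
  · rw [det_rows, sum_rowCross_mul_complRow (hν.pos p hp0) (hRav t p hp hp0)]
    exact one_ne_zero
  · have h0 : ((0, p.1) : unitInterval × B) ∈ A := Or.inl (Or.inl rfl)
    have : R (0, p.1) p = topRows (Ψ₀.mat p) := by
      rw [hRA _ h0, hrA _ h0 p rfl hp]
      simp [F]
    rw [this, hΨ₀' p hp]
  · have h0 : ((1, p.1) : unitInterval × B) ∈ A := Or.inl (Or.inr rfl)
    have : R (1, p.1) p = topRows (Ψ₁.mat p) := by
      rw [hRA _ h0, hrA _ h0 p rfl hp]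
      simp [F]
    rw [this, hΨ₁' p hp]

/-- Every trivialization of the real part of determinant `1` extends up to homotopy. -/
theorem exists_realIso_extension (hσ : Continuous σ) (hσσ : Function.Involutive σ)
    (hq : IsSpread (EuclideanSpace ℝ (Fin 2)) q (Function.fixedPoints σ))
    {N : Function.fixedPoints σ → TotalSpace ℂ L → Matrix (Fin 3) (Fin 3) ℂ}
    (hN : IsFrameFamily φ (fun y : Function.fixedPoints σ => y.1) id Set.univ N)
    (hN1 : ∀ y : Function.fixedPoints σ, ∀ p : TotalSpace ℂ L, p.1 = y → p.2 ≠ 0 →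
      (N y p).det = 1) :
    ∃ Ψ : RealIso φ, Ψ.HasCanonicalDet ∧
      ∃ γ : Function.fixedPoints σ → Matrix (Fin 3) (Fin 3) ℝ, Null γ ∧
        ∀ y : Function.fixedPoints σ, ∀ p : TotalSpace ℂ L, p.1 = y → p.2 ≠ 0 →
          (γ y).map Complex.ofReal * N y p = Ψ.mat p := by
  classical
  obtain ⟨ν, hν1, hν2, hν3, hν4⟩ := exists_metric φ
  have hν : IsMetric φ ν := ⟨hν1, hν2, hν3, hν4⟩
  have hYc := isClosed_fixedPoints' hσ
  have hF := hN.of_subtype (C := Function.fixedPoints σ) (f := fun x => x) (τ := σ) fun t ht => ht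
  have hA : ∀ t ∈ Function.fixedPoints σ, σ t ∈ Function.fixedPoints σ := fun t ht => by
    show σ (σ t) = σ t
    rw [hσσ t]
    exact ht.symm
  -- Only the first two rows of `N` are extended. The third is replaced by the metric completion,
  -- and the discrepancy over the real part is what `γ` records.
  obtain ⟨r, hr, hr', hrA⟩ := exists_isSec_extension φ continuous_id hσ hσσ (fun _ => rfl)
    hYc hA hF.topRows.1 hF.topRows.2
  obtain ⟨R, hR, hR', hRA, hRav⟩ := exists_avoiding (E := EuclideanSpace ℝ (Fin 2)) φ
    continuous_id hσ hσσ (fun _ => rfl) hYc hA isInvariant_dependentRows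
    isClosed_dependentRows (avoidable_dependentRows (by simp)) hr hr'
    (fun t ht p hp hp0 => by
      rw [hrA t ht p hp hp0]
      exact hF.avoidsAt ht p hp hp0)
    (exists_pieces hq.continuous hq.surjective continuous_id hσ hYc
      (fun t ht h => ht h) hq.exists_nhds)
  have hCR := isSec_complRow hν continuous_id hR hR' fun t _ => hRav t
  have hdet : ∀ p : TotalSpace ℂ L, p.2 ≠ 0 →
      (rows (R p.1 p) (complRow (ν p) (R p.1 p))).det = 1 := fun p hp0 => by
    rw [det_rows, sum_rowCross_mul_complRow (hν.pos p hp0) (hRav p.1 p rfl hp0)]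
  have hW := isFrameFamily_rows hR hR' hCR.1 hCR.2 fun t _ p hp hp0 => by
    obtain rfl : p.1 = t := hp
    rw [hdet p hp0]
    exact one_ne_zero
  have hW' : IsFrameFamily φ (fun x => x) σ Set.univ fun _ p =>
      rows (R p.1 p) (complRow (ν p) (R p.1 p)) :=
    hW.congr (fun _ _ => trivial) (fun _ => rfl) fun t _ p hp _ => by
      obtain rfl : p.1 = t := hp
      rfl
  refine ⟨realIsoOfMat _ hW', RealIso.hasCanonicalDet_of_det_eq_one fun p hp => by
    rw [realIsoOfMat_mat hW' hp, hdet p hp], ?_⟩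
  -- the third rows over the real part are homotopic
  have hNI := hN.comp (s := fun t : unitInterval × Function.fixedPoints σ => t.2) continuous_snd
    (τ' := id) fun _ => rfl
  have hWI := hW'.comp (s := fun t : unitInterval × Function.fixedPoints σ => t.2.1)
    (by fun_prop) (τ' := id) fun t => t.2.2.symm
  have hRN : ∀ y : Function.fixedPoints σ, ∀ p : TotalSpace ℂ L, p.1 = y → p.2 ≠ 0 →
      R p.1 p = topRows (N y p) := by
    intro y p hp hp0
    rw [hp, hRA y y.2, hrA y y.2 p hp hp0]
    simp only [dif_pos y.2]
  -- Both third rows complete the same two rows to determinant `1`, hence so does every affine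
  -- combination of them.
  have hV := isFrameFamily_rows hNI.topRows.1 hNI.topRows.2
    (((hNI.row 2).1.mul (g := fun t _ => ((1 - t.1.1 : ℝ) : ℂ))
      (by fun_prop)).add ((hWI.row 2).1.mul (g := fun t _ => (t.1.1 : ℂ)) (by fun_prop)))
    (((hNI.row 2).2.mul (g := fun t => ((1 - t.1.1 : ℝ) : ℂ)) fun t _ =>
      (Complex.conj_ofReal _).symm).add ((hWI.row 2).2.mul (g := fun t => (t.1.1 : ℂ)) fun t _ =>
      (Complex.conj_ofReal _).symm))
    (fun t _ p hp hp0 => by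
      have e1 := hN1 t.2 p hp hp0
      rw [← rows_topRows (N t.2 p), det_rows] at e1
      have e2 := hdet p hp0
      rw [hRN t.2 p hp hp0, det_rows] at e2
      have e3 : (rows (topRows (N t.2 p)) fun j => ((1 - t.1.1 : ℝ) : ℂ) * N t.2 p 2 j +
          (t.1.1 : ℂ) * rows (R p.1 p) (complRow (ν p) (R p.1 p)) 2 j).det = 1 := by
        rw [det_rows_combination, e1, hRN t.2 p hp hp0]
        refine (congrArg (fun z => ((1 - t.1.1 : ℝ) : ℂ) * 1 + (t.1.1 : ℂ) * z) e2).trans ?_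
        push_cast
        ring
      rw [e3]
      exact one_ne_zero)
  obtain ⟨γ, hγ0, hγ⟩ := hV.exists_real_quotient hNI (by fun_prop) fun t => t.2.2
  refine ⟨fun y => γ (1, y), ⟨γ, hγ0, fun y => ?_, fun _ => rfl⟩, fun y p hp hp0 => ?_⟩
  · have hb := baseVec_ne_zero (L := L) y.1
    refine eq_of_map_ofReal_mul_eq (P := N y ⟨y.1, baseVec L y.1⟩)
      (hN.det_ne_zero y trivial _ rfl hb) ?_
    rw [map_ofReal_one, Matrix.one_mul, hγ (0, y) ⟨y.1, baseVec L y.1⟩ rfl hb]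
    have : (fun j => ((1 - (0 : unitInterval).1 : ℝ) : ℂ) * N y ⟨y.1, baseVec L y.1⟩ 2 j +
        ((0 : unitInterval).1 : ℂ) * rows (R y.1 ⟨y.1, baseVec L y.1⟩)
        (complRow (ν ⟨y.1, baseVec L y.1⟩) (R y.1 ⟨y.1, baseVec L y.1⟩)) 2 j) =
        N y ⟨y.1, baseVec L y.1⟩ 2 := by
      ext j
      simp
    simp only [this, rows_topRows]
  · rw [hγ (1, y) p hp hp0, realIsoOfMat_mat hW' hp0, hRN y p hp hp0]
    have : (fun j => ((1 - (1 : unitInterval).1 : ℝ) : ℂ) * N y p 2 j +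
        ((1 : unitInterval).1 : ℂ) * rows (topRows (N y p)) (complRow (ν p) (topRows (N y p))) 2 j) =
        complRow (ν p) (topRows (N y p)) := by
      ext j
      simp [rows]
    simp only [this]

end Core

/-! ### The surface and its fixed locus as low-dimensional spaces -/

theorem exists_eq_smul {u v : EuclideanSpace ℝ (Fin 2)} (hu : u ≠ 0)
    (h : u 0 * v 1 = u 1 * v 0) : ∃ a : ℝ, v = a • u := by
  by_cases h0 : u 0 = 0
  · have h1 : u 1 ≠ 0 := fun h1 => hu (by ext i; fin_cases i <;> assumption)
    have h2 : v 0 = 0 := by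
      rw [h0, zero_mul] at h
      exact (mul_eq_zero.1 h.symm).resolve_left h1
    refine ⟨v 1 / u 1, ?_⟩
    ext i
    rw [PiLp.smul_apply, smul_eq_mul]
    revert i
    rw [Fin.forall_fin_two, h2, h0, mul_zero, div_mul_cancel₀ _ h1]
    exact ⟨rfl, rfl⟩
  · refine ⟨v 0 / u 0, ?_⟩
    ext i
    rw [PiLp.smul_apply, smul_eq_mul]
    revert i
    rw [Fin.forall_fin_two, div_mul_cancel₀ _ h0]
    refine ⟨rfl, ?_⟩
    field_simp
    linarith

/-- Near a fixed point at which its differential is not the identity, the fixed points of a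
differentiable map of the plane are separated by a linear function. -/
theorem exists_injOn_fixedPoints {F : EuclideanSpace ℝ (Fin 2) → EuclideanSpace ℝ (Fin 2)}
    {z : EuclideanSpace ℝ (Fin 2)}
    {D : EuclideanSpace ℝ (Fin 2) →L[ℝ] EuclideanSpace ℝ (Fin 2)} (hF : HasStrictFDerivAt F D z)
    (hD : D ≠ ContinuousLinearMap.id ℝ _) :
    ∃ W ∈ 𝓝 z, ∃ m : EuclideanSpace ℝ (Fin 2) → ℝ, Continuous m ∧
      Set.InjOn m (W ∩ Function.fixedPoints F) := by
  obtain ⟨u, hu⟩ : ∃ u, D u - u ≠ 0 := by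
    by_contra! h
    exact hD (ContinuousLinearMap.ext fun u => sub_eq_zero.1 (h u))
  have hu0 : u ≠ 0 := by
    rintro rfl
    simp at hu
  have hF' := hF.isLittleO
  -- Two fixed points whose difference is `a • u` make the error of the linear approximation equal
  -- to `‖a‖ * ‖D u - u‖`. This `c` bounds the error by half of that, which forces `a = 0`.
  let c : ℝ := ‖D u - u‖ / (2 * ‖u‖)
  have hun := norm_pos_iff.2 hu0
  have hc : 0 < c := div_pos (norm_pos_iff.2 hu) (by positivity)
  have hev := hF'.def hc
  rw [nhds_prod_eq] at hev
  obtain ⟨W, hW, hWc⟩ := Filter.mem_prod_self_iff.1 hev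
  -- The separating function is the linear form with kernel spanned by `u`.
  refine ⟨W, hW, fun x => u 0 * x 1 - u 1 * x 0, by fun_prop, fun x hx y hy hxy => ?_⟩
  have h1 : ‖F x - F y - D (x - y)‖ ≤ c * ‖x - y‖ := by
    have h := hWc (Set.mk_mem_prod hx.1 hy.1)
    exact h
  have hxy' : u 0 * (x - y) 1 = u 1 * (x - y) 0 := by
    simp only [PiLp.sub_apply]
    linarith
  obtain ⟨a, ha⟩ := exists_eq_smul hu0 hxy'
  have hx' : F x = x := hx.2
  have hy' : F y = y := hy.2
  have e1 : F x - F y - D (x - y) =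
      -(a • (D u - u)) := by
    rw [hx', hy', ha, map_smul, smul_sub]
    abel
  rw [e1, ha, norm_neg, norm_smul, norm_smul] at h1
  have e2 : c * (‖a‖ * ‖u‖) = ‖a‖ * ‖D u - u‖ / 2 := by
    simp only [c]
    field_simp
  rw [e2] at h1
  have h3 : ‖a‖ = 0 := by
    by_contra h
    have : 0 < ‖a‖ * ‖D u - u‖ := mul_pos (lt_of_le_of_ne (norm_nonneg _) (Ne.symm h))
      (norm_pos_iff.2 hu)
    linarith
  rw [norm_eq_zero.1 h3, zero_smul] at ha
  exact sub_eq_zero.1 ha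

namespace SymmetricSurface

variable {S : Type*} [TopologicalSpace S] [T2Space S]
  [ChartedSpace (EuclideanSpace ℝ (Fin 2)) S] (X : SymmetricSurface S)

theorem mk_eq_mk {x y : S} :
    (Quotient.mk X.nodeSetoid x = Quotient.mk X.nodeSetoid y) ↔ y = x ∨ y = X.node x :=
  Quotient.eq

theorem continuous_inv : Continuous X.inv := X.inv_smooth.continuous

theorem continuous_conj : Continuous X.conj :=
  (continuous_quotient_mk'.comp X.continuous_inv).quotient_lift _

/-- The saturation of a closed set adds only finitely many points, and these are closed in a
Hausdorff space. -/
theorem isClosedMap_mk : IsClosedMap (Quotient.mk X.nodeSetoid) := by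
  intro C hC
  have : Quotient.mk X.nodeSetoid ⁻¹' (Quotient.mk X.nodeSetoid '' C) =
      C ∪ X.node '' (C ∩ {x | X.node x ≠ x}) := by
    ext y
    constructor
    · rintro ⟨x, hx, hxy⟩
      rcases X.mk_eq_mk.1 hxy with rfl | h
      · exact Or.inl hx
      · by_cases hn : X.node x = x
        · exact Or.inl (by rwa [h, hn])
        · exact Or.inr ⟨x, ⟨hx, hn⟩, h.symm⟩
    · rintro (hy | ⟨x, hx, rfl⟩)
      · exact ⟨y, hy, rfl⟩
      · exact ⟨x, hx.1, X.mk_eq_mk.2 (Or.inr rfl)⟩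
  rw [← isQuotientMap_quotient_mk'.isClosed_preimage]
  exact this ▸ hC.union (((X.node_finite.inter_of_right C).image _).isClosed)

/-- Fibers of the projection are finite, so distinct ones have disjoint neighborhoods. Closedness of
the projection lets these descend. -/
instance : T2Space X.Carrier := by
  refine ⟨fun p q => ?_⟩
  induction p using Quotient.inductionOn with | h x => ?_
  induction q using Quotient.inductionOn with | h y => ?_
  intro hxy
  have hd : Disjoint ({x, X.node x} : Set S) {y, X.node y} := by
    rw [Set.disjoint_left]
    intro z hz hz'
    refine hxy ?_
    have h1 : Quotient.mk X.nodeSetoid x = Quotient.mk X.nodeSetoid z := X.mk_eq_mk.2 hz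
    have h2 : Quotient.mk X.nodeSetoid y = Quotient.mk X.nodeSetoid z := X.mk_eq_mk.2 hz'
    exact h1.trans h2.symm
  obtain ⟨U, V, hU, hV, hxU, hyV, hUV⟩ := SeparatedNhds.of_isCompact_isCompact
    (Set.toFinite ({x, X.node x} : Set S)).isCompact
    (Set.toFinite ({y, X.node y} : Set S)).isCompact hd
  refine ⟨(Quotient.mk X.nodeSetoid '' Uᶜ)ᶜ, (Quotient.mk X.nodeSetoid '' Vᶜ)ᶜ,
    (X.isClosedMap_mk _ hU.isClosed_compl).isOpen_compl,
    (X.isClosedMap_mk _ hV.isClosed_compl).isOpen_compl, ?_, ?_, ?_⟩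
  · rintro ⟨z, hz, hzx⟩
    exact hz (hxU (X.mk_eq_mk.1 hzx.symm))
  · rintro ⟨z, hz, hzy⟩
    exact hz (hyV (X.mk_eq_mk.1 hzy.symm))
  · rw [Set.disjoint_left]
    intro p
    induction p using Quotient.inductionOn with | h z => ?_
    intro h1 h2
    have hzU : z ∈ U := by
      by_contra h
      exact h1 ⟨z, h, rfl⟩
    have hzV : z ∈ V := by
      by_contra h
      exact h2 ⟨z, h, rfl⟩
    exact Set.disjoint_left.1 hUV hzU hzV

/-- The complement of the nodes other than `x`. -/
def regularNhd (x : S) : Set S := {y | y = x ∨ X.node y = y}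

theorem regularNhd_mem_nhds (x : S) : X.regularNhd x ∈ 𝓝 x := by
  have h : IsClosed ({y | X.node y ≠ y} \ {x}) := (X.node_finite.subset Set.sdiff_subset).isClosed
  refine Filter.mem_of_superset (h.isOpen_compl.mem_nhds fun h => h.2 rfl) fun y hy => ?_
  by_contra hn
  exact hy ⟨fun h => hn (Or.inr h), fun h => hn (Or.inl h)⟩

theorem injOn_mk (x : S) : Set.InjOn (Quotient.mk X.nodeSetoid) (X.regularNhd x) := by
  intro y hy z hz hyz
  rcases X.mk_eq_mk.1 hyz with h | h
  · exact h.symm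
  · rcases hy with rfl | hy
    · rcases hz with rfl | hz
      · rfl
      · rw [h, X.node_involutive] at hz
        rw [h, ← hz]
    · rw [h, hy]

theorem isSpread (A : Set X.Carrier) :
    IsSpread (EuclideanSpace ℝ (Fin 2)) (Quotient.mk X.nodeSetoid) A where
  continuous := continuous_quotient_mk'
  surjective := Quotient.mk_surjective
  exists_nhds x _ :=
    ⟨X.regularNhd x ∩ (chartAt (EuclideanSpace ℝ (Fin 2)) x).source,
      Filter.inter_mem (X.regularNhd_mem_nhds x) (chart_source_mem_nhds _ x),
      (X.injOn_mk x).mono Set.inter_subset_left, chartAt (EuclideanSpace ℝ (Fin 2)) x,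
      (chartAt (EuclideanSpace ℝ (Fin 2)) x).continuousOn.mono Set.inter_subset_right,
      (chartAt (EuclideanSpace ℝ (Fin 2)) x).injOn.mono Set.inter_subset_right⟩

/-- The preimage in the normalization of the fixed locus. -/
abbrev RealPoints : Type _ := {x : S // X.conj (Quotient.mk X.nodeSetoid x) = Quotient.mk _ x}

/-- The projection to the fixed locus. -/
def realMk (x : X.RealPoints) : Function.fixedPoints X.conj := ⟨Quotient.mk _ x.1, x.2⟩

theorem continuous_realMk : Continuous X.realMk :=
  (continuous_quotient_mk'.comp continuous_subtype_val).subtype_mk _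

theorem realMk_surjective : Function.Surjective X.realMk := by
  rintro ⟨p, hp⟩
  induction p using Quotient.inductionOn with | h x => ?_
  exact ⟨⟨x, hp⟩, rfl⟩

instance [CompactSpace S] : CompactSpace X.RealPoints :=
  isCompact_iff_compactSpace.1 (isClosed_eq (X.continuous_conj.comp continuous_quotient_mk')
    continuous_quotient_mk').isCompact

theorem RealPoints.inv_eq_or (x : X.RealPoints) : X.inv x.1 = x.1 ∨ X.inv x.1 = X.node x.1 := by
  rcases X.mk_eq_mk.1 x.2.symm with h | h
  · exact Or.inl h
  · exact Or.inr h

/-- A real point of the normalization is either fixed by the involution or is a branch of a node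
exchanged with the other branch. The first kind lies locally on a curve, and the second is isolated.
-/
theorem isSpread_realMk : IsSpread ℝ X.realMk ∅ := by
  refine ⟨X.continuous_realMk, X.realMk_surjective, fun x _ => ?_⟩
  have hi : Set.InjOn X.realMk (Subtype.val ⁻¹' X.regularNhd x.1) := fun y hy z hz hyz =>
    Subtype.ext (X.injOn_mk x.1 hy hz (congrArg Subtype.val hyz))
  have hn : Subtype.val ⁻¹' X.regularNhd x.1 ∈ 𝓝 x :=
    continuous_subtype_val.continuousAt.preimage_mem_nhds (X.regularNhd_mem_nhds x.1)
  by_cases hx : X.inv x.1 = x.1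
  · have hsm := (contMDiffAt_iff.1 (X.inv_smooth x.1)).2
    rw [ModelWithCorners.range_eq_univ, contDiffWithinAt_univ] at hsm
    have hrev := X.inv_reversing x.1
    have hst : HasStrictFDerivAt (writtenInExtChartAt (𝓡 2) (𝓡 2) x.1 X.inv)
        (fderiv ℝ (writtenInExtChartAt (𝓡 2) (𝓡 2) x.1 X.inv) (extChartAt (𝓡 2) x.1 x.1))
        (extChartAt (𝓡 2) x.1 x.1) := hsm.hasStrictFDerivAt (by simp)
    -- Reversing the orientation makes the determinant negative, so the differential cannot be the
    -- identity.
    obtain ⟨W, hW, m, hm, hmi⟩ := exists_injOn_fixedPoints hst fun h => by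
      rw [h] at hrev
      have : (ContinuousLinearMap.id ℝ (EuclideanSpace ℝ (Fin 2))).det = 1 := by
        simp [ContinuousLinearMap.det]
      linarith
    let K : Set S := X.regularNhd x.1 ∩ ((extChartAt (𝓡 2) x.1).source ∩
      extChartAt (𝓡 2) x.1 ⁻¹' W)
    have hK : K ∈ 𝓝 x.1 := Filter.inter_mem (X.regularNhd_mem_nhds _)
      (Filter.inter_mem (extChartAt_source_mem_nhds _)
        ((continuousAt_extChartAt _).preimage_mem_nhds hW))
    refine ⟨Subtype.val ⁻¹' K, continuous_subtype_val.continuousAt.preimage_mem_nhds hK,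
      hi.mono fun y hy => hy.1, fun y => m (extChartAt (𝓡 2) x.1 y.1), ?_, ?_⟩
    · exact hm.comp_continuousOn ((continuousOn_extChartAt x.1).comp
        continuous_subtype_val.continuousOn fun y hy => hy.2.1)
    · have hfix : ∀ y : X.RealPoints, y.1 ∈ K → extChartAt (𝓡 2) x.1 y.1 ∈ W ∩
          Function.fixedPoints (writtenInExtChartAt (𝓡 2) (𝓡 2) x.1 X.inv) := by
        intro y hy
        refine ⟨hy.2.2, ?_⟩
        have hyi : X.inv y.1 = y.1 := by
          rcases hy.1 with h | h
          · rw [h, hx]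
          · rcases RealPoints.inv_eq_or X y with h' | h'
            · exact h'
            · rw [h', h]
        show extChartAt (𝓡 2) (X.inv x.1) (X.inv ((extChartAt (𝓡 2) x.1).symm _)) = _
        rw [(extChartAt (𝓡 2) x.1).left_inv hy.2.1, hyi, hx]
      intro y hy z hz hyz
      exact Subtype.ext ((extChartAt (𝓡 2) x.1).injOn hy.2.1 hz.2.1
        (hmi (hfix y hy) (hfix z hz) hyz))
  -- Here `inv` exchanges the branches at a node. Nearby points are not nodes and are moved by
  -- `inv`, hence are not real.
  · have hK : {y : S | X.inv y ≠ y} ∈ 𝓝 x.1 :=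
      (isClosed_eq X.continuous_inv continuous_id).isOpen_compl.mem_nhds hx
    have hsub : Subtype.val ⁻¹' (X.regularNhd x.1 ∩ {y : S | X.inv y ≠ y}) ⊆ ({x} : Set _) := by
      rintro y ⟨hy | hy, hy'⟩
      · exact Subtype.ext hy
      · rcases RealPoints.inv_eq_or X y with h' | h'
        · exact absurd h' hy'
        · exact absurd (h'.trans hy) hy'
    have hx1 : ({x} : Set X.RealPoints) ∈ 𝓝 x := Filter.mem_of_superset
      (continuous_subtype_val.continuousAt.preimage_mem_nhds
        (Filter.inter_mem (X.regularNhd_mem_nhds _) hK)) hsub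
    exact ⟨{x}, hx1, Set.injOn_singleton _ _, fun _ => 0, continuousOn_const,
      Set.injOn_singleton _ _⟩

end SymmetricSurface

/-! ### Null-homotopic matrix functions -/

section Null

variable {Z : Type*} [TopologicalSpace Z] {γ δ : Z → Matrix (Fin 3) (Fin 3) ℝ}

theorem Null.continuous (h : Null γ) : Continuous γ := by
  obtain ⟨H, -, -, h1⟩ := h
  have : γ = fun z => H (1, z) := funext fun z => (h1 z).symm
  rw [this]
  fun_prop

theorem Null.det_ne_zero (h : Null γ) (z : Z) : (γ z).det ≠ 0 := by
  obtain ⟨H, h0, -, h1⟩ := h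
  exact h1 z ▸ h0 _

theorem Null.mul (h : Null γ) (h' : Null δ) : Null fun z => γ z * δ z := by
  obtain ⟨H, hd, h0, h1⟩ := h
  obtain ⟨H', hd', h0', h1'⟩ := h'
  refine ⟨⟨fun p => H p * H' p, H.continuous.matrix_mul H'.continuous⟩, fun p => ?_, fun z => ?_,
    fun z => ?_⟩
  · show (H p * H' p).det ≠ 0
    rw [Matrix.det_mul]
    exact mul_ne_zero (hd p) (hd' p)
  · show H (0, z) * H' (0, z) = 1
    rw [h0, h0', Matrix.mul_one]
  · show H (1, z) * H' (1, z) = _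
    rw [h1, h1']

theorem continuous_matrix_inv (hγ : Continuous γ) (h : ∀ z, (γ z).det ≠ 0) :
    Continuous fun z => (γ z)⁻¹ :=
  continuous_iff_continuousAt.2 fun z => (continuousAt_matrix_inv (h z)).comp hγ.continuousAt

theorem det_inv_ne_zero {M : Matrix (Fin 3) (Fin 3) ℝ} (h : M.det ≠ 0) : M⁻¹.det ≠ 0 := by
  rw [Matrix.det_nonsing_inv, Ring.inverse_eq_inv']
  exact inv_ne_zero h

theorem Null.inv (h : Null γ) : Null fun z => (γ z)⁻¹ := by
  obtain ⟨H, hd, h0, h1⟩ := h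
  refine ⟨⟨fun p => (H p)⁻¹, continuous_matrix_inv H.continuous hd⟩,
    fun p => det_inv_ne_zero (hd p), fun z => ?_, fun z => ?_⟩
  · show (H (0, z))⁻¹ = 1
    rw [h0, inv_one]
  · show (H (1, z))⁻¹ = _
    rw [h1]

theorem Null.conj (h : Null γ) (hδ : Continuous δ) (hδ0 : ∀ z, (δ z).det ≠ 0) :
    Null fun z => (δ z)⁻¹ * γ z * δ z := by
  obtain ⟨H, hd, h0, h1⟩ := h
  refine ⟨⟨fun p => (δ p.2)⁻¹ * H p * δ p.2, (((continuous_matrix_inv hδ hδ0).comp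
    continuous_snd).matrix_mul H.continuous).matrix_mul (hδ.comp continuous_snd)⟩,
    fun p => ?_, fun z => ?_, fun z => ?_⟩
  · show ((δ p.2)⁻¹ * H p * δ p.2).det ≠ 0
    rw [Matrix.det_mul, Matrix.det_mul]
    exact mul_ne_zero (mul_ne_zero (det_inv_ne_zero (hδ0 _)) (hd p)) (hδ0 _)
  · show (δ z)⁻¹ * H (0, z) * δ z = 1
    rw [h0, Matrix.mul_one, Matrix.nonsing_inv_mul _ (hδ0 z).isUnit]
  · show (δ z)⁻¹ * H (1, z) * δ z = _
    rw [h1]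

theorem Null.comp (h : Null γ) {Z' : Type*} [TopologicalSpace Z'] {g : Z' → Z}
    (hg : Continuous g) : Null fun z => γ (g z) := by
  obtain ⟨H, hd, h0, h1⟩ := h
  exact ⟨⟨fun p => H (p.1, g p.2), by fun_prop⟩, fun p => hd _, fun z => h0 _, fun z => h1 _⟩

theorem null_inv_mul_of_path {K : unitInterval × Z → Matrix (Fin 3) (Fin 3) ℝ}
    (hK : Continuous K) (hd : ∀ p, (K p).det ≠ 0) : Null fun z => (K (0, z))⁻¹ * K (1, z) := by
  refine ⟨⟨fun p => (K (0, p.2))⁻¹ * K p, ((continuous_matrix_inv hK hd).comp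
    (by fun_prop : Continuous fun p : unitInterval × Z => ((0 : unitInterval), p.2))).matrix_mul
      hK⟩, fun p => ?_, fun z => ?_, fun z => rfl⟩
  · show ((K (0, p.2))⁻¹ * K p).det ≠ 0
    rw [Matrix.det_mul]
    exact mul_ne_zero (det_inv_ne_zero (hd _)) (hd p)
  · exact Matrix.nonsing_inv_mul _ (hd _).isUnit

/-- `K₁ = K₀ · (K₀⁻¹ K₁)`, and the second factor is the end of a path that starts at `1`. -/
theorem Null.of_path {K : unitInterval × Z → Matrix (Fin 3) (Fin 3) ℝ}
    (h : Null fun z => K (0, z)) (hK : Continuous K) (hd : ∀ p, (K p).det ≠ 0) :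
    Null fun z => K (1, z) := by
  have h1 := h.mul (null_inv_mul_of_path hK hd)
  simpa only [← Matrix.mul_assoc, Matrix.mul_nonsing_inv _ (hd _).isUnit, Matrix.one_mul] using h1

/-- A null matrix function composed with homotopic maps. -/
theorem Null.of_homotopic {W : Type*} [TopologicalSpace W] {f g : C(Z, W)} (hfg : f.Homotopic g)
    {Γ : W → Matrix (Fin 3) (Fin 3) ℝ} (hΓ : Continuous Γ) (hd : ∀ w, (Γ w).det ≠ 0)
    (h : Null fun z => Γ (f z)) : Null fun z => Γ (g z) := by
  obtain ⟨F⟩ := hfg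
  have := Null.of_path (K := fun p => Γ (F p)) (by simpa using h) (hΓ.comp F.continuous)
    fun p => hd _
  simpa using this

end Null

/-! ### Rotations in the last two coordinates and reduction to them -/

/-- The block matrix formed by `a` and the complex multiplication by `z`. -/
def blk (a : ℝ) (z : ℂ) : Matrix (Fin 3) (Fin 3) ℝ :=
  !![a, 0, 0; 0, z.re, -z.im; 0, z.im, z.re]

theorem blk_mul (a b : ℝ) (z w : ℂ) : blk a z * blk b w = blk (a * b) (z * w) := by
  ext i j
  fin_cases i <;> fin_cases j <;> simp [blk, Matrix.mul_apply, Fin.sum_univ_three] <;> ring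

theorem blk_one : blk 1 1 = 1 := by
  ext i j
  fin_cases i <;> fin_cases j <;> simp [blk]

theorem det_blk (a : ℝ) (z : ℂ) : (blk a z).det = a * Complex.normSq z := by
  rw [Matrix.det_fin_three, Complex.normSq_apply]
  simp [blk]
  ring

theorem _root_.Continuous.blk {Z : Type*} [TopologicalSpace Z] {a : Z → ℝ} {ζ : Z → ℂ}
    (ha : Continuous a) (hζ : Continuous ζ) : Continuous fun z => blk (a z) (ζ z) := by
  have h1 := Complex.continuous_re.comp hζ
  have h2 := Complex.continuous_im.comp hζ
  refine continuous_matrix fun i j => ?_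
  fin_cases i <;> fin_cases j <;> simp [RealPairs.blk] <;> first | exact continuous_const | assumption | exact h1 | exact h2 | exact h2.neg

theorem det_blk_circle (z : Circle) : (blk 1 z).det = 1 := by
  rw [det_blk, Circle.normSq_coe, one_mul]

theorem blk_circle_mul (z w : Circle) : blk 1 z * blk 1 w = blk 1 ((z * w : Circle) : ℂ) := by
  rw [blk_mul, one_mul, Circle.coe_mul]

theorem blk_circle_inv (z : Circle) : (blk 1 z)⁻¹ = blk 1 ((z⁻¹ : Circle) : ℂ) := by
  apply Matrix.inv_eq_left_inv
  rw [blk_circle_mul, inv_mul_cancel, Circle.coe_one, blk_one]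

theorem continuous_blk_circle : Continuous fun z : Circle => blk 1 (z : ℂ) :=
  continuous_const.blk continuous_subtype_val

section Blocks

variable {Z : Type*} [TopologicalSpace Z]

/-- A global logarithm `β` of the direction of `ζ` lets the angle shrink to zero while the moduli
are interpolated linearly to `1`. -/
theorem null_blk {a β : Z → ℝ} {ζ : Z → ℂ} (ha : Continuous a) (hβ : Continuous β)
    (hζ : Continuous ζ) (ha0 : ∀ z, 0 < a z) (hζ0 : ∀ z, ζ z ≠ 0)
    (h : ∀ z, ζ z = ‖ζ z‖ * Complex.exp (β z * Complex.I)) : Null fun z => blk (a z) (ζ z) := by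
  have pos : ∀ (t : unitInterval) (x : ℝ), 0 < x → 0 < 1 - (t : ℝ) + t * x := fun t x hx => by
    rcases eq_or_lt_of_le t.2.1 with h | h
    · rw [← h]; simp
    · have h1 : (0 : ℝ) ≤ 1 - t := sub_nonneg.2 t.2.2
      have h2 : 0 < (t : ℝ) * x := mul_pos h hx
      linarith
  refine ⟨⟨fun p => blk (1 - (p.1 : ℝ) + p.1 * a p.2)
    (((1 - (p.1 : ℝ) + p.1 * ‖ζ p.2‖ : ℝ) : ℂ) * Complex.exp (((p.1 : ℝ) * β p.2 : ℝ) * Complex.I)),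
    Continuous.blk (by fun_prop) (by fun_prop)⟩, fun p => ?_, fun z => ?_, fun z => ?_⟩
  · show (blk _ _).det ≠ 0
    rw [det_blk]
    refine mul_ne_zero (pos _ _ (ha0 _)).ne' (Complex.normSq_eq_zero.not.2 ?_)
    exact mul_ne_zero (Complex.ofReal_ne_zero.2 (pos _ _ (norm_pos_iff.2 (hζ0 _))).ne')
      (Complex.exp_ne_zero _)
  · show blk (1 - ((0 : unitInterval) : ℝ) + (0 : unitInterval) * a z) _ = 1
    simp [blk_one]
  · show blk (1 - ((1 : unitInterval) : ℝ) + (1 : unitInterval) * a z) (((1 - ((1 : unitInterval) :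
      ℝ) + (1 : unitInterval) * ‖ζ z‖ : ℝ) : ℂ) * Complex.exp ((((1 : unitInterval) : ℝ) * β z :
      ℝ) * Complex.I)) = _
    simp only [Set.Icc.coe_one, sub_self, zero_add, one_mul]
    rw [← h z]

/-- The rotation in the plane of the first and the third coordinate. -/
noncomputable def tilt (t : ℝ) : Matrix (Fin 3) (Fin 3) ℝ :=
  !![Real.cos t, 0, -Real.sin t; 0, 1, 0; Real.sin t, 0, Real.cos t]

theorem det_tilt (t : ℝ) : (tilt t).det = 1 := by
  have h := Real.cos_sq_add_sin_sq t
  rw [Matrix.det_fin_three]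
  simp [tilt]
  nlinarith

theorem continuous_tilt : Continuous tilt := by
  refine continuous_matrix fun i j => ?_
  fin_cases i <;> fin_cases j <;> simp [tilt] <;> fun_prop

theorem tilt_pi_conj (z : Circle) :
    tilt Real.pi * blk 1 z * tilt (-Real.pi) = blk 1 ((z⁻¹ : Circle) : ℂ) := by
  rw [Circle.coe_inv_eq_conj]
  ext i j
  fin_cases i <;> fin_cases j <;> simp [tilt, blk, Matrix.mul_apply, Fin.sum_univ_three]

theorem null_one : Null fun _ : Z => (1 : Matrix (Fin 3) (Fin 3) ℝ) :=
  ⟨⟨fun _ => 1, continuous_const⟩, by simp, fun _ => rfl, fun _ => rfl⟩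

/-- Conjugating a rotation by the half-turn `tilt π` inverts it, and the half-turn is joined to the
identity through `tilt`. So `f · f` is homotopic to `f · f⁻¹ = 1`: twice a loop of rotations is
contractible in `SO(3)`. -/
theorem null_blk_sq {f : Z → Circle} (hf : Continuous f) :
    Null fun z => blk 1 ((f z ^ 2 : Circle) : ℂ) := by
  let K : unitInterval × Z → Matrix (Fin 3) (Fin 3) ℝ := fun p =>
    blk 1 (f p.2) * (tilt (Real.pi * (1 - p.1)) * blk 1 (f p.2) * tilt (-(Real.pi * (1 - p.1))))
  have hfc : Continuous fun p : unitInterval × Z => blk 1 ((f p.2 : Circle) : ℂ) :=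
    continuous_blk_circle.comp (hf.comp continuous_snd)
  have hK : Continuous K := hfc.matrix_mul (((continuous_tilt.comp (by fun_prop)).matrix_mul
    hfc).matrix_mul (continuous_tilt.comp (by fun_prop)))
  have h0 : Null fun z => K (0, z) := by
    have : (fun z => K (0, z)) = fun _ => 1 := by
      ext1 z
      simp only [K, Set.Icc.coe_zero, sub_zero, mul_one]
      rw [tilt_pi_conj, blk_circle_mul, mul_inv_cancel, Circle.coe_one, blk_one]
    rw [this]
    exact null_one
  have h1 := h0.of_path hK fun p => by
    simp only [K, Matrix.det_mul, det_blk_circle, det_tilt]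
    norm_num
  refine (congrArg Null (funext fun z => ?_)).mp h1
  simp only [K, Set.Icc.coe_one, sub_self, mul_zero, neg_zero]
  rw [show tilt 0 = 1 by ext i j; fin_cases i <;> fin_cases j <;> simp [tilt], Matrix.one_mul,
    Matrix.mul_one, blk_circle_mul, sq]

theorem blk_mul_apply_zero (a : ℝ) (z : ℂ) (M : Matrix (Fin 3) (Fin 3) ℝ) (j : Fin 3) :
    (blk a z * M) 0 j = a * M 0 j := by
  simp [blk, Matrix.mul_apply, Fin.sum_univ_three]

theorem blk_mul_apply_one (a : ℝ) (z : ℂ) (M : Matrix (Fin 3) (Fin 3) ℝ) (j : Fin 3) :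
    (blk a z * M) 1 j = z.re * M 1 j - z.im * M 2 j := by
  simp [blk, Matrix.mul_apply, Fin.sum_univ_three, sub_eq_add_neg]

theorem blk_mul_apply_two (a : ℝ) (z : ℂ) (M : Matrix (Fin 3) (Fin 3) ℝ) (j : Fin 3) :
    (blk a z * M) 2 j = z.im * M 1 j + z.re * M 2 j := by
  simp [blk, Matrix.mul_apply, Fin.sum_univ_three]

theorem exists_circle_of_ne_zero {ζ : Z → ℂ} (hζ : Continuous ζ) (h0 : ∀ z, ζ z ≠ 0) :
    ∃ w : C(Z, Circle), ∀ z, ζ z = ‖ζ z‖ * w z := by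
  have hn : ∀ z, (‖ζ z‖ : ℂ) ≠ 0 := fun z => Complex.ofReal_ne_zero.2 (norm_ne_zero_iff.2 (h0 z))
  refine ⟨⟨fun z => ⟨ζ z / ‖ζ z‖, mem_sphere_zero_iff_norm.2 ?_⟩, Continuous.subtype_mk ?_ _⟩,
    fun z => (mul_div_cancel₀ _ (hn z)).symm⟩
  · rw [norm_div, Complex.norm_real, norm_norm, div_self (norm_ne_zero_iff.2 (h0 z))]
  · exact hζ.div (by fun_prop) hn

/-- An upper triangular matrix function with positive diagonal is null. -/
theorem null_of_upper {U : Z → Matrix (Fin 3) (Fin 3) ℝ} (hU : Continuous U)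
    (h10 : ∀ z, U z 1 0 = 0) (h20 : ∀ z, U z 2 0 = 0) (h21 : ∀ z, U z 2 1 = 0)
    (hd : ∀ z i, 0 < U z i i) : Null U := by
  have pos : ∀ (t : unitInterval) (x : ℝ), 0 < x → 0 < 1 - (t : ℝ) + t * x := fun t x hx => by
    rcases eq_or_lt_of_le t.2.1 with h | h
    · rw [← h]; simp
    · have h1 : (0 : ℝ) ≤ 1 - t := sub_nonneg.2 t.2.2
      have h2 : 0 < (t : ℝ) * x := mul_pos h hx
      linarith
  refine ⟨⟨fun p => (1 - (p.1 : ℝ)) • (1 : Matrix (Fin 3) (Fin 3) ℝ) + (p.1 : ℝ) • U p.2,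
    by fun_prop⟩, fun p => ?_, fun z => by simp, fun z => by simp⟩
  have : ((1 - (p.1 : ℝ)) • (1 : Matrix (Fin 3) (Fin 3) ℝ) + (p.1 : ℝ) • U p.2).det =
      (1 - (p.1 : ℝ) + p.1 * U p.2 0 0) * (1 - (p.1 : ℝ) + p.1 * U p.2 1 1) *
        (1 - (p.1 : ℝ) + p.1 * U p.2 2 2) := by
    rw [Matrix.det_fin_three]
    simp [h10, h20, h21]
  exact this ▸ (mul_pos (mul_pos (pos _ _ (hd _ _)) (pos _ _ (hd _ _))) (pos _ _ (hd _ _))).ne'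

theorem null_swap : Null fun _ : Z => !![0, 1, 0; -1, 0, 0; 0, 0, (1 : ℝ)] := by
  refine ⟨⟨fun p => !![Real.cos (Real.pi / 2 * p.1), Real.sin (Real.pi / 2 * p.1), 0;
    -Real.sin (Real.pi / 2 * p.1), Real.cos (Real.pi / 2 * p.1), 0; 0, 0, 1], ?_⟩, fun p => ?_,
    fun z => ?_, fun z => ?_⟩
  · refine continuous_matrix fun i j => ?_
    fin_cases i <;> fin_cases j <;> simp <;> fun_prop
  · have h := Real.cos_sq_add_sin_sq (Real.pi / 2 * p.1)
    have : (!![Real.cos (Real.pi / 2 * p.1), Real.sin (Real.pi / 2 * p.1), 0;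
      -Real.sin (Real.pi / 2 * p.1), Real.cos (Real.pi / 2 * p.1), 0; 0, 0, 1] :
        Matrix (Fin 3) (Fin 3) ℝ).det = 1 := by
      rw [Matrix.det_fin_three]
      simp
      nlinarith
    exact fun h => one_ne_zero (this.symm.trans h)
  · ext i j
    fin_cases i <;> fin_cases j <;> simp
  · ext i j
    fin_cases i <;> fin_cases j <;> simp

theorem null_shear {s : Z → ℝ} (hs : Continuous s) :
    Null fun z => !![1, 0, 0; s z, 1, 0; 0, 0, (1 : ℝ)] := by
  refine ⟨⟨fun p => !![1, 0, 0; p.1 * s p.2, 1, 0; 0, 0, 1], ?_⟩, fun p => ?_,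
    fun z => ?_, fun z => ?_⟩
  · refine continuous_matrix fun i j => ?_
    fin_cases i <;> fin_cases j <;> simp <;> fun_prop
  · have : (!![1, 0, 0; p.1 * s p.2, 1, 0; 0, 0, 1] : Matrix (Fin 3) (Fin 3) ℝ).det = 1 := by
      rw [Matrix.det_fin_three]
      simp
    exact fun h => one_ne_zero (this.symm.trans h)
  · ext i j
    fin_cases i <;> fin_cases j <;> simp
  · ext i j
    fin_cases i <;> fin_cases j <;> simp

/-- Reduction of a matrix function of positive determinant to rotations. -/
theorem exists_blk_mul_null {γ : Z → Matrix (Fin 3) (Fin 3) ℝ} (hγ : Continuous γ)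
    (hd : ∀ z, 0 < (γ z).det) (h0 : ∀ z, (⟨γ z 1 0, γ z 2 0⟩ : ℂ) ≠ 0) :
    ∃ (f : C(Z, Circle)) (N : Z → Matrix (Fin 3) (Fin 3) ℝ), Null N ∧
      ∀ z, γ z = blk 1 (f z) * N z := by
  have hcplx : ∀ {x y : Z → ℝ}, Continuous x → Continuous y →
      Continuous fun z => (⟨x z, y z⟩ : ℂ) := fun hx hy =>
    Complex.equivRealProdCLM.symm.continuous.comp (hx.prodMk hy)
  obtain ⟨w, hw⟩ := exists_circle_of_ne_zero (hcplx (hγ.matrix_elem 1 0) (hγ.matrix_elem 2 0)) h0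
  let ρ : Z → ℝ := fun z => ‖(⟨γ z 1 0, γ z 2 0⟩ : ℂ)‖
  have hρ : Continuous ρ := (hcplx (hγ.matrix_elem 1 0) (hγ.matrix_elem 2 0)).norm
  have hρ0 : ∀ z, 0 < ρ z := fun z => norm_pos_iff.2 (h0 z)
  have hre : ∀ z, γ z 1 0 = ρ z * (w z : ℂ).re := fun z => by
    have := congrArg Complex.re (hw z)
    rwa [Complex.re_ofReal_mul] at this
  have him : ∀ z, γ z 2 0 = ρ z * (w z : ℂ).im := fun z => by
    have := congrArg Complex.im (hw z)
    rwa [Complex.im_ofReal_mul] at this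
  have hunit : ∀ z : Circle, (z : ℂ).re * (z : ℂ).re + (z : ℂ).im * (z : ℂ).im = 1 := fun z => by
    rw [← Complex.normSq_apply, Circle.normSq_coe]
  -- After rotating by `w⁻¹` the first column is `(γ₀₀, ρ, 0)`. This product of a shear and a signed
  -- swap, applied to it, gives `(ρ, 0, 0)` and is null.
  let G : Z → Matrix (Fin 3) (Fin 3) ℝ := fun z =>
    !![1, 0, 0; γ z 0 0 / ρ z, 1, 0; 0, 0, 1] * !![0, 1, 0; -1, 0, 0; 0, 0, 1]
  have hG : Null G := (null_shear ((hγ.matrix_elem 0 0).div hρ fun z => (hρ0 z).ne')).mul null_swap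
  have hG' : ∀ z, G z = !![0, 1, 0; -1, γ z 0 0 / ρ z, 0; 0, 0, 1] := fun z => by
    ext i j
    fin_cases i <;> fin_cases j <;> simp [G]
  have hGd : ∀ z, (G z).det = 1 := fun z => by
    rw [hG', Matrix.det_fin_three]
    simp
  let γ' : Z → Matrix (Fin 3) (Fin 3) ℝ := fun z => blk 1 ((w z)⁻¹ : Circle) * γ z
  have hγ' : Continuous γ' := (continuous_blk_circle.comp w.continuous.inv).matrix_mul hγ
  have e1 : ∀ z, γ' z 1 0 = ρ z := fun z => by
    simp only [γ', blk_mul_apply_one, hre, him, Circle.coe_inv_eq_conj, Complex.conj_re,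
      Complex.conj_im]
    linear_combination ρ z * hunit (w z)
  have e2 : ∀ z, γ' z 2 0 = 0 := fun z => by
    simp only [γ', blk_mul_apply_two, hre, him, Circle.coe_inv_eq_conj, Complex.conj_re,
      Complex.conj_im]
    ring
  have e0 : ∀ z, γ' z 0 0 = γ z 0 0 := fun z => by
    simp only [γ', blk_mul_apply_zero, one_mul]
  let δ : Z → Matrix (Fin 3) (Fin 3) ℝ := fun z => G z * γ' z
  have hδ : Continuous δ := hG.continuous.matrix_mul hγ'
  have hδd : ∀ z, 0 < (δ z).det := fun z => by
    simp only [δ, γ', Matrix.det_mul, hGd, det_blk_circle, one_mul]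
    exact hd z
  have d0 : ∀ z, δ z 0 0 = ρ z := fun z => by
    simp only [δ, hG', Matrix.mul_apply, Fin.sum_univ_three]
    simp [e1]
  have d1 : ∀ z, δ z 1 0 = 0 := fun z => by
    have := (hρ0 z).ne'
    simp only [δ, hG', Matrix.mul_apply, Fin.sum_univ_three]
    simp [e0, e1]
    field_simp
    ring
  have d2 : ∀ z, δ z 2 0 = 0 := fun z => by
    simp only [δ, hG', Matrix.mul_apply, Fin.sum_univ_three]
    simp [e2]
  have hδdet : ∀ z, (δ z).det = ρ z * (δ z 1 1 * δ z 2 2 - δ z 1 2 * δ z 2 1) := fun z => by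
    rw [Matrix.det_fin_three, d0, d1, d2]
    ring
  have h0' : ∀ z, (⟨δ z 1 1, δ z 2 1⟩ : ℂ) ≠ 0 := fun z h => by
    have h1 := congrArg Complex.re h
    have h2 := congrArg Complex.im h
    simp only [Complex.zero_re, Complex.zero_im] at h1 h2
    have := hδd z
    rw [hδdet, h1, h2] at this
    simp at this
  obtain ⟨v, hv⟩ := exists_circle_of_ne_zero
    (hcplx (hδ.matrix_elem 1 1) (hδ.matrix_elem 2 1)) h0'
  let m : Z → ℝ := fun z => ‖(⟨δ z 1 1, δ z 2 1⟩ : ℂ)‖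
  have hm0 : ∀ z, 0 < m z := fun z => norm_pos_iff.2 (h0' z)
  have hre' : ∀ z, δ z 1 1 = m z * (v z : ℂ).re := fun z => by
    have := congrArg Complex.re (hv z)
    rwa [Complex.re_ofReal_mul] at this
  have him' : ∀ z, δ z 2 1 = m z * (v z : ℂ).im := fun z => by
    have := congrArg Complex.im (hv z)
    rwa [Complex.im_ofReal_mul] at this
  -- A second rotation clears the last off-diagonal entry. The first two diagonal entries are the
  -- norms `ρ` and `m`, and positivity of the third follows from that of the determinant.
  let U : Z → Matrix (Fin 3) (Fin 3) ℝ := fun z => blk 1 ((v z)⁻¹ : Circle) * δ z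
  have u11 : ∀ z, U z 1 1 = m z := fun z => by
    simp only [U, blk_mul_apply_one, hre', him', Circle.coe_inv_eq_conj, Complex.conj_re,
      Complex.conj_im]
    linear_combination m z * hunit (v z)
  have u21 : ∀ z, U z 2 1 = 0 := fun z => by
    simp only [U, blk_mul_apply_two, hre', him', Circle.coe_inv_eq_conj, Complex.conj_re,
      Complex.conj_im]
    ring
  have u00 : ∀ z, U z 0 0 = ρ z := fun z => by
    simp only [U, blk_mul_apply_zero, one_mul, d0]
  have u10 : ∀ z, U z 1 0 = 0 := fun z => by
    simp only [U, blk_mul_apply_one, d1, d2, mul_zero, sub_self]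
  have u20 : ∀ z, U z 2 0 = 0 := fun z => by
    simp only [U, blk_mul_apply_two, d1, d2, mul_zero, add_zero]
  have u22 : ∀ z, 0 < U z 2 2 := fun z => by
    have h1 : (U z).det = (δ z).det := by
      simp only [U, Matrix.det_mul, det_blk_circle, one_mul]
    have h2 : (U z).det = ρ z * m z * U z 2 2 := by
      rw [Matrix.det_fin_three, u00, u11, u10, u20, u21]
      ring
    exact pos_of_mul_pos_right (h2 ▸ h1 ▸ hδd z) (mul_pos (hρ0 z) (hm0 z)).le
  have hU : Null U := null_of_upper ((continuous_blk_circle.comp v.continuous.inv).matrix_mul hδ)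
    u10 u20 u21 fun z i => by
      fin_cases i
      · exact u00 z ▸ hρ0 z
      · exact u11 z ▸ hm0 z
      · exact u22 z
  -- From `γ = w G⁻¹ v U` the two rotations are collected as `(w v) (v⁻¹ G⁻¹ v) U`. A conjugate of a
  -- null function is null.
  refine ⟨w * v, fun z => ((blk 1 (v z))⁻¹ * (G z)⁻¹ * blk 1 (v z)) * U z,
    (hG.inv.conj (continuous_blk_circle.comp v.continuous) fun z =>
      (det_blk_circle (v z)).trans_ne one_ne_zero).mul hU, fun z => ?_⟩
  have hvu : IsUnit (blk 1 (v z : ℂ)).det := by rw [det_blk_circle]; exact isUnit_one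
  have hwu : IsUnit (blk 1 (w z : ℂ)).det := by rw [det_blk_circle]; exact isUnit_one
  have hGu : IsUnit (G z).det := by rw [hGd]; exact isUnit_one
  simp only [U, δ, γ', ← blk_circle_inv, ContinuousMap.mul_apply, ← blk_circle_mul]
  simp only [Matrix.mul_assoc]
  rw [Matrix.mul_nonsing_inv_cancel_left _ _ hvu, Matrix.mul_nonsing_inv_cancel_left _ _ hvu,
    Matrix.nonsing_inv_mul_cancel_left _ _ hGu, Matrix.mul_nonsing_inv_cancel_left _ _ hwu]

end Blocks

/-! ### Circle-valued functions: descent, logarithms, degree -/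

section Degree

variable {Z : Type*} [TopologicalSpace Z]

theorem circle_exp_add_int (x : ℝ) (n : ℤ) :
    Circle.exp (2 * Real.pi * (x + n)) = Circle.exp (2 * Real.pi * x) :=
  Circle.exp_eq_exp.2 ⟨n, by ring⟩

/-- Openness is recorded because it makes the product with any parameter space a quotient map again,
as descent of homotopies requires. -/
theorem isOpenQuotientMap_circleParam :
    IsOpenQuotientMap fun θ : ℝ => Circle.exp (2 * Real.pi * θ) := by
  have h2 : (2 * Real.pi) ≠ 0 := by positivity
  refine ⟨fun z => ?_, by fun_prop, ?_⟩
  · obtain ⟨x, hx⟩ := Circle.exp_surjective z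
    exact ⟨x / (2 * Real.pi), by rw [mul_div_cancel₀ _ h2, hx]⟩
  · exact isLocalHomeomorph_circleExp.isOpenMap.comp (Homeomorph.mulLeft₀ _ h2).isOpenMap

/-- Periodic continuous families of functions on the line descend to the circle. -/
theorem exists_circle_descent {W : Type*} [TopologicalSpace W] {F : Z × ℝ → W}
    (hF : Continuous F) (hp : ∀ z θ, F (z, θ + 1) = F (z, θ)) :
    ∃ G : C(Z × Circle, W), ∀ z θ, G (z, Circle.exp (2 * Real.pi * θ)) = F (z, θ) := by
  have hn : ∀ z θ (n : ℤ), F (z, θ + n) = F (z, θ) := fun z θ n => by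
    have hP : Function.Periodic (fun θ => F (z, θ)) 1 := fun θ => hp z θ
    simpa using hP.int_mul n θ
  let g : Z × Circle → W := fun p =>
    F (p.1, Function.surjInv isOpenQuotientMap_circleParam.surjective p.2)
  have hg : ∀ z θ, g (z, Circle.exp (2 * Real.pi * θ)) = F (z, θ) := fun z θ => by
    obtain ⟨n, hn'⟩ := Circle.exp_eq_exp.1
      (Function.surjInv_eq isOpenQuotientMap_circleParam.surjective
        (Circle.exp (2 * Real.pi * θ)))
    have : Function.surjInv isOpenQuotientMap_circleParam.surjective
        (Circle.exp (2 * Real.pi * θ)) = θ + n := by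
      have h2 : (2 * Real.pi) ≠ 0 := by positivity
      apply mul_left_cancel₀ h2
      rw [hn']
      ring
    show F (z, _) = _
    rw [this, hn]
  refine ⟨⟨g, ?_⟩, hg⟩
  have hq := (IsOpenQuotientMap.id (X := Z)).prodMap isOpenQuotientMap_circleParam
  rw [hq.isQuotientMap.continuous_iff]
  exact hF.congr fun p => (hg p.1 p.2).symm

theorem exists_circle_descent' {W : Type*} [TopologicalSpace W] {F : ℝ → W}
    (hF : Continuous F) (hp : ∀ θ, F (θ + 1) = F θ) :
    ∃ G : C(Circle, W), ∀ θ, G (Circle.exp (2 * Real.pi * θ)) = F θ := by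
  obtain ⟨G, hG⟩ := exists_circle_descent (Z := Unit) (F := fun p => F p.2) (by fun_prop)
    fun _ θ => hp θ
  exact ⟨⟨fun z => G ((), z), by fun_prop⟩, fun θ => hG () θ⟩

/-- Null-homotopic functions with values in the circle have a logarithm. -/
theorem exists_log_of_homotopic_one {f : C(Z, Circle)} (h : ContinuousMap.Homotopic 1 f) :
    ∃ β : C(Z, ℝ), ∀ z, f z = Circle.exp (β z) := by
  obtain ⟨F⟩ := h
  have h0 : ∀ z, F (0, z) = Circle.exp ((0 : C(Z, ℝ)) z) := fun z => by simp
  let H := Circle.isCoveringMap_exp.liftHomotopy F.toContinuousMap (0 : C(Z, ℝ)) h0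
  have hH := Circle.isCoveringMap_exp.liftHomotopy_lifts F.toContinuousMap (0 : C(Z, ℝ)) h0
  refine ⟨⟨fun z => H (1, z), by fun_prop⟩, fun z => ?_⟩
  have := congrFun hH (1, z)
  exact ((F.apply_one z).symm.trans this.symm)

theorem homotopic_mul_exp (f : C(Z, Circle)) (β : C(Z, ℝ)) :
    f.Homotopic ⟨fun z => f z * Circle.exp (β z), by fun_prop⟩ :=
  ⟨{ toFun := fun p => f p.2 * Circle.exp (p.1 * β p.2)
     continuous_toFun := by fun_prop
     map_zero_left := fun z => by simp
     map_one_left := fun z => by simp }⟩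

theorem exists_log_of_homotopic {f g : C(Z, Circle)} (h : g.Homotopic f) :
    ∃ β : C(Z, ℝ), ∀ z, f z = g z * Circle.exp (β z) := by
  obtain ⟨F⟩ := h
  obtain ⟨β, hβ⟩ := exists_log_of_homotopic_one (f := f * g⁻¹)
    ⟨{ toFun := fun p => F p * (g p.2)⁻¹
       continuous_toFun := by fun_prop
       map_zero_left := fun z => by simp
       map_one_left := fun z => by simp }⟩
  refine ⟨β, fun z => ?_⟩
  rw [← hβ, ContinuousMap.mul_apply, ContinuousMap.inv_apply, mul_comm, inv_mul_cancel_right]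

theorem circlePow_apply (n : ℤ) (z : Circle) : circlePow n z = z ^ n := rfl

/-- Every self-map of the circle has a degree. -/
theorem exists_homotopic_circlePow (g : C(Circle, Circle)) : ∃ n, g.Homotopic (circlePow n) := by
  let g' : C(ℝ, Circle) := ⟨fun θ => g (Circle.exp (2 * Real.pi * θ)), by fun_prop⟩
  obtain ⟨x₀, hx₀⟩ := Circle.exp_surjective (g' 0)
  obtain ⟨G, ⟨-, hG⟩, -⟩ := Circle.isCoveringMap_exp.existsUnique_continuousMap_lifts g' 0 x₀ hx₀
  have hG' : ∀ θ, Circle.exp (G θ) = g (Circle.exp (2 * Real.pi * θ)) := fun θ => congrFun hG θ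
  have h2 : (2 * Real.pi) ≠ 0 := by positivity
  have hn : ∀ θ, ∃ n : ℤ, G (θ + 1) - G θ = n * (2 * Real.pi) := fun θ => by
    have : Circle.exp (G (θ + 1)) = Circle.exp (G θ) := by
      rw [hG', hG']
      have := circle_exp_add_int θ 1
      rw [Int.cast_one] at this
      rw [this]
    obtain ⟨n, hn⟩ := Circle.exp_eq_exp.1 this
    exact ⟨n, by rw [hn]; ring⟩
  choose n hn using hn
  have hc : Continuous n := by
    have : Continuous fun θ => ((n θ : ℤ) : ℝ) := by
      have : (fun θ => ((n θ : ℤ) : ℝ)) = fun θ => (G (θ + 1) - G θ) / (2 * Real.pi) := by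
        ext θ
        rw [hn, mul_div_cancel_right₀ _ h2]
      rw [this]
      fun_prop
    exact Int.isClosedEmbedding_coe_real.isEmbedding.continuous_iff.2 this
  have hconst : ∀ θ, n θ = n 0 := fun θ => PreconnectedSpace.constant inferInstance hc
  -- The lift `G` grows by `2π n 0` in each period, so its difference from the linear function of
  -- that slope descends to the circle.
  obtain ⟨β, hβ⟩ := exists_circle_descent' (F := fun θ => 2 * Real.pi * n 0 * θ - G θ)
    (by fun_prop) fun θ => by
      have := hn θ
      rw [hconst] at this
      linarith
  refine ⟨n 0, ?_⟩
  have := homotopic_mul_exp g β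
  convert this using 1
  ext1 z
  obtain ⟨θ, rfl⟩ := isOpenQuotientMap_circleParam.surjective z
  show Circle.exp (2 * Real.pi * θ) ^ n 0 = g _ * Circle.exp (β _)
  rw [hβ, ← hG', ← Circle.exp_add, ← Circle.exp_zsmul]
  congr 1
  simp only [zsmul_eq_mul]
  ring

theorem homotopic_pow {W : Type*} [TopologicalSpace W] {f g : C(W, Circle)}
    (h : f.Homotopic g) (n : ℕ) :
    ContinuousMap.Homotopic (f ^ n) (g ^ n) := by
  obtain ⟨F⟩ := h
  exact ⟨{ toFun := fun p => F p ^ n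
           continuous_toFun := by fun_prop
           map_zero_left := fun z => by simp
           map_one_left := fun z => by simp }⟩

end Degree

/-! ### Nullity of rotations along a basis of loops -/

section LoopBasis

variable {Y : Type*} [TopologicalSpace Y] {ι : Type*} {c : ι → C(Circle, Y)}

/-- An odd power differs from the first by a square, and squares are null. -/
theorem null_blk_of_null_odd (m : ℤ) (h : Null fun z : Circle => blk 1 ((z ^ (2 * m + 1) : Circle) : ℂ)) :
    Null fun z : Circle => blk 1 (z : ℂ) := by
  have h1 := (null_blk_sq (continuous_zpow (-m) : Continuous fun z : Circle => z ^ (-m))).mul h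
  refine (congrArg Null (funext fun z => ?_)).mp h1
  rw [blk_circle_mul, ← zpow_natCast, ← zpow_mul, ← zpow_add]
  congr 2
  push_cast
  rw [show -m * 2 + (2 * m + 1) = 1 by ring, zpow_one]

/-- Circle-valued functions are detected along a basis of loops up to null rotations. -/
theorem IsLoopBasis.null_blk (hc : IsLoopBasis c) (f : C(Y, Circle))
    (h : ∀ i, Null fun z => blk 1 (f (c i z) : ℂ)) : Null fun y => blk 1 (f y : ℂ) := by
  -- This case distinction dispenses with the non-triviality of the fundamental group of `SO(3)`. If
  -- the basic rotation loop is null, every rotation function is. Otherwise nullity along the loops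
  -- forces even degrees.
  by_cases hid : Null fun z : Circle => blk 1 (z : ℂ)
  · exact hid.comp f.continuous
  · choose n hn using fun i => exists_homotopic_circlePow (f.comp (c i))
    have heven : ∀ i, ∃ m : ℤ, n i = 2 * m := fun i => by
      rcases Int.even_or_odd' (n i) with ⟨m, hm | hm⟩
      · exact ⟨m, hm⟩
      · refine absurd (null_blk_of_null_odd m ?_) hid
        rw [← hm]
        exact Null.of_homotopic (hn i) continuous_blk_circle
          (fun w => (det_blk_circle w).trans_ne one_ne_zero) (h i)
    choose m hm using heven
    obtain ⟨g, hg⟩ := hc.1 m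
    -- The degrees of `f` are all even, so `f` is a square up to homotopy.
    have hfg : (g ^ 2).Homotopic f := by
      refine hc.2 _ _ fun i => ?_
      refine ContinuousMap.Homotopic.trans ?_ (hn i).symm
      have := homotopic_pow (hg i) 2
      have e : circlePow (m i) ^ 2 = circlePow (n i) := by
        ext1 z
        rw [ContinuousMap.pow_apply, circlePow_apply, circlePow_apply, hm, ← zpow_natCast,
          ← zpow_mul, mul_comm]
        rfl
      exact e ▸ this
    exact Null.of_homotopic hfg continuous_blk_circle
      (fun w => (det_blk_circle w).trans_ne one_ne_zero) (null_blk_sq g.continuous)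

end LoopBasis

/-! ### Matrix functions on a curve -/

section Perturbation

variable {Y : Type*} [TopologicalSpace Y] [CompactSpace Y] [T2Space Y]

/-- The bounded Tietze theorem is applied to real and imaginary parts separately, at the price of
the factor 2. -/
theorem exists_extension_lt {K : Set Y} (hK : IsClosed K) (g : C(K, ℂ)) {ε : ℝ} (hε : 0 < ε)
    (hg : ∀ t, ‖g t‖ < ε) : ∃ G : C(Y, ℂ), (∀ t : K, G t = g t) ∧ ∀ t, ‖G t‖ < 2 * ε := by
  have key : ∀ r : C(K, ℝ), (∀ t, |r t| < ε) → ∃ R : C(Y, ℝ), (∀ t : K, R t = r t) ∧ ∀ t, |R t| < ε := by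
    intro r hr
    obtain ⟨R, hR, hRr⟩ := ContinuousMap.exists_restrict_eq_forall_mem_of_closed (t := Set.Ioo (-ε) ε) r
      (fun t => abs_lt.1 (hr t)) ⟨0, by simp [hε]⟩ hK
    exact ⟨R, fun t => congrArg (fun q : C(K, ℝ) => q t) hRr, fun t => abs_lt.2 (hR t)⟩
  obtain ⟨R, hR, hR'⟩ := key ⟨fun t => (g t).re, by fun_prop⟩
    fun t => (Complex.abs_re_le_norm _).trans_lt (hg t)
  obtain ⟨I, hI, hI'⟩ := key ⟨fun t => (g t).im, by fun_prop⟩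
    fun t => (Complex.abs_im_le_norm _).trans_lt (hg t)
  refine ⟨⟨fun t => R t + I t * Complex.I, by fun_prop⟩, fun t => ?_, fun t => ?_⟩
  · show (R t : ℂ) + I t * Complex.I = g t
    rw [hR, hI]
    exact Complex.re_add_im _
  · show ‖(R t : ℂ) + I t * Complex.I‖ < _
    refine (norm_add_le _ _).trans_lt ?_
    rw [norm_mul, Complex.norm_I, mul_one, Complex.norm_real, Complex.norm_real]
    have h1 := hR' t
    have h2 := hI' t
    simp only [Real.norm_eq_abs]
    linarith

theorem avoidable_zero {κ : Type*} [Fintype κ] [Nonempty κ] :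
    Avoidable ℝ ({0} : Set (κ → ℂ)) := by
  have h : Module.finrank ℝ ℝ + Module.finrank ℝ (Fin 0 → ℝ) < Module.finrank ℝ (κ → ℂ) := by
    have h2 : Module.finrank ℝ (κ → ℂ) = 2 * Fintype.card κ := by
      rw [Module.finrank_pi_fintype]
      simp [mul_comm]
    rw [h2]
    have : 0 < Fintype.card κ := Fintype.card_pos
    simp
    omega
  exact avoidable_of_subset_range (F₁ := Fin 0 → ℝ) (F₂ := Fin 0 → ℝ) (q₁ := fun _ => 0)
    (q₂ := fun _ => 0) contDiff_const contDiff_const (fun v hv => Or.inl ⟨0, hv.symm⟩) h h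

/-- Complex functions on a curve are approximated by functions without zeros. -/
theorem exists_near_ne_zero {S : Type*} [TopologicalSpace S] [CompactSpace S] [T2Space S]
    {q : S → Y} (hq : IsSpread ℝ q ∅) (ζ : C(Y, ℂ)) {ε : ℝ} (hε : 0 < ε) :
    ∃ ζ' : C(Y, ℂ), (∀ y, ‖ζ' y - ζ y‖ < ε) ∧ ∀ y, ζ' y ≠ 0 := by
  have hloc : ∀ x : S, ∃ K ∈ 𝓝 x, IsCompact K ∧ Set.InjOn q K ∧
      ∃ j : S → ℝ, ContinuousOn j K ∧ Set.InjOn j K := fun x => by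
    obtain ⟨K, hK, hi, j, hj, hji⟩ := hq.exists_nhds x (by simp)
    obtain ⟨K', hK', hK'K, hc⟩ := local_compact_nhds hK
    exact ⟨K', hK', hc, hi.mono hK'K, j, hj.mono hK'K, hji.mono hK'K⟩
  choose K hK hKc hKi hKj using hloc
  obtain ⟨s, -, hs⟩ := isCompact_univ.elim_nhds_subcover K fun x _ => hK x
  -- The tolerance is quantified inside the induction, since each step passes half of it to the
  -- previous one.
  have key : ∀ s : Finset S, ∀ ε > 0, ∃ ζ' : C(Y, ℂ), (∀ y, ‖ζ' y - ζ y‖ < ε) ∧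
      ∀ x ∈ s, ∀ y ∈ q '' K x, ζ' y ≠ 0 := by
    classical
    intro s
    induction s using Finset.induction_on with
    | empty => exact fun ε hε => ⟨ζ, fun y => by simpa using hε, by simp⟩
    | insert x s hx ih =>
      intro ε hε
      obtain ⟨ζ₁, h₁, h₁'⟩ := ih (ε / 2) (by positivity)
      let D : Set Y := ⋃ x ∈ s, q '' K x
      have hD : IsCompact D := s.isCompact_biUnion fun x _ => (hKc x).image hq.continuous
      obtain ⟨η, hη, hηD⟩ : ∃ η > 0, ∀ y ∈ D, η ≤ ‖ζ₁ y‖ := by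
        rcases D.eq_empty_or_nonempty with h | h
        · exact ⟨1, one_pos, by simp [h]⟩
        · obtain ⟨y₀, hy₀, hm⟩ := hD.exists_isMinOn h (f := fun y => ‖ζ₁ y‖) (by fun_prop)
          obtain ⟨x', hx', hy'⟩ := Set.mem_iUnion₂.1 hy₀
          exact ⟨‖ζ₁ y₀‖, norm_pos_iff.2 (h₁' x' hx' y₀ hy'), fun y hy => hm hy⟩
      -- The extended correction is below `2 e`. This is at most the remaining tolerance and at most
      -- the minimum modulus on the pieces already treated.
      let e := min (ε / 2) η / 2
      have he : 0 < e := by positivity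
      have hQ : IsClosed (q '' K x) := ((hKc x).image hq.continuous).isClosed
      obtain ⟨j, hj, hji⟩ := hKj x
      -- the inverse of `q` on the image of `K x`
      have : CompactSpace (K x) := isCompact_iff_compactSpace.1 (hKc x)
      let E : K x ≃ q '' K x := Equiv.Set.imageOfInjOn q (K x) (hKi x)
      have hE : Continuous E := (hq.continuous.comp continuous_subtype_val).subtype_mk _
      have hE' : Continuous E.symm := (hE.homeoOfEquivCompactToT2 (f := E)).symm.continuous
      have hjc : Continuous fun y : q '' K x => j (E.symm y) :=
        (continuousOn_iff_continuous_domRestrict.1 hj).comp hE'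
      have hjinj : Function.Injective fun y : q '' K x => j (E.symm y) := fun a b hab =>
        E.symm.injective (Subtype.ext (hji (E.symm a).2 (E.symm b).2 hab))
      have : CompactSpace (q '' K x) := isCompact_iff_compactSpace.1 hQ.isCompact
      obtain ⟨g, hg, hgn, hg0⟩ := exists_near_avoiding (κ := Unit) hjc hjinj avoidable_zero
        (h := fun y _ => ζ₁ y) (by fun_prop) he
      obtain ⟨G, hG, hG'⟩ := exists_extension_lt hQ ⟨fun y => g y () - ζ₁ y, by fun_prop⟩ he
        fun y => (norm_le_pi_norm (g y - fun _ => ζ₁ y) ()).trans_lt (hgn y)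
      have hee : 2 * e = min (ε / 2) η := by simp only [e]; ring
      refine ⟨ζ₁ + G, fun y => ?_, fun x' hx' y hy => ?_⟩
      · have h2 := hG' y
        rw [hee] at h2
        have h3 := h2.trans_le (min_le_left _ _)
        have h4 : (ζ₁ + G) y - ζ y = (ζ₁ y - ζ y) + G y := by
          rw [ContinuousMap.add_apply]; ring
        rw [h4]
        exact (norm_add_le _ _).trans_lt (by linarith [h₁ y])
      · rw [ContinuousMap.add_apply]
        rcases Finset.mem_insert.1 hx' with rfl | hx'
        · have h2 := hG ⟨y, hy⟩
          simp only at h2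
          rw [h2]
          intro h0
          apply hg0 ⟨y, hy⟩
          ext u
          show g ⟨y, hy⟩ () = 0
          simpa using h0
        · intro h0
          have h2 := hG' y
          rw [hee] at h2
          have h3 := h2.trans_le (min_le_right _ _)
          have h4 := hηD y (Set.mem_biUnion hx' hy)
          rw [eq_neg_of_add_eq_zero_left h0, norm_neg] at h4
          linarith
  obtain ⟨ζ', h1, h2⟩ := key s ε hε
  refine ⟨ζ', h1, fun y => ?_⟩
  obtain ⟨x, rfl⟩ := hq.surjective y
  obtain ⟨x', hx', hxK⟩ := Set.mem_iUnion₂.1 (hs (Set.mem_univ x))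
  exact h2 x' hx' _ ⟨x, hxK, rfl⟩

/-- A matrix function of positive determinant on a curve is null if it is null along a basis of
loops. -/
theorem IsLoopBasis.null {S : Type*} [TopologicalSpace S] [CompactSpace S] [T2Space S]
    {q : S → Y} (hq : IsSpread ℝ q ∅) {ι : Type*} {c : ι → C(Circle, Y)} (hc : IsLoopBasis c)
    {γ : Y → Matrix (Fin 3) (Fin 3) ℝ} (hγ : Continuous γ) (hd : ∀ y, 0 < (γ y).det)
    (h : ∀ i, Null fun z => γ (c i z)) : Null γ := by
  let P : Y × ℂ → Matrix (Fin 3) (Fin 3) ℝ := fun p =>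
    γ p.1 + !![0, 0, 0; p.2.re, 0, 0; p.2.im, 0, 0]
  have hP : Continuous P := by
    refine (hγ.comp continuous_fst).add (continuous_matrix fun i j => ?_)
    fin_cases i <;> fin_cases j <;> simp <;> fun_prop
  -- Compactness of `Y` gives one bound under which every change of the two lower entries of the
  -- first column keeps the determinant positive.
  have hopen : IsOpen {w : ℂ | ∀ y, 0 < (P (y, w)).det} := by
    have hcl : IsClosed {p : Y × ℂ | (P p).det ≤ 0} := isClosed_le hP.matrix_det continuous_const
    have := (isClosedMap_snd_of_compactSpace _ hcl).isOpen_compl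
    convert this using 1
    ext w
    simp
  obtain ⟨ε, hε, hball⟩ := Metric.isOpen_iff.1 hopen 0 fun y => by
    have : P (y, 0) = γ y := by
      ext i j
      fin_cases i <;> fin_cases j <;> simp [P]
    rw [this]
    exact hd y
  obtain ⟨ζ', h1, h2⟩ := exists_near_ne_zero hq ⟨fun y => (⟨γ y 1 0, γ y 2 0⟩ : ℂ),
    Complex.equivRealProdCLM.symm.continuous.comp
      ((hγ.matrix_elem 1 0).prodMk (hγ.matrix_elem 2 0))⟩ hε
  let ζ : Y → ℂ := fun y => (⟨γ y 1 0, γ y 2 0⟩ : ℂ)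
  have hζ : Continuous ζ := Complex.equivRealProdCLM.symm.continuous.comp
      ((hγ.matrix_elem 1 0).prodMk (hγ.matrix_elem 2 0))
  let K : unitInterval × Y → Matrix (Fin 3) (Fin 3) ℝ := fun p =>
    P (p.2, (p.1 : ℝ) * (ζ' p.2 - ζ p.2))
  have hK : Continuous K := hP.comp (by fun_prop)
  have hKd : ∀ p, 0 < (K p).det := fun p => by
    refine hball (mem_ball_zero_iff.2 ?_) p.2
    rw [norm_mul, Complex.norm_real, Real.norm_of_nonneg p.1.2.1]
    exact (mul_le_of_le_one_left (norm_nonneg _) p.1.2.2).trans_lt (h1 p.2)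
  have hK0 : ∀ y, K (0, y) = γ y := fun y => by
    ext i j
    fin_cases i <;> fin_cases j <;> simp [K, P]
  have hK1 : ∀ y, (⟨K (1, y) 1 0, K (1, y) 2 0⟩ : ℂ) = ζ' y := fun y => by
    apply Complex.ext <;> simp [K, P, ζ]
  have hKn := null_inv_mul_of_path hK fun p => (hKd p).ne'
  obtain ⟨f, N, hN, hfN⟩ := exists_blk_mul_null (γ := fun y => K (1, y)) (by fun_prop)
    (fun y => hKd _) fun y => by
      rw [hK1]
      exact h2 y
  -- `γ = blk f * N * (γ⁻¹ K₁)⁻¹`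
  have hfac : ∀ y, γ y = blk 1 (f y) * (N y * ((K (0, y))⁻¹ * K (1, y))⁻¹) := fun y => by
    have hu0 : IsUnit (K (0, y)).det := (hKd _).ne'.isUnit
    have hu1 : IsUnit (K (1, y)).det := (hKd _).ne'.isUnit
    rw [← Matrix.mul_assoc, ← hfN, Matrix.mul_inv_rev, Matrix.nonsing_inv_nonsing_inv _ hu0,
      Matrix.mul_nonsing_inv_cancel_left _ _ hu1, hK0]
  have hM := hN.mul hKn.inv
  -- Along each loop the rotation is the quotient of `γ`, null by hypothesis, and of a globally null
  -- factor.
  have hf : Null fun y => blk 1 (f y : ℂ) := hc.null_blk f fun i => by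
    have h3 := (h i).mul (hM.comp (c i).continuous).inv
    refine (congrArg Null (funext fun z => ?_)).mp h3
    conv_lhs => rw [hfac (c i z)]
    exact Matrix.mul_nonsing_inv_cancel_right _ _ (hM.det_ne_zero (c i z)).isUnit
  exact (congrArg Null (funext fun y => (hfac y).symm)).mp (hf.mul hM)

end Perturbation

/-! ### The real trivialization attached to a complex section -/

/-- The matrix of the real frame `Re z, Im z` of `2L*` completed to determinant `1`, where `w` is
the conjugate of `z`. -/
noncomputable def coframeMat (z w : ℂ) : Matrix (Fin 3) (Fin 3) ℂ :=
  !![(z * w)⁻¹, 0, 0; 0, (z + w) / 2, (z - w) / (2 * Complex.I);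
    0, -((z - w) / (2 * Complex.I)), (z + w) / 2]

theorem det_coframeMat {z w : ℂ} (hz : z ≠ 0) (hw : w ≠ 0) : (coframeMat z w).det = 1 := by
  have hI := Complex.I_ne_zero
  rw [Matrix.det_fin_three]
  simp [coframeMat]
  field_simp
  rw [Complex.I_sq]
  ring

theorem coframeMat_scale {c : ℂ} (hc : c ≠ 0) (z w : ℂ) (i j : Fin 3) :
    coframeMat (c⁻¹ * z) (c⁻¹ * w) i j = c ^ wt j * coframeMat z w i j := by
  have h2 : c ^ (2 : ℤ) = c ^ 2 := by norm_cast
  fin_cases i <;> fin_cases j <;> simp [coframeMat, wt, h2] <;> field_simp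

/-- Passing to the conjugate vector replaces the coordinates of the section and of its conjugate by
`conj w` and `conj z`. This symmetry is the reality of the trivialization. -/
theorem coframeMat_conj (z w : ℂ) (i j : Fin 3) :
    coframeMat (starRingEnd ℂ w) (starRingEnd ℂ z) i j = starRingEnd ℂ (coframeMat z w i j) := by
  have h2 : starRingEnd ℂ 2 = 2 := map_ofNat _ 2
  fin_cases i <;> fin_cases j <;> simp [coframeMat, h2] <;> ring

/-- On real vectors the trivialization is a dilated rotation by minus the argument of the section.
This links half-turns of the frame to the phase. -/
theorem coframeMat_self_conj (z : ℂ) :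
    coframeMat z (starRingEnd ℂ z) =
      (blk (Complex.normSq z)⁻¹ (starRingEnd ℂ z)).map Complex.ofReal := by
  have h1 : z + starRingEnd ℂ z = 2 * (z.re : ℂ) := by rw [Complex.add_conj]; push_cast; ring
  have h2 : z - starRingEnd ℂ z = 2 * Complex.I * (z.im : ℂ) := by
    rw [Complex.sub_conj]; push_cast; ring
  have hI := Complex.I_ne_zero
  ext i j
  fin_cases i <;> fin_cases j <;> simp [coframeMat, blk, h1, h2, Complex.mul_conj]

theorem continuousOn_coframeMat {Z : Type*} [TopologicalSpace Z] {z w : Z → ℂ} {Q : Set Z}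
    (hz : ContinuousOn z Q) (hw : ContinuousOn w Q) (h0 : ∀ t ∈ Q, z t ≠ 0)
    (h0' : ∀ t ∈ Q, w t ≠ 0) (i j : Fin 3) :
    ContinuousOn (fun t => coframeMat (z t) (w t) i j) Q := by
  have h1 : ContinuousOn (fun t => (z t * w t)⁻¹) Q :=
    (hz.mul hw).inv₀ fun t ht => mul_ne_zero (h0 t ht) (h0' t ht)
  have h2 : ContinuousOn (fun t => (z t + w t) / 2) Q := (hz.add hw).div_const _
  have h3 : ContinuousOn (fun t => (z t - w t) / (2 * Complex.I)) Q := (hz.sub hw).div_const _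
  fin_cases i <;> fin_cases j <;> first | exact h1 | exact h2 | exact h3 | exact h3.neg | exact continuousOn_const

/-! ### Nowhere zero sections over the real part and their phase -/

section DualSections

variable {B : Type*} [TopologicalSpace B] {σ : B → B} {L : B → Type*} [∀ x, AddCommGroup (L x)]
  [∀ x, Module ℂ (L x)] [∀ x, TopologicalSpace (L x)] [TopologicalSpace (TotalSpace ℂ L)]
  [FiberBundle ℂ L] [VectorBundle ℂ ℂ L] {φ : Conjugation σ L}
  {T : Type*} [TopologicalSpace T] {f : T → B} {b : T → TotalSpace ℂ L → ℂ}

/-- A nowhere zero section along `f` of the line bundle, described by its coordinate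
`b t p` with respect to nonzero vectors `p`. -/
structure IsUnitSec (f : T → B) (b : T → TotalSpace ℂ L → ℂ) : Prop where
  sec : IsSec f (fun _ : Unit => (-1 : ℤ)) Set.univ fun t p _ => b t p
  ne_zero : ∀ t p, p.1 = f t → p.2 ≠ 0 → b t p ≠ 0

theorem IsUnitSec.scale (h : IsUnitSec f b) (t : T) {p : TotalSpace ℂ L} (hp : p.1 = f t)
    (hp0 : p.2 ≠ 0) {c : ℂ} (hc : c ≠ 0) : b t (scale c p) = c⁻¹ * b t p := by
  have := h.sec.hom t trivial p hp hp0 c hc ()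
  rwa [zpow_neg_one] at this

theorem IsUnitSec.continuousOn_locSec (h : IsUnitSec f b) (a : B) :
    ContinuousOn (fun t => b t (locSec L a (f t))) (f ⁻¹' (trivializationAt ℂ L a).baseSet) := by
  have := h.sec.cont a
  rw [Set.univ_inter] at this
  exact (continuous_apply ()).comp_continuousOn this

theorem IsUnitSec.continuous_comp (h : IsUnitSec f b) {Z : Type*} [TopologicalSpace Z]
    {s : Z → T} {q : Z → TotalSpace ℂ L} (hs : Continuous s) (hq : Continuous q)
    (hqs : ∀ z, (q z).1 = f (s z)) (hq0 : ∀ z, (q z).2 ≠ 0) : Continuous fun z => b (s z) (q z) := by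
  have := h.sec.continuousOn_comp (Q := Set.univ) hs.continuousOn hq.continuousOn
    (fun _ _ => trivial) (fun z _ => hqs z) fun z _ => hq0 z
  exact continuousOn_univ.1 ((continuous_apply ()).comp_continuousOn this)

/-- The conjugate section. -/
noncomputable def conjUnitSec (φ : Conjugation σ L) (b : T → TotalSpace ℂ L → ℂ) (t : T)
    (p : TotalSpace ℂ L) : ℂ := starRingEnd ℂ (b t (φ.tot p))

theorem conjUnitSec_of_real {t : T} {p : TotalSpace ℂ L} (h : φ.tot p = p) :
    conjUnitSec φ b t p = starRingEnd ℂ (b t p) := by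
  rw [conjUnitSec, h]

theorem IsUnitSec.conj (h : IsUnitSec f b) (φ : Conjugation σ L) (hf : Continuous f)
    (hσ : ∀ t, σ (f t) = f t) : IsUnitSec f (conjUnitSec φ b) :=
  ⟨h.sec.conjSec φ hf continuous_id (fun t => (hσ t).symm) fun _ _ => trivial,
    fun t p hp hp0 => (map_ne_zero _).2 (h.ne_zero t _ (by rw [φ.tot_proj, hp, hσ])
      (φ.tot_snd_ne_zero hp0))⟩

theorem IsUnitSec.isFrameFamily (h : IsUnitSec f b) (φ : Conjugation σ L) (hf : Continuous f)
    (hσ : ∀ t, σ (f t) = f t) :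
    IsFrameFamily φ f id Set.univ fun t p => coframeMat (b t p) (conjUnitSec φ b t p) := by
  have h' := h.conj φ hf hσ
  refine ⟨⟨fun t _ p hp hp0 c hc k => ?_, fun a => ?_⟩, fun t _ p hp hp0 k => ?_,
    fun t _ p hp hp0 => ?_⟩
  · simp only [h.scale t hp hp0 hc, h'.scale t hp hp0 hc]
    exact coframeMat_scale hc _ _ k.1 k.2
  · rw [Set.univ_inter]
    exact continuousOn_pi.2 fun k => continuousOn_coframeMat (h.continuousOn_locSec a)
      (h'.continuousOn_locSec a) (fun t ht => h.ne_zero t _ rfl (locSec_snd_ne_zero ht))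
      (fun t ht => h'.ne_zero t _ rfl (locSec_snd_ne_zero ht)) k.1 k.2
  · have e1 : b t (φ.tot p) = starRingEnd ℂ (conjUnitSec φ b t p) := by
      rw [conjUnitSec, Complex.conj_conj]
    have e2 : conjUnitSec φ b t (φ.tot p) = starRingEnd ℂ (b t p) := by
      rw [conjUnitSec, φ.tot_tot]
    show coframeMat (b t (φ.tot p)) (conjUnitSec φ b t (φ.tot p)) k.1 k.2 = _
    rw [e1, e2]
    exact coframeMat_conj _ _ k.1 k.2
  · rw [det_coframeMat (h.ne_zero t p hp hp0) (h'.ne_zero t p hp hp0)]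
    exact one_ne_zero

/-- The ratio of a section and its conjugate. -/
theorem IsUnitSec.exists_phase (h : IsUnitSec f b) (φ : Conjugation σ L) (hf : Continuous f)
    (hσ : ∀ t, σ (f t) = f t) :
    ∃ u : C(T, Circle), ∀ t p, p.1 = f t → p.2 ≠ 0 → b t p = u t * conjUnitSec φ b t p := by
  have h' := h.conj φ hf hσ
  have hb : ∀ t, (⟨f t, baseVec L (f t)⟩ : TotalSpace ℂ L).2 ≠ 0 := fun t => baseVec_ne_zero _
  let v : T → ℂ := fun t =>
    b t ⟨f t, baseVec L (f t)⟩ / conjUnitSec φ b t ⟨f t, baseVec L (f t)⟩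
  have hv : ∀ t p, p.1 = f t → p.2 ≠ 0 → v t = b t p / conjUnitSec φ b t p := by
    intro t p hp hp0
    obtain ⟨c, hc, rfl⟩ := exists_scale_eq (p := ⟨f t, baseVec L (f t)⟩) (q := p) hp.symm (hb t) hp0
    rw [h.scale t rfl (hb t) hc, h'.scale t rfl (hb t) hc,
      mul_div_mul_left _ _ (inv_ne_zero hc)]
  have hvc : Continuous v := continuous_iff_continuousAt.2 fun t => by
    have ha : f t ∈ (trivializationAt ℂ L (f t)).baseSet :=
      FiberBundle.mem_baseSet_trivializationAt' _
    have ho := ((trivializationAt ℂ L (f t)).open_baseSet.preimage hf).mem_nhds ha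
    refine (((h.continuousOn_locSec (f t)).continuousAt ho).div
      ((h'.continuousOn_locSec (f t)).continuousAt ho)
      (h'.ne_zero t _ rfl (locSec_snd_ne_zero ha))).congr ?_
    filter_upwards [ho] with s hs using (hv s _ rfl (locSec_snd_ne_zero hs)).symm
  -- Over a fixed point `φ p = c p`, and `φ² = 1` forces `conj c * c = 1`. So the section and its
  -- conjugate have coordinates of equal modulus.
  have hnorm : ∀ t, ‖v t‖ = 1 := fun t => by
    let p : TotalSpace ℂ L := ⟨f t, baseVec L (f t)⟩
    obtain ⟨c, hc, hcp⟩ := exists_scale_eq (p := p) (q := φ.tot p) (hσ t).symm (hb t)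
      (φ.tot_snd_ne_zero (hb t))
    have e1 : RealPairs.scale (starRingEnd ℂ c * c) p = p := by
      rw [← scale_scale, ← hcp, ← φ.tot_scale, ← hcp, φ.tot_tot]
    have e2 : b t p = (starRingEnd ℂ c * c)⁻¹ * b t p := by
      conv_lhs => rw [← e1]
      exact h.scale t rfl (hb t) (mul_ne_zero ((map_ne_zero _).2 hc) hc)
    have e3 : starRingEnd ℂ c * c = 1 := by
      have := mul_right_cancel₀ (h.ne_zero t p rfl (hb t)) ((one_mul _).trans e2)
      rw [← inv_inv (starRingEnd ℂ c * c), ← this, inv_one]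
    have e4 : ‖c‖ = 1 := by
      have := congrArg norm e3
      rw [norm_mul, RCLike.norm_conj, norm_one] at this
      nlinarith [norm_nonneg c]
    have e5 : conjUnitSec φ b t p = starRingEnd ℂ (c⁻¹ * b t p) := by
      rw [conjUnitSec, hcp, h.scale t rfl (hb t) hc]
    show ‖b t p / conjUnitSec φ b t p‖ = 1
    rw [e5, norm_div, RCLike.norm_conj, norm_mul, norm_inv, e4, inv_one, one_mul,
      div_self (norm_ne_zero_iff.2 (h.ne_zero t p rfl (hb t)))]
  refine ⟨⟨fun t => ⟨v t, mem_sphere_zero_iff_norm.2 (hnorm t)⟩, hvc.subtype_mk _⟩,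
    fun t p hp hp0 => ?_⟩
  show b t p = v t * _
  rw [hv t p hp hp0, div_mul_cancel₀ _ (h'.ne_zero t p hp hp0)]

theorem IsUnitSec.mul (h : IsUnitSec f b) (g : C(T, Circle)) :
    IsUnitSec f fun t p => g t * b t p :=
  ⟨h.sec.mul (g := fun t _ => (g t : ℂ)) (continuous_pi fun _ =>
    continuous_subtype_val.comp g.continuous).continuousOn,
    fun t p hp hp0 => mul_ne_zero (Circle.coe_ne_zero _) (h.ne_zero t p hp hp0)⟩

/-- The section given by a frame of the real part. -/
theorem Conjugation.RealFrameAlong.exists_isUnitSec (s : φ.RealFrameAlong f) :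
    ∃ b : T → TotalSpace ℂ L → ℂ, IsUnitSec f b ∧ (∀ t, b t ⟨f t, s.sec t⟩ = 1) ∧
      ∀ t p, p.1 = f t → p.2 ≠ 0 → φ.tot p = p → (b t p).im = 0 := by
  have hmem : ∀ t, f t ∈ (trivializationAt ℂ L (f t)).baseSet := fun t =>
    FiberBundle.mem_baseSet_trivializationAt' _
  let b : T → TotalSpace ℂ L → ℂ := fun t p => (coord (f t) p)⁻¹ * coord (f t) ⟨f t, s.sec t⟩
  have hbc : ∀ t p, p.1 = f t → p.2 ≠ 0 → RealPairs.scale (b t p) p = ⟨f t, s.sec t⟩ := by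
    intro t p hp hp0
    obtain ⟨c, hc, hcp⟩ := exists_scale_eq (p := p) (q := ⟨f t, s.sec t⟩) hp hp0 (s.ne_zero t)
    have h0 := coord_ne_zero (a := f t) (p := p) (hp ▸ hmem t) hp0
    have : b t p = c := by
      simp only [b]
      rw [hcp, coord_scale, mul_comm c, inv_mul_cancel_left₀ h0]
    rw [this, hcp]
  have hinj : ∀ {p : TotalSpace ℂ L} {c d : ℂ}, p.2 ≠ 0 →
      RealPairs.scale c p = RealPairs.scale d p → c = d := by
    intro p c d hp0 hcd
    have := congrArg (coord p.1) hcd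
    rw [coord_scale, coord_scale] at this
    exact mul_right_cancel₀ (coord_ne_zero (FiberBundle.mem_baseSet_trivializationAt' _) hp0) this
  refine ⟨b, ⟨⟨fun t _ p hp hp0 c hc k => ?_, fun a => continuousOn_pi.2 fun _ => ?_⟩,
    fun t p hp hp0 => ?_⟩, fun t => ?_, fun t p hp hp0 hpr => ?_⟩
  · simp only [b, coord_scale, mul_inv, zpow_neg_one, mul_assoc]
  · rw [Set.univ_inter]
    have h1 : ContinuousOn (fun t => coord a (⟨f t, s.sec t⟩ : TotalSpace ℂ L))
        (f ⁻¹' (trivializationAt ℂ L a).baseSet) :=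
      (continuousOn_coord a).comp s.continuous_sec.continuousOn fun t ht => ht
    refine h1.congr fun t ht => ?_
    refine hinj (p := locSec L a (f t)) (locSec_snd_ne_zero ht) ?_
    rw [hbc t _ rfl (locSec_snd_ne_zero ht)]
    exact (scale_coord_locSec (p := (⟨f t, s.sec t⟩ : TotalSpace ℂ L)) ht).symm
  · exact mul_ne_zero (inv_ne_zero (coord_ne_zero (hp ▸ hmem t) hp0))
      (coord_ne_zero (hmem t) (s.ne_zero t))
  · exact inv_mul_cancel₀ (coord_ne_zero (hmem t) (s.ne_zero t))
  · have h1 := congrArg φ.tot (hbc t p hp hp0)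
    rw [φ.tot_scale, hpr] at h1
    have h2 : φ.tot (⟨f t, s.sec t⟩ : TotalSpace ℂ L) = ⟨f t, s.sec t⟩ := s.isReal t
    rw [h2, ← hbc t p hp hp0] at h1
    exact Complex.conj_eq_iff_im.1 (hinj hp0 h1)

/-- An orientation of the real part determines a frame. -/
theorem Conjugation.RealPartOrientableAlong.exists_frame [CompactSpace B] [T2Space B]
    (h : φ.RealPartOrientableAlong f) : Nonempty (φ.RealFrameAlong f) := by
  obtain ⟨ν, hν, hν0, hνs, -⟩ := exists_metric φ
  obtain ⟨o, ho⟩ := h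
  -- the unit vector of a half-line
  have key : ∀ {y : T} {v w : L (f y)} (hv : v ≠ 0) (hw : w ≠ 0),
      rayOfNeZero ℝ v hv = rayOfNeZero ℝ w hw →
      (((Real.sqrt (ν ⟨f y, v⟩))⁻¹ : ℝ) : ℂ) • v = (((Real.sqrt (ν ⟨f y, w⟩))⁻¹ : ℝ) : ℂ) • w := by
    intro y v w hv hw hvw
    obtain ⟨r, hr, hrw⟩ := ((ray_eq_iff hv hw).1 hvw).exists_pos_left hv hw
    have hrw' : w = (r : ℂ) • v := by rw [← hrw, Complex.coe_smul]
    have e : ν ⟨f y, w⟩ = r ^ 2 * ν ⟨f y, v⟩ := by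
      rw [hrw']
      have := hνs (r : ℂ) ⟨f y, v⟩
      rw [Complex.norm_real, Real.norm_of_nonneg hr.le] at this
      exact this
    rw [e, Real.sqrt_mul (sq_nonneg r), Real.sqrt_sq hr.le, hrw', smul_smul, ← Complex.ofReal_mul,
      mul_inv, mul_comm r⁻¹, inv_mul_cancel_right₀ hr.ne']
  choose U hU s hs hso using ho
  have hmem := fun y => mem_of_mem_nhds (hU y)
  have hs0 : ∀ y y', y' ∈ U y → s y y' ≠ 0 := fun y y' hy' => (hso y y' hy').2.choose
  let n : ∀ y, T → ℂ := fun y y' => ((Real.sqrt (ν ⟨f y', s y y'⟩))⁻¹ : ℝ)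
  have hn0 : ∀ y y', y' ∈ U y → n y y' ≠ 0 := fun y y' hy' =>
    Complex.ofReal_ne_zero.2 (inv_ne_zero (Real.sqrt_pos.2 (hν0 _ (hs0 y y' hy'))).ne')
  have heq : ∀ y y', y' ∈ U y → n y' y' • s y' y' = n y y' • s y y' := fun y y' hy' => by
    obtain ⟨h1, h1'⟩ := (hso y y' hy').2
    obtain ⟨h2, h2'⟩ := (hso y' y' (hmem y')).2
    exact key h2 h1 (h2'.symm.trans h1')
  refine ⟨⟨fun y => n y y • s y y, fun y => smul_ne_zero (hn0 y y (hmem y)) (hs0 y y (hmem y)),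
    fun y => ?_, continuous_iff_continuousAt.2 fun y => ?_⟩⟩
  · have h1 : φ.tot ⟨f y, s y y⟩ = ⟨f y, s y y⟩ := (hso y y (hmem y)).1
    show φ.tot (scale (n y y) ⟨f y, s y y⟩) = scale (n y y) ⟨f y, s y y⟩
    rw [φ.tot_scale, h1]
    congr 1
    exact Complex.conj_ofReal _
  · have h1 : ContinuousOn (n y) (U y) := by
      refine Complex.continuous_ofReal.comp_continuousOn (ContinuousOn.inv₀
        (Real.continuous_sqrt.comp_continuousOn (hν.comp_continuousOn (hs y))) fun y' hy' =>
          (Real.sqrt_pos.2 (hν0 _ (hs0 y y' hy'))).ne')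
    refine ((continuous_scale h1 (hs y)).continuousAt (hU y)).congr ?_
    filter_upwards [hU y] with y' hy'
    exact congrArg (TotalSpace.mk (f y')) (heq y y' hy').symm

/-- The line bundle has a nowhere zero section over a curve. -/
theorem exists_isUnitSec {S : Type*} [TopologicalSpace S] [CompactSpace S] [T2Space S]
    [CompactSpace T] [T2Space T] {q : S → T} (hq : IsSpread ℝ q ∅) (φ : Conjugation σ L)
    (hf : Continuous f) (hσ : ∀ t, σ (f t) = f t) :
    ∃ b : T → TotalSpace ℂ L → ℂ, IsUnitSec f b := by
  -- The general position result needs a free involution. Doubling `T` and exchanging the copies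
  -- provides one, and restricting to one copy leaves a section subject to no reality condition.
  have hτ : Continuous fun t : T × Bool => (t.1, !t.2) := by fun_prop
  have hττ : Function.Involutive fun t : T × Bool => (t.1, !t.2) := fun t => by simp
  obtain ⟨r, hr, -, -, hr0⟩ := exists_avoiding (E := ℝ) (f := fun t : T × Bool => f t.1)
    (τ := fun t => (t.1, !t.2)) (A := ∅) (w := fun _ : Unit => (-1 : ℤ)) (Z := {0})
    (r := fun _ _ _ => 0) φ (by fun_prop) hτ hττ (fun t => (hσ t.1).symm) isClosed_empty
    (fun t ht => ht.elim)
    ⟨fun c _ v hv => by ext k; simp [show v = 0 from hv],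
      fun v hv => by ext k; simp [show v = 0 from hv]⟩
    isClosed_singleton avoidable_zero isSec_zero (fun t _ p _ _ k => by simp) (fun t ht => ht.elim)
    (exists_pieces (q := fun x : S × Bool => (q x.1, x.2))
      (by have := hq.continuous; fun_prop)
      (fun t => by
        obtain ⟨x, hx⟩ := hq.surjective t.1
        exact ⟨(x, t.2), by simp [hx]⟩) (by fun_prop) hτ isClosed_empty
      (fun t _ h => by
        have := congrArg Prod.snd h
        simp at this)
      fun x _ => by
        obtain ⟨K, hK, hKi, j, hj, hji⟩ := hq.exists_nhds x.1 (by simp)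
        refine ⟨K ×ˢ {x.2}, prod_mem_nhds hK (by simp), ?_, fun y => j y.1, ?_, ?_⟩
        · intro y hy z hz hyz
          simp only [Prod.mk.injEq] at hyz
          exact Prod.ext (hKi hy.1 hz.1 hyz.1) hyz.2
        · exact hj.comp continuousOn_fst fun y hy => hy.1
        · intro y hy z hz hyz
          exact Prod.ext (hji hy.1 hz.1 hyz)
            ((show y.2 = x.2 from hy.2).trans (show z.2 = x.2 from hz.2).symm))
  refine ⟨fun t p => r (t, false) p (), ?_, fun t p hp hp0 h0 => ?_⟩
  · exact hr.comp (s := fun t : T => (t, false)) (by fun_prop)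
  · exact hr0 (t, false) p hp hp0 (by ext; exact h0)

end DualSections

theorem rot_eq_map_blk (t : ℝ) : rot t = (blk 1 (Circle.exp t)).map Complex.ofReal := by
  have h1 : (Circle.exp t : ℂ).re = Real.cos t := by
    rw [Circle.coe_exp, Complex.exp_ofReal_mul_I_re]
  have h2 : (Circle.exp t : ℂ).im = Real.sin t := by
    rw [Circle.coe_exp, Complex.exp_ofReal_mul_I_im]
  unfold blk
  rw [h1, h2]
  ext i j
  fin_cases i <;> fin_cases j <;> simp [rot]

/-- The direction of a real nowhere zero function is a sign, so `β` can be the continuous function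
equal to `0` where it is positive and `π` where it is negative. -/
theorem null_blk_of_real {Z : Type*} [TopologicalSpace Z] {ζ : Z → ℂ} (hζ : Continuous ζ)
    (h0 : ∀ z, ζ z ≠ 0) (him : ∀ z, (ζ z).im = 0) :
    Null fun z => blk (Complex.normSq (ζ z))⁻¹ (starRingEnd ℂ (ζ z)) := by
  have hre : ∀ z, (((ζ z).re : ℝ) : ℂ) = ζ z := fun z => Complex.ext rfl (by simp [him])
  have hre0 : ∀ z, (ζ z).re ≠ 0 := fun z h => h0 z (by rw [← hre, h, Complex.ofReal_zero])
  refine null_blk (β := fun z => Real.pi * (1 - (ζ z).re / |(ζ z).re|) / 2)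
    ((Complex.continuous_normSq.comp hζ).inv₀ fun z => Complex.normSq_eq_zero.not.2 (h0 z)) ?_
    (Complex.continuous_conj.comp hζ) (fun z => inv_pos.2 (Complex.normSq_pos.2 (h0 z)))
    (fun z => (map_ne_zero _).2 (h0 z)) fun z => ?_
  · have h1 : Continuous fun z => (ζ z).re := by fun_prop
    have h2 : Continuous fun z => (ζ z).re / |(ζ z).re| := h1.div h1.abs fun z => abs_ne_zero.2 (hre0 z)
    fun_prop
  · rw [← hre z, Complex.conj_ofReal, Complex.norm_real, Complex.ofReal_re, Real.norm_eq_abs]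
    rcases lt_or_gt_of_ne (hre0 z) with h | h
    · rw [abs_of_neg h, div_neg, div_self h.ne]
      have : Real.pi * (1 - -1) / 2 = Real.pi := by ring
      rw [this, Complex.exp_pi_mul_I]
      push_cast
      ring
    · rw [abs_of_pos h, div_self h.ne']
      simp

/-- A real nowhere zero function on the line has constant sign. -/
theorem exists_const_phase {w : ℝ → ℂ} (hw : Continuous w) (h0 : ∀ θ, w θ ≠ 0)
    (him : ∀ θ, (w θ).im = 0) : ∃ ε : ℝ, ∀ θ, w θ = ‖w θ‖ * Complex.exp (ε * Complex.I) := by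
  have hre : ∀ z, (((w z).re : ℝ) : ℂ) = w z := fun z => Complex.ext rfl (by simp [him])
  have hre0 : ∀ z, (w z).re ≠ 0 := fun z h => h0 z (by rw [← hre, h, Complex.ofReal_zero])
  by_cases h : ∀ θ, 0 < (w θ).re
  · refine ⟨0, fun θ => ?_⟩
    rw [← hre θ, Complex.norm_real, Real.norm_of_nonneg (h θ).le]
    simp
  · have hneg : ∀ θ, (w θ).re < 0 := fun θ => by
      push Not at h
      obtain ⟨a, ha⟩ := h
      by_contra hθ
      obtain ⟨x, hx⟩ := mem_range_of_exists_le_of_exists_ge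
        (by fun_prop : Continuous fun θ => (w θ).re) ⟨a, ha⟩ ⟨θ, not_lt.1 hθ⟩
      exact hre0 x hx
    refine ⟨Real.pi, fun θ => ?_⟩
    rw [← hre θ, Complex.norm_real, Real.norm_of_nonpos (hneg θ).le, Complex.exp_pi_mul_I]
    push_cast
    ring

theorem exp_pi_mul_int (k : ℤ) : Complex.exp (Real.pi * k * Complex.I) = (-1) ^ k := by
  rw [← Complex.exp_pi_mul_I, ← Complex.exp_int_mul]
  congr 1
  ring

theorem neg_one_zpow_mul_self (k : ℤ) : ((-1 : ℂ) ^ k) * (-1) ^ k = 1 := by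
  rw [← mul_zpow]
  simp

/-! ### Real frames with prescribed coordinates -/

section Frames

variable {B : Type*} [TopologicalSpace B] {σ : B → B} {L : B → Type*} [∀ x, AddCommGroup (L x)]
  [∀ x, Module ℂ (L x)] [∀ x, TopologicalSpace (L x)] [TopologicalSpace (TotalSpace ℂ L)]
  {φ : Conjugation σ L} {T : Type*} [TopologicalSpace T] {f : T → B} {b : T → TotalSpace ℂ L → ℂ}

/-- The pullback of a frame. -/
def Conjugation.RealFrameAlong.comp (s : φ.RealFrameAlong f) {Z : Type*} [TopologicalSpace Z]
    {g : Z → T} (hg : Continuous g) : φ.RealFrameAlong fun z => f (g z) where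
  sec z := s.sec (g z)
  ne_zero z := s.ne_zero (g z)
  isReal z := s.isReal (g z)
  continuous_sec := s.continuous_sec.comp hg

theorem Conjugation.RealPartOrientableAlong.comp (h : φ.RealPartOrientableAlong f) {Z : Type*}
    [TopologicalSpace Z] {g : Z → T} (hg : Continuous g) :
    φ.RealPartOrientableAlong fun z => f (g z) := by
  obtain ⟨o, ho⟩ := h
  refine ⟨fun z => o (g z), fun z => ?_⟩
  obtain ⟨U, hU, s, hs, hso⟩ := ho (g z)
  exact ⟨g ⁻¹' U, hg.continuousAt.preimage_mem_nhds hU, fun z => s (g z),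
    hs.comp hg.continuousOn fun _ h => h, fun z hz => hso (g z) hz⟩

theorem Conjugation.RealFrameAlong.orientable (s : φ.RealFrameAlong f) :
    φ.RealPartOrientableAlong f :=
  ⟨fun t => rayOfNeZero ℝ (s.sec t) (s.ne_zero t), fun _ => ⟨Set.univ, Filter.univ_mem, s.sec,
    s.continuous_sec.continuousOn, fun t _ => ⟨s.isReal t, s.ne_zero t, rfl⟩⟩⟩

variable [FiberBundle ℂ L] [VectorBundle ℂ ℂ L]

theorem IsUnitSec.comp (h : IsUnitSec f b) {Z : Type*} [TopologicalSpace Z] {g : Z → T}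
    (hg : Continuous g) : IsUnitSec (fun z => f (g z)) fun z => b (g z) :=
  ⟨h.sec.comp hg, fun z => h.ne_zero (g z)⟩

theorem IsUnitSec.injective (h : IsUnitSec f b) {t : T} {p p' : TotalSpace ℂ L} (hp : p.1 = f t)
    (hp' : p'.1 = f t) (hp0 : p.2 ≠ 0) (hp0' : p'.2 ≠ 0) (hb : b t p = b t p') : p = p' := by
  obtain ⟨c, hc, rfl⟩ := exists_scale_eq (hp.trans hp'.symm) hp0 hp0'
  rw [h.scale t hp hp0 hc] at hb
  have h1 : c⁻¹ = 1 := mul_right_cancel₀ (h.ne_zero t p hp hp0) (hb.symm.trans (one_mul _).symm)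
  rw [inv_eq_one.1 h1, scale_one]

/-- The real frame on which the section takes given values. -/
theorem IsUnitSec.exists_frame (h : IsUnitSec f b) (hf : Continuous f) (hσ : ∀ t, σ (f t) = f t)
    {u : T → Circle} (hu : ∀ t p, p.1 = f t → p.2 ≠ 0 → b t p = u t * conjUnitSec φ b t p)
    {g : T → ℂ} (hg : Continuous g) (hg0 : ∀ t, g t ≠ 0)
    (hgu : ∀ t, g t = u t * starRingEnd ℂ (g t)) :
    ∃ s : φ.RealFrameAlong f, ∀ t, b t ⟨f t, s.sec t⟩ = g t := by
  -- The frame is the section divided by `g`. It is real because `g` and the section have the same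
  -- ratio `u` to their conjugates.
  let v : ∀ t, L (f t) := fun t =>
    (b t ⟨f t, baseVec L (f t)⟩ * (g t)⁻¹) • baseVec L (f t)
  have hb : ∀ t, (⟨f t, baseVec L (f t)⟩ : TotalSpace ℂ L).2 ≠ 0 := fun t => baseVec_ne_zero _
  have hc : ∀ t, b t ⟨f t, baseVec L (f t)⟩ * (g t)⁻¹ ≠ 0 := fun t =>
    mul_ne_zero (h.ne_zero t _ rfl (hb t)) (inv_ne_zero (hg0 t))
  have hv0 : ∀ t, v t ≠ 0 := fun t => smul_ne_zero (hc t) (hb t)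
  have hbv : ∀ t, b t ⟨f t, v t⟩ = g t := fun t => by
    refine (h.scale t rfl (hb t) (hc t)).trans ?_
    have h1 := h.ne_zero t _ rfl (hb t)
    have h2 := hg0 t
    field_simp
  refine ⟨⟨v, hv0, fun t => ?_, continuous_iff_continuousAt.2 fun t => ?_⟩, hbv⟩
  · have h1 := hu t ⟨f t, v t⟩ rfl (hv0 t)
    rw [hbv] at h1
    have h2 : conjUnitSec φ b t ⟨f t, v t⟩ = starRingEnd ℂ (g t) :=
      mul_left_cancel₀ (Circle.coe_ne_zero (u t)) (h1.symm.trans (hgu t))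
    refine h.injective (t := t) (hσ t) rfl (φ.tot_snd_ne_zero (p := ⟨f t, v t⟩) (hv0 t)) (hv0 t) ?_
    rw [hbv]
    have h3 := congrArg (starRingEnd ℂ) h2
    rw [conjUnitSec, Complex.conj_conj, Complex.conj_conj] at h3
    exact h3
  · have ha : f t ∈ (trivializationAt ℂ L (f t)).baseSet :=
      FiberBundle.mem_baseSet_trivializationAt' _
    have hopen := (trivializationAt ℂ L (f t)).open_baseSet.preimage hf
    have h1 : ContinuousOn (fun t' => RealPairs.scale (b t' (locSec L (f t) (f t')) * (g t')⁻¹)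
        (locSec L (f t) (f t'))) (f ⁻¹' (trivializationAt ℂ L (f t)).baseSet) :=
      continuous_scale ((h.continuousOn_locSec (f t)).mul (hg.inv₀ hg0).continuousOn)
        ((RealPairs.continuousOn_locSec (f t)).comp hf.continuousOn fun _ h => h)
    refine (h1.continuousAt (hopen.mem_nhds ha)).congr ?_
    filter_upwards [hopen.mem_nhds ha] with t' ht'
    have hl := locSec_snd_ne_zero (L := L) ht'
    have hl' := h.ne_zero t' _ rfl hl
    have hcl := mul_ne_zero hl' (inv_ne_zero (hg0 t'))
    refine h.injective (t := t') rfl rfl (scale_snd_ne_zero hcl hl) (hv0 t') ?_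
    rw [h.scale t' rfl hl hcl, hbv]
    have h2 := hg0 t'
    field_simp

end Frames

/-! ### Half-turns along loops in the fixed locus -/

section Loops

variable {B : Type*} [TopologicalSpace B] {σ : B → B} {L : B → Type*} [∀ x, AddCommGroup (L x)]
  [∀ x, Module ℂ (L x)] [∀ x, TopologicalSpace (L x)] [TopologicalSpace (TotalSpace ℂ L)]
  [FiberBundle ℂ L] [VectorBundle ℂ ℂ L] {φ : Conjugation σ L}
  {b : Function.fixedPoints σ → TotalSpace ℂ L → ℂ} {u : C(Function.fixedPoints σ, Circle)}
  {c : C(Circle, Function.fixedPoints σ)} {k : ℤ} {β : C(Circle, ℝ)}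

theorem circle_exp_add_one (θ : ℝ) :
    Circle.exp (2 * Real.pi * (θ + 1)) = Circle.exp (2 * Real.pi * θ) := by
  simpa using circle_exp_add_int θ 1

theorem loopParam_add_one (c : C(Circle, Function.fixedPoints σ)) (θ : ℝ) :
    loopParam c (θ + 1) = loopParam c θ := by
  simp only [loopParam, circle_exp_add_one]

theorem continuous_loopParam (c : C(Circle, Function.fixedPoints σ)) : Continuous (loopParam c) := by
  unfold loopParam
  fun_prop

/-- Half of the argument of the phase along a loop. -/
noncomputable def halfArg (k : ℤ) (β : C(Circle, ℝ)) (θ : ℝ) : ℝ :=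
  Real.pi * k * θ + β (Circle.exp (2 * Real.pi * θ)) / 2

theorem halfArg_add_one (θ : ℝ) : halfArg k β (θ + 1) = halfArg k β θ + Real.pi * k := by
  simp only [halfArg, circle_exp_add_one]
  ring

theorem exp_halfArg_add_one (θ : ℝ) : Complex.exp (halfArg k β (θ + 1) * Complex.I) =
    (-1) ^ k * Complex.exp (halfArg k β θ * Complex.I) := by
  rw [halfArg_add_one, ← exp_pi_mul_int, ← Complex.exp_add]
  congr 1
  push_cast
  ring

theorem continuous_halfArg : Continuous (halfArg k β) := by
  unfold halfArg
  fun_prop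

theorem exp_halfArg_sq (hk : ∀ z, u (c z) = z ^ k * Circle.exp (β z)) (θ : ℝ) :
    Complex.exp (halfArg k β θ * Complex.I) * Complex.exp (halfArg k β θ * Complex.I) =
      u (c (Circle.exp (2 * Real.pi * θ))) := by
  rw [hk, ← Circle.exp_zsmul, ← Circle.exp_add, Circle.coe_exp, ← Complex.exp_add]
  congr 1
  simp only [halfArg, zsmul_eq_mul]
  push_cast
  ring

theorem conj_exp_mul_I (x : ℝ) :
    starRingEnd ℂ (Complex.exp (x * Complex.I)) = (Complex.exp (x * Complex.I))⁻¹ := by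
  rw [← Complex.exp_conj, ← Complex.exp_neg]
  simp

/-- The argument of the section on a real frame along a loop. -/
theorem exists_arg_along (hb : IsUnitSec (Subtype.val : Function.fixedPoints σ → B) b)
    (hu : ∀ t p, p.1 = t.1 → p.2 ≠ 0 → b t p = u t * conjUnitSec φ b t p)
    (hk : ∀ z, u (c z) = z ^ k * Circle.exp (β z)) (s : φ.RealFrameAlong (loopParam c)) :
    ∃ ε : ℝ, ∀ θ, b (c (Circle.exp (2 * Real.pi * θ))) ⟨loopParam c θ, s.sec θ⟩ =
      ‖b (c (Circle.exp (2 * Real.pi * θ))) ⟨loopParam c θ, s.sec θ⟩‖ *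
        Complex.exp ((halfArg k β θ + ε : ℝ) * Complex.I) := by
  let z : ℝ → ℂ := fun θ => b (c (Circle.exp (2 * Real.pi * θ))) ⟨loopParam c θ, s.sec θ⟩
  have hz : Continuous z := hb.continuous_comp (s := fun θ => c (Circle.exp (2 * Real.pi * θ)))
    (by fun_prop) s.continuous_sec (fun _ => rfl) s.ne_zero
  have hz0 : ∀ θ, z θ ≠ 0 := fun θ => hb.ne_zero _ _ rfl (s.ne_zero θ)
  have hzu : ∀ θ, z θ = u (c (Circle.exp (2 * Real.pi * θ))) * starRingEnd ℂ (z θ) := fun θ => by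
    have h1 := hu (c (Circle.exp (2 * Real.pi * θ))) ⟨loopParam c θ, s.sec θ⟩ rfl (s.ne_zero θ)
    have hr : φ.tot ⟨loopParam c θ, s.sec θ⟩ = ⟨loopParam c θ, s.sec θ⟩ := s.isReal θ
    rw [conjUnitSec_of_real hr] at h1
    exact h1
  -- The square of the exponential is the phase `u`, as is the ratio of `z` to its conjugate. So `w`
  -- is real and its sign is constant on the line.
  let w : ℝ → ℂ := fun θ => z θ * (Complex.exp (halfArg k β θ * Complex.I))⁻¹
  have he : Continuous fun θ => Complex.exp (halfArg k β θ * Complex.I) := by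
    have := continuous_halfArg (k := k) (β := β)
    fun_prop
  have hw : Continuous w := hz.mul (he.inv₀ fun _ => Complex.exp_ne_zero _)
  have hw0 : ∀ θ, w θ ≠ 0 := fun θ => mul_ne_zero (hz0 θ) (inv_ne_zero (Complex.exp_ne_zero _))
  have hwn : ∀ θ, ‖w θ‖ = ‖z θ‖ := fun θ => by
    simp only [w]
    rw [norm_mul, norm_inv, Complex.norm_exp_ofReal_mul_I, inv_one, mul_one]
  obtain ⟨ε, hε⟩ := exists_const_phase hw hw0 fun θ => by
    refine Complex.conj_eq_iff_im.1 ?_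
    simp only [w]
    conv_rhs => rw [hzu θ, ← exp_halfArg_sq hk]
    rw [map_mul, map_inv₀, conj_exp_mul_I, inv_inv]
    have := Complex.exp_ne_zero (halfArg k β θ * Complex.I)
    field_simp
  refine ⟨ε, fun θ => ?_⟩
  have h1 := hε θ
  rw [hwn] at h1
  show z θ = ‖z θ‖ * _
  have h2 : z θ = w θ * Complex.exp (halfArg k β θ * Complex.I) := by
    simp only [w]
    rw [inv_mul_cancel_right₀ (Complex.exp_ne_zero _)]
  conv_lhs => rw [h2, h1]
  rw [mul_assoc, ← Complex.exp_add]
  congr 2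
  push_cast
  ring

theorem section_add_one (hb : IsUnitSec (Subtype.val : Function.fixedPoints σ → B) b) {m : ℤ}
    {s : φ.RealFrameAlong (loopParam c)}
    (hs : ∀ θ, (⟨loopParam c (θ + 1), s.sec (θ + 1)⟩ : TotalSpace ℂ L) =
      ⟨loopParam c θ, ((-1 : ℂ) ^ m) • s.sec θ⟩) (θ : ℝ) :
    b (c (Circle.exp (2 * Real.pi * (θ + 1)))) ⟨loopParam c (θ + 1), s.sec (θ + 1)⟩ =
      (-1) ^ m * b (c (Circle.exp (2 * Real.pi * θ))) ⟨loopParam c θ, s.sec θ⟩ := by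
  have h1 : ((-1 : ℂ) ^ m) ≠ 0 := zpow_ne_zero _ (by norm_num)
  rw [hs, circle_exp_add_one]
  refine (hb.scale (c (Circle.exp (2 * Real.pi * θ))) (p := ⟨loopParam c θ, s.sec θ⟩) rfl
    (s.ne_zero θ) h1).trans ?_
  rw [inv_eq_of_mul_eq_one_left (neg_one_zpow_mul_self m)]

/-- The twisting of a frame along a loop is the parity of the degree of the phase. -/
theorem neg_one_zpow_eq (hb : IsUnitSec (Subtype.val : Function.fixedPoints σ → B) b)
    (hu : ∀ t p, p.1 = t.1 → p.2 ≠ 0 → b t p = u t * conjUnitSec φ b t p)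
    (hk : ∀ z, u (c z) = z ^ k * Circle.exp (β z)) {m : ℤ} {s : φ.RealFrameAlong (loopParam c)}
    (hs : ∀ θ, (⟨loopParam c (θ + 1), s.sec (θ + 1)⟩ : TotalSpace ℂ L) =
      ⟨loopParam c θ, ((-1 : ℂ) ^ m) • s.sec θ⟩) : (-1 : ℂ) ^ m = (-1) ^ k := by
  obtain ⟨ε, hε⟩ := exists_arg_along hb hu hk s
  let z : ℝ → ℂ := fun θ => b (c (Circle.exp (2 * Real.pi * θ))) ⟨loopParam c θ, s.sec θ⟩
  have hz0 : z 0 ≠ 0 := hb.ne_zero _ _ rfl (s.ne_zero 0)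
  have h1 : z (0 + 1) = (-1) ^ m * z 0 := section_add_one hb hs 0
  have hn : ‖z (0 + 1)‖ = ‖z 0‖ := by
    rw [h1, norm_mul, norm_zpow, norm_neg, norm_one, one_zpow, one_mul]
  have h2 : z (0 + 1) = (-1) ^ k * z 0 := by
    have e1 : z (0 + 1) = ‖z (0 + 1)‖ * _ := hε (0 + 1)
    have e0 : z 0 = ‖z 0‖ * _ := hε 0
    rw [hn] at e1
    rw [e1]
    conv_rhs => rw [e0]
    have : ∀ x : ℝ, Complex.exp ((x + ε : ℝ) * Complex.I) =
        Complex.exp (x * Complex.I) * Complex.exp (ε * Complex.I) := fun x => by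
      rw [← Complex.exp_add]
      congr 1
      push_cast
      ring
    rw [this, this, exp_halfArg_add_one]
    ring
  exact mul_right_cancel₀ hz0 (h1.symm.trans h2)

/-- The rotating frame along a loop differs from the frame given by the section by a null matrix
function. -/
theorem exists_null_along (hb : IsUnitSec (Subtype.val : Function.fixedPoints σ → B) b)
    (hu : ∀ t p, p.1 = t.1 → p.2 ≠ 0 → b t p = u t * conjUnitSec φ b t p)
    (hk : ∀ z, u (c z) = z ^ k * Circle.exp (β z)) {s : φ.RealFrameAlong (loopParam c)}
    (hs : ∀ θ, (⟨loopParam c (θ + 1), s.sec (θ + 1)⟩ : TotalSpace ℂ L) =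
      ⟨loopParam c θ, ((-1 : ℂ) ^ k) • s.sec θ⟩) :
    ∃ ν : Circle → Matrix (Fin 3) (Fin 3) ℝ, Null ν ∧ ∀ θ,
      coframeMat (b (c (Circle.exp (2 * Real.pi * θ))) ⟨loopParam c θ, s.sec θ⟩)
        (conjUnitSec φ b (c (Circle.exp (2 * Real.pi * θ))) ⟨loopParam c θ, s.sec θ⟩) *
        rot (k * Real.pi * θ) = (ν (Circle.exp (2 * Real.pi * θ))).map Complex.ofReal := by
  obtain ⟨ε, hε⟩ := exists_arg_along hb hu hk s
  let z : ℝ → ℂ := fun θ => b (c (Circle.exp (2 * Real.pi * θ))) ⟨loopParam c θ, s.sec θ⟩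
  have hz : Continuous z := hb.continuous_comp (s := fun θ => c (Circle.exp (2 * Real.pi * θ)))
    (by fun_prop) s.continuous_sec (fun _ => rfl) s.ne_zero
  have hz0 : ∀ θ, z θ ≠ 0 := fun θ => hb.ne_zero _ _ rfl (s.ne_zero θ)
  have hz1 : ∀ θ, z (θ + 1) = (-1) ^ k * z θ := section_add_one hb hs
  have hr1 : ∀ θ : ℝ, Complex.exp ((k * Real.pi * (θ + 1) : ℝ) * Complex.I) =
      (-1) ^ k * Complex.exp ((k * Real.pi * θ : ℝ) * Complex.I) := fun θ => by
    rw [← exp_pi_mul_int, ← Complex.exp_add]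
    congr 1
    push_cast
    ring
  -- Both factors change by `(-1) ^ k` over a period, so the product is periodic. The linear parts
  -- of the two arguments cancel, leaving the single-valued angle `-β / 2 - ε`.
  obtain ⟨ζ, hζ⟩ := exists_circle_descent'
    (F := fun θ => starRingEnd ℂ (z θ) * Complex.exp ((k * Real.pi * θ : ℝ) * Complex.I))
    (by fun_prop) fun θ => by
      simp only [hz1, hr1, map_mul, map_zpow₀, map_neg, map_one]
      rw [mul_mul_mul_comm, neg_one_zpow_mul_self, one_mul]
  have hζn : ∀ θ, ‖ζ (Circle.exp (2 * Real.pi * θ))‖ = ‖z θ‖ := fun θ => by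
    rw [hζ, norm_mul, RCLike.norm_conj, Complex.norm_exp_ofReal_mul_I, mul_one]
  have hsurj := isOpenQuotientMap_circleParam.surjective
  have hζ0 : ∀ x, ζ x ≠ 0 := fun x => by
    obtain ⟨θ, rfl⟩ := hsurj x
    rw [← norm_ne_zero_iff]
    exact (hζn θ).trans_ne (norm_ne_zero_iff.2 (hz0 θ))
  refine ⟨fun x => blk (Complex.normSq (ζ x))⁻¹ (ζ x),
    null_blk (β := fun x => -(β x / 2) - ε) ((Complex.continuous_normSq.comp ζ.continuous).inv₀
      fun x => Complex.normSq_eq_zero.not.2 (hζ0 x)) (by fun_prop) ζ.continuous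
      (fun x => inv_pos.2 (Complex.normSq_pos.2 (hζ0 x))) hζ0 fun x => ?_, fun θ => ?_⟩
  · obtain ⟨θ, rfl⟩ := hsurj x
    simp only [hζn]
    simp only [hζ]
    have e : z θ = ‖z θ‖ * _ := hε θ
    conv_lhs => rw [e]
    rw [map_mul, Complex.conj_ofReal, conj_exp_mul_I, mul_assoc, ← Complex.exp_neg,
      ← Complex.exp_add]
    congr 2
    simp only [halfArg]
    push_cast
    ring
  · have e1 : conjUnitSec φ b (c (Circle.exp (2 * Real.pi * θ))) ⟨loopParam c θ, s.sec θ⟩ =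
        starRingEnd ℂ (z θ) := conjUnitSec_of_real (s.isReal θ)
    rw [e1]
    show coframeMat (z θ) _ * _ = (blk (Complex.normSq (ζ (Circle.exp (2 * Real.pi * θ))))⁻¹
      (ζ (Circle.exp (2 * Real.pi * θ)))).map _
    rw [coframeMat_self_conj, rot_eq_map_blk, ← map_ofReal_mul, blk_mul, mul_one, Circle.coe_exp,
      ← hζ θ, Complex.normSq_eq_norm_sq, Complex.normSq_eq_norm_sq, hζn]

/-- The real frame along a loop whose twisting is the degree of the phase. -/
theorem exists_twisted_frame
    (hb : IsUnitSec (Subtype.val : Function.fixedPoints σ → B) b)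
    (hu : ∀ t p, p.1 = t.1 → p.2 ≠ 0 → b t p = u t * conjUnitSec φ b t p)
    (hk : ∀ z, u (c z) = z ^ k * Circle.exp (β z)) :
    ∃ s : φ.RealFrameAlong (loopParam c),
      ∀ θ, (⟨loopParam c (θ + 1), s.sec (θ + 1)⟩ : TotalSpace ℂ L) =
        ⟨loopParam c θ, ((-1 : ℂ) ^ k) • s.sec θ⟩ := by
  have hc : Continuous fun θ : ℝ => c (Circle.exp (2 * Real.pi * θ)) := by fun_prop
  obtain ⟨s, hs⟩ := (hb.comp hc).exists_frame (φ := φ)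
    (g := fun θ => Complex.exp (halfArg k β θ * Complex.I))
    (u := fun θ => u (c (Circle.exp (2 * Real.pi * θ)))) (continuous_loopParam c)
    (fun θ => (c (Circle.exp (2 * Real.pi * θ))).2) (fun θ p hp hp0 => hu _ p hp hp0)
    (by
      have := continuous_halfArg (k := k) (β := β)
      fun_prop) (fun θ => Complex.exp_ne_zero _) fun θ => by
      rw [← exp_halfArg_sq hk, conj_exp_mul_I, mul_inv_cancel_right₀ (Complex.exp_ne_zero _)]
  refine ⟨s, fun θ => ?_⟩
  have h1 : ((-1 : ℂ) ^ k) ≠ 0 := zpow_ne_zero _ (by norm_num)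
  refine hb.injective (t := c (Circle.exp (2 * Real.pi * θ))) (loopParam_add_one c θ) rfl
    (s.ne_zero _) (smul_ne_zero h1 (s.ne_zero θ)) ?_
  refine Eq.trans ?_ (hb.scale (c (Circle.exp (2 * Real.pi * θ))) (p := ⟨loopParam c θ, s.sec θ⟩)
    rfl (s.ne_zero θ) h1).symm
  have h2 := hs (θ + 1)
  have h3 : b (c (Circle.exp (2 * Real.pi * θ))) ⟨loopParam c (θ + 1), s.sec (θ + 1)⟩ =
      Complex.exp (halfArg k β (θ + 1) * Complex.I) :=
    (congrArg (fun z => b (c z) ⟨loopParam c (θ + 1), s.sec (θ + 1)⟩)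
      (circle_exp_add_one θ).symm).trans h2
  have h4 : b (c (Circle.exp (2 * Real.pi * θ))) ⟨loopParam c θ, s.sec θ⟩ =
      Complex.exp (halfArg k β θ * Complex.I) := hs θ
  rw [h3, h4, exp_halfArg_add_one, inv_eq_of_mul_eq_one_left (neg_one_zpow_mul_self k)]

/-- A real frame along the parametrization comes back multiplied by `(-1) ^ k` after one period, so
a closed frame exists exactly for even `k`. -/
theorem orientableOver_iff_even [CompactSpace B] [T2Space B]
    (hb : IsUnitSec (Subtype.val : Function.fixedPoints σ → B) b)
    (hu : ∀ t p, p.1 = t.1 → p.2 ≠ 0 → b t p = u t * conjUnitSec φ b t p)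
    (hk : ContinuousMap.Homotopic (circlePow k) (u.comp c)) : φ.OrientableOver c ↔ Even k := by
  obtain ⟨β, hβ⟩ := exists_log_of_homotopic hk
  have hk' : ∀ z, u (c z) = z ^ k * Circle.exp (β z) := hβ
  constructor
  · intro h
    obtain ⟨s⟩ := h.exists_frame
    have hc : Continuous fun θ : ℝ => Circle.exp (2 * Real.pi * θ) := by fun_prop
    let s' : φ.RealFrameAlong (loopParam c) := s.comp hc
    have h1 := neg_one_zpow_eq (s := s') (m := 0) hb hu hk' fun θ => by
      have : (⟨loopParam c (θ + 1), s'.sec (θ + 1)⟩ : TotalSpace ℂ L) =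
          ⟨loopParam c θ, s'.sec θ⟩ :=
        congrArg (fun z : Circle => (⟨(c z).1, s.sec z⟩ : TotalSpace ℂ L)) (circle_exp_add_one θ)
      rw [this, zpow_zero, one_smul]
    rw [zpow_zero] at h1
    by_contra hodd
    rw [Int.not_even_iff_odd] at hodd
    rw [hodd.neg_one_zpow] at h1
    norm_num at h1
  · intro h
    obtain ⟨s, hs⟩ := exists_twisted_frame hb hu hk'
    obtain ⟨P, hP⟩ := exists_circle_descent'
      (F := fun θ => (⟨loopParam c θ, s.sec θ⟩ : TotalSpace ℂ L)) s.continuous_sec fun θ => by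
        rw [hs, h.neg_one_zpow, one_smul]
    have hsurj := isOpenQuotientMap_circleParam.surjective
    have hP1 : ∀ z, (P z).1 = (c z).1 := fun z => by
      obtain ⟨θ, rfl⟩ := hsurj z
      rw [hP]
      rfl
    have key : ∀ z, ∃ v : L (c z).1, (⟨(c z).1, v⟩ : TotalSpace ℂ L) = P z := fun z => by
      rw [← hP1 z]
      exact ⟨(P z).2, rfl⟩
    choose v hv using key
    have hne : ∀ z, v z ≠ 0 ∧ φ.IsReal (c z).1 (v z) := fun z => by
      obtain ⟨θ, rfl⟩ := hsurj z
      have h1 := hv (Circle.exp (2 * Real.pi * θ))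
      rw [hP] at h1
      have h2 : v (Circle.exp (2 * Real.pi * θ)) = s.sec θ := TotalSpace.mk_injective _ h1
      rw [h2]
      exact ⟨s.ne_zero θ, s.isReal θ⟩
    exact Conjugation.RealFrameAlong.orientable ⟨v, fun z => (hne z).1, fun z => (hne z).2,
      P.continuous.congr fun z => (hv z).symm⟩

variable {γ : Function.fixedPoints σ → Matrix (Fin 3) (Fin 3) ℝ} {Ψ : RealIso φ}

/-- When the degree of the phase is the prescribed number of half-turns, the rotating frame and the
coframe of the section differ by a null factor. What remains of the condition on `Ψ` is a condition
on its quotient `γ`. -/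
theorem isStandardAlong_iff
    (hb : IsUnitSec (Subtype.val : Function.fixedPoints σ → B) b)
    (hu : ∀ t p, p.1 = t.1 → p.2 ≠ 0 → b t p = u t * conjUnitSec φ b t p)
    (hk : ContinuousMap.Homotopic (circlePow k) (u.comp c)) (hγ : Continuous γ)
    (hγ0 : ∀ y, (γ y).det ≠ 0)
    (hγΨ : ∀ y : Function.fixedPoints σ, ∀ p : TotalSpace ℂ L, p.1 = y → p.2 ≠ 0 →
      (γ y).map Complex.ofReal * coframeMat (b y p) (conjUnitSec φ b y p) = Ψ.mat p) :
    Ψ.IsStandardAlong c k ↔ Null fun z => γ (c z) := by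
  have hmat : ∀ (c' : C(Circle, Function.fixedPoints σ)) (s : φ.RealFrameAlong (loopParam c'))
      (ν : Circle → Matrix (Fin 3) (Fin 3) ℝ), (∀ θ,
      coframeMat (b (c' (Circle.exp (2 * Real.pi * θ))) ⟨loopParam c' θ, s.sec θ⟩)
        (conjUnitSec φ b (c' (Circle.exp (2 * Real.pi * θ))) ⟨loopParam c' θ, s.sec θ⟩) *
        rot (k * Real.pi * θ) = (ν (Circle.exp (2 * Real.pi * θ))).map Complex.ofReal) →
      ∀ θ, Ψ.matrix (s.sec θ) * rot (k * Real.pi * θ) =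
        (γ (c' (Circle.exp (2 * Real.pi * θ))) * ν (Circle.exp (2 * Real.pi * θ))).map
          Complex.ofReal := by
    intro c' s ν hν θ
    have h1 := hγΨ (c' (Circle.exp (2 * Real.pi * θ))) ⟨loopParam c' θ, s.sec θ⟩ rfl (s.ne_zero θ)
    have h2 : Ψ.matrix (s.sec θ) = Ψ.mat ⟨loopParam c' θ, s.sec θ⟩ := rfl
    rw [h2, ← h1, Matrix.mul_assoc, hν, ← map_ofReal_mul]
  have hsurj := isOpenQuotientMap_circleParam.surjective
  constructor
  · rintro ⟨c', hc', s, hs, H, hH0, hHp, hH1, hHΨ⟩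
    -- The degree of the phase is the same along the homotopic loop `c'`, so the comparison can be
    -- made there and nullity carried back to `c`.
    obtain ⟨F⟩ := hc'.symm
    have hkc : ContinuousMap.Homotopic (circlePow k) (u.comp c') :=
      hk.trans ⟨{ toFun := fun p => u (F p)
                  continuous_toFun := by fun_prop
                  map_zero_left := fun z => by simp
                  map_one_left := fun z => by simp }⟩
    obtain ⟨β, hβ⟩ := exists_log_of_homotopic hkc
    obtain ⟨ν, hν, hνs⟩ := exists_null_along hb hu hβ hs
    obtain ⟨G, hG⟩ := exists_circle_descent H.continuous hHp
    have h1 : Null fun z => γ (c' z) * ν z := by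
      refine ⟨G, fun p => ?_, fun z => ?_, fun z => ?_⟩
      · obtain ⟨t, z⟩ := p
        obtain ⟨θ, rfl⟩ := hsurj z
        rw [hG]
        exact hH0 _
      · obtain ⟨θ, rfl⟩ := hsurj z
        rw [hG]
        exact hH1 θ
      · obtain ⟨θ, rfl⟩ := hsurj z
        rw [hG]
        exact map_ofReal_injective ((hHΨ θ).trans (hmat c' s ν hνs θ))
    have h2 : Null fun z => γ (c' z) := by
      refine (congrArg Null (funext fun z => ?_)).mp (h1.mul hν.inv)
      exact Matrix.mul_nonsing_inv_cancel_right _ _ (hν.det_ne_zero z).isUnit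
    exact Null.of_homotopic hc' hγ hγ0 h2
  · intro h
    obtain ⟨β, hβ⟩ := exists_log_of_homotopic hk
    obtain ⟨s, hs⟩ := exists_twisted_frame hb hu hβ
    obtain ⟨ν, hν, hνs⟩ := exists_null_along hb hu hβ hs
    obtain ⟨H, hH0, hH1, hHγ⟩ := h.mul hν
    refine ⟨c, ContinuousMap.Homotopic.refl c, s, hs,
      ⟨fun p => H (p.1, Circle.exp (2 * Real.pi * p.2)), by fun_prop⟩, fun p => hH0 _,
      fun t θ => ?_, fun θ => hH1 _, fun θ => ?_⟩
    · show H (t, Circle.exp (2 * Real.pi * (θ + 1))) = H (t, Circle.exp (2 * Real.pi * θ))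
      rw [circle_exp_add_one]
    · exact (congrArg (fun P => P.map Complex.ofReal) (hHγ (Circle.exp (2 * Real.pi * θ)))).trans
        (hmat c s ν hνs θ).symm

end Loops

theorem homotopic_mul {W : Type*} [TopologicalSpace W] {f f' g g' : C(W, Circle)}
    (hf : f.Homotopic f') (hg : g.Homotopic g') : (f * g).Homotopic (f' * g') := by
  obtain ⟨F⟩ := hf
  obtain ⟨G⟩ := hg
  exact ⟨{ toFun := fun p => F p * G p
           continuous_toFun := by fun_prop
           map_zero_left := fun w => by simp
           map_one_left := fun w => by simp }⟩

/-! ### The homotopy classes -/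

section Classes

variable {B : Type*} [TopologicalSpace B] {σ : B → B} {L : B → Type*} [∀ x, AddCommGroup (L x)]
  [∀ x, Module ℂ (L x)] [∀ x, TopologicalSpace (L x)] [TopologicalSpace (TotalSpace ℂ L)]
  [FiberBundle ℂ L] [VectorBundle ℂ ℂ L] {φ : Conjugation σ L}
  {b : Function.fixedPoints σ → TotalSpace ℂ L → ℂ}
  {γ : Function.fixedPoints σ → Matrix (Fin 3) (Fin 3) ℝ} {Ψ : RealIso φ}

theorem IsUnitSec.det_coframeMat_conj
    (hb : IsUnitSec (Subtype.val : Function.fixedPoints σ → B) b) (φ : Conjugation σ L)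
    (y : Function.fixedPoints σ) (p : TotalSpace ℂ L) (hp : p.1 = y) (hp0 : p.2 ≠ 0) :
    (coframeMat (b y p) (conjUnitSec φ b y p)).det = 1 :=
  det_coframeMat (hb.ne_zero y p hp hp0)
    ((hb.conj φ continuous_subtype_val fun t => t.2).ne_zero y p hp hp0)

/-- On the fixed locus, an isomorphism differs from the coframe of a section by a real matrix
function. -/
theorem RealIso.exists_coframe_quotient (Ψ : RealIso φ)
    (hb : IsUnitSec (Subtype.val : Function.fixedPoints σ → B) b) :
    ∃ γ : C(Function.fixedPoints σ, Matrix (Fin 3) (Fin 3) ℝ), (∀ y, (γ y).det ≠ 0) ∧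
      ∀ (y : Function.fixedPoints σ) (p : TotalSpace ℂ L), p.1 = y → p.2 ≠ 0 →
        (γ y).map Complex.ofReal * coframeMat (b y p) (conjUnitSec φ b y p) = Ψ.mat p :=
  (Ψ.isFrameFamily.comp (s := (Subtype.val : Function.fixedPoints σ → B)) (τ' := id)
    continuous_subtype_val fun t => t.2.symm).exists_real_quotient
    (hb.isFrameFamily φ continuous_subtype_val fun t => t.2) continuous_subtype_val fun t => t.2

/-- Over a fixed point the homotopy of determinants is a path of nonzero reals starting at `1`. The
coframe has determinant `1`, so the end of the path is `det γ`. -/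
theorem RealIso.HasCanonicalDet.det_pos (h : Ψ.HasCanonicalDet)
    (hb : IsUnitSec (Subtype.val : Function.fixedPoints σ → B) b)
    (hγΨ : ∀ (y : Function.fixedPoints σ) (p : TotalSpace ℂ L), p.1 = y → p.2 ≠ 0 →
      (γ y).map Complex.ofReal * coframeMat (b y p) (conjUnitSec φ b y p) = Ψ.mat p)
    (y : Function.fixedPoints σ) : 0 < (γ y).det := by
  obtain ⟨h, h0, hσ, h1, hd⟩ := h
  have hreal : ∀ t, ((h (t, y.1)).re : ℂ) = h (t, y.1) := fun t => by
    have h2 := hσ t y.1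
    have hy : σ y.1 = y.1 := y.2
    rw [hy] at h2
    exact Complex.conj_eq_iff_re.1 h2.symm
  have hne : ∀ t, (h (t, y.1)).re ≠ 0 := fun t h2 =>
    h0 (t, y.1) (by rw [← hreal t, h2, Complex.ofReal_zero])
  have hdet : (h (1, y.1)).re = (γ y).det := by
    have h2 := hγΨ y ⟨y.1, baseVec L y.1⟩ rfl (baseVec_ne_zero _)
    have h3 : h (1, y.1) = (Ψ.mat ⟨y.1, baseVec L y.1⟩).det := hd y.1 _ (baseVec_ne_zero _)
    rw [h3, ← h2, Matrix.det_mul, hb.det_coframeMat_conj φ y _ rfl (baseVec_ne_zero _), mul_one,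
      det_map_ofReal, Complex.ofReal_re]
  rw [← hdet]
  by_contra hneg
  obtain ⟨t, ht⟩ := mem_range_of_exists_le_of_exists_ge (f := fun t => (h (t, y.1)).re) (c := 0)
    (by fun_prop) ⟨1, not_lt.1 hneg⟩ ⟨0, by simp [h1]⟩
  exact hne t ht

/-- `Ψ₀` extends the coframe of the section. Quotients by `Ψ₀` and by the coframe differ by a null
factor, so the classification by real parts applies. -/
theorem exists_homotopy_class [CompactSpace B] [T2Space B] {S : Type*} [TopologicalSpace S]
    [CompactSpace S] [T2Space S] {q : S → B} (hσ : Continuous σ) (hσσ : Function.Involutive σ)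
    (hq : IsSpread (EuclideanSpace ℝ (Fin 2)) q (Function.fixedPoints σ))
    (hb : IsUnitSec (Subtype.val : Function.fixedPoints σ → B) b) :
    ∃ Ψ₀ : RealIso φ, ∀ (Ψ : RealIso φ) (γ : Function.fixedPoints σ → Matrix (Fin 3) (Fin 3) ℝ),
      (∀ (y : Function.fixedPoints σ) (p : TotalSpace ℂ L), p.1 = y → p.2 ≠ 0 →
        (γ y).map Complex.ofReal * coframeMat (b y p) (conjUnitSec φ b y p) = Ψ.mat p) →
      (Ψ.HasCanonicalDet ∧ Null γ ↔ Ψ₀.Homotopic Ψ) := by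
  obtain ⟨Ψ₀, hΨ₀, γ₀, hγ₀, hN⟩ := exists_realIso_extension hσ hσσ hq
    (hb.isFrameFamily φ continuous_subtype_val fun t => t.2)
    (hb.det_coframeMat_conj φ)
  refine ⟨Ψ₀, fun Ψ γ hγΨ => ⟨fun ⟨hd, hγ⟩ => ?_, fun hΨ => ?_⟩⟩
  · refine RealIso.homotopic_of_null hσ hσσ hq hΨ₀ hd (hγ.mul hγ₀.inv) fun y p hp hp0 => ?_
    rw [← hN y p hp hp0, ← hγΨ y p hp hp0, ← Matrix.mul_assoc, ← map_ofReal_mul,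
      Matrix.nonsing_inv_mul_cancel_right _ _ (hγ₀.det_ne_zero y).isUnit]
  · refine ⟨hΨ₀.of_homotopic hΨ, ?_⟩
    obtain ⟨δ, hδ, hδΨ⟩ := hΨ.exists_null
    refine (congrArg Null (funext fun y => ?_)).mp (hδ.mul hγ₀)
    have hp0 := baseVec_ne_zero (L := L) y.1
    refine eq_of_map_ofReal_mul_eq (P := coframeMat (b y ⟨y.1, baseVec L y.1⟩)
      (conjUnitSec φ b y ⟨y.1, baseVec L y.1⟩))
      (fun h => one_ne_zero ((hb.det_coframeMat_conj φ y _ rfl hp0).symm.trans h)) ?_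
    rw [hγΨ y ⟨y.1, baseVec L y.1⟩ rfl hp0, map_ofReal_mul, Matrix.mul_assoc,
      hN y ⟨y.1, baseVec L y.1⟩ rfl hp0, hδΨ y ⟨y.1, baseVec L y.1⟩ rfl hp0]

/-- Here the section is itself a real frame. Any other real frame differs from it by a real nowhere
zero function, which changes the trivialization by a null factor only. -/
theorem isStandardOnFixedLocus_iff
    (hb : IsUnitSec (Subtype.val : Function.fixedPoints σ → B) b)
    (s : φ.RealFrameAlong (Subtype.val : Function.fixedPoints σ → B))
    (hs : ∀ y, b y ⟨y.1, s.sec y⟩ = 1)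
    (him : ∀ (y : Function.fixedPoints σ) (p : TotalSpace ℂ L), p.1 = y → p.2 ≠ 0 →
      φ.tot p = p → (b y p).im = 0)
    (hγΨ : ∀ (y : Function.fixedPoints σ) (p : TotalSpace ℂ L), p.1 = y → p.2 ≠ 0 →
      (γ y).map Complex.ofReal * coframeMat (b y p) (conjUnitSec φ b y p) = Ψ.mat p) :
    Ψ.IsStandardOnFixedLocus ↔ Null γ := by
  have hmat : ∀ (s' : φ.RealFrameAlong (Subtype.val : Function.fixedPoints σ → B)) y,
      Ψ.matrix (s'.sec y) = (γ y * blk (Complex.normSq (b y ⟨y.1, s'.sec y⟩))⁻¹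
        (starRingEnd ℂ (b y ⟨y.1, s'.sec y⟩))).map Complex.ofReal := fun s' y => by
    have hr : φ.tot ⟨y.1, s'.sec y⟩ = ⟨y.1, s'.sec y⟩ := s'.isReal y
    have h1 := hγΨ y ⟨y.1, s'.sec y⟩ rfl (s'.ne_zero y)
    rw [conjUnitSec_of_real hr, coframeMat_self_conj, ← map_ofReal_mul] at h1
    exact h1.symm
  constructor
  · rintro ⟨s', H, hH0, hH1, hHΨ⟩
    have hz : Continuous fun y => b y ⟨y.1, s'.sec y⟩ :=
      hb.continuous_comp continuous_id s'.continuous_sec (fun _ => rfl) s'.ne_zero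
    have h1 := null_blk_of_real hz (fun y => hb.ne_zero y _ rfl (s'.ne_zero y))
      fun y => him y _ rfl (s'.ne_zero y) (s'.isReal y)
    have h2 : Null fun y => γ y * blk (Complex.normSq (b y ⟨y.1, s'.sec y⟩))⁻¹
        (starRingEnd ℂ (b y ⟨y.1, s'.sec y⟩)) :=
      ⟨H, hH0, hH1, fun y => map_ofReal_injective ((hHΨ y).trans (hmat s' y))⟩
    refine (congrArg Null (funext fun y => ?_)).mp (h2.mul h1.inv)
    exact Matrix.mul_nonsing_inv_cancel_right _ _ (h1.det_ne_zero y).isUnit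
  · rintro ⟨H, hH0, hH1, hHγ⟩
    refine ⟨s, H, hH0, hH1, fun y => ?_⟩
    rw [hmat s y, hs, hHγ, map_one, map_one, inv_one, blk_one, mul_one]

open Classical in
/-- The number of half-turns prescribed along the loops. -/
noncomputable def halfTurns {ι : Type*} (c : ι → C(Circle, Function.fixedPoints σ))
    (o : {i : ι // ¬ φ.OrientableOver (c i)} → ℤˣ) (i : ι) : ℤ :=
  if h : φ.OrientableOver (c i) then 0 else o ⟨i, h⟩

variable {ι : Type*} {c : ι → C(Circle, Function.fixedPoints σ)}
  {o : {i : ι // ¬ φ.OrientableOver (c i)} → ℤˣ} {u : C(Function.fixedPoints σ, Circle)}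

theorem halfTurns_of_orientableOver {i : ι} (h : φ.OrientableOver (c i)) :
    halfTurns c o i = 0 := dif_pos h

theorem halfTurns_of_not_orientableOver (i : {i : ι // ¬ φ.OrientableOver (c i)}) :
    halfTurns c o i.1 = o i := dif_neg i.2

theorem orientableOver_iff_even_halfTurns (i : ι) :
    φ.OrientableOver (c i) ↔ Even (halfTurns c o i) := by
  by_cases h : φ.OrientableOver (c i)
  · simp [halfTurns_of_orientableOver h, h]
  · rw [halfTurns_of_not_orientableOver ⟨i, h⟩]
    refine iff_of_false h ?_
    rcases Int.units_eq_one_or (o ⟨i, h⟩) with h1 | h1 <;> rw [h1] <;> decide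

theorem isCanonicalFor_iff_halfTurns : Ψ.IsCanonicalFor c o ↔
    Ψ.HasCanonicalDet ∧ ∀ i, Ψ.IsStandardAlong (c i) (halfTurns c o i) := by
  refine and_congr_right fun _ => ⟨fun ⟨h1, h2⟩ i => ?_, fun h => ⟨fun i hi => ?_, fun i => ?_⟩⟩
  · by_cases h : φ.OrientableOver (c i)
    · rw [halfTurns_of_orientableOver h]
      exact h1 i h
    · rw [halfTurns_of_not_orientableOver ⟨i, h⟩]
      exact h2 ⟨i, h⟩
  · rw [← halfTurns_of_orientableOver (o := o) hi]
    exact h i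
  · rw [← halfTurns_of_not_orientableOver i]
    exact h i.1

/-- Canonical determinant makes `det γ` positive, which is what testing `γ` along the basis of loops
requires. -/
theorem isCanonicalFor_iff [CompactSpace B] [T2Space B] {S : Type*} [TopologicalSpace S]
    [CompactSpace S] [T2Space S] {q : S → Function.fixedPoints σ} (hσ : Continuous σ)
    (hq : IsSpread ℝ q ∅) (hc : IsLoopBasis c)
    (hb : IsUnitSec (Subtype.val : Function.fixedPoints σ → B) b)
    (hu : ∀ t p, p.1 = t.1 → p.2 ≠ 0 → b t p = u t * conjUnitSec φ b t p)
    (hk : ∀ i, ContinuousMap.Homotopic (circlePow (halfTurns c o i)) (u.comp (c i)))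
    (hγ : Continuous γ) (hγ0 : ∀ y, (γ y).det ≠ 0)
    (hγΨ : ∀ (y : Function.fixedPoints σ) (p : TotalSpace ℂ L), p.1 = y → p.2 ≠ 0 →
      (γ y).map Complex.ofReal * coframeMat (b y p) (conjUnitSec φ b y p) = Ψ.mat p) :
    Ψ.IsCanonicalFor c o ↔ Ψ.HasCanonicalDet ∧ Null γ := by
  have : CompactSpace (Function.fixedPoints σ) :=
    isCompact_iff_compactSpace.1 (isClosed_fixedPoints' hσ).isCompact
  rw [isCanonicalFor_iff_halfTurns]
  refine and_congr_right fun hd => ?_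
  rw [forall_congr' fun i => isStandardAlong_iff hb hu (hk i) hγ hγ0 hγΨ]
  exact ⟨fun h => hc.null hq hγ (fun y => hd.det_pos hb hγΨ y) h, fun h i => h.comp (c i).continuous⟩

/-- The degrees of the phase of a section along a basis of loops can be prescribed within the
parities given by the orientability of the real part. -/
theorem exists_isUnitSec_halfTurns [CompactSpace B] [T2Space B] {S : Type*} [TopologicalSpace S]
    [CompactSpace S] [T2Space S] {q : S → Function.fixedPoints σ} (hσ : Continuous σ)
    (hq : IsSpread ℝ q ∅) (hc : IsLoopBasis c)
    (o : {i : ι // ¬ φ.OrientableOver (c i)} → ℤˣ) :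
    ∃ (b : Function.fixedPoints σ → TotalSpace ℂ L → ℂ) (u : C(Function.fixedPoints σ, Circle)),
      IsUnitSec (Subtype.val : Function.fixedPoints σ → B) b ∧
      (∀ t p, p.1 = t.1 → p.2 ≠ 0 → b t p = u t * conjUnitSec φ b t p) ∧
      ∀ i, ContinuousMap.Homotopic (circlePow (halfTurns c o i)) (u.comp (c i)) := by
  have : CompactSpace (Function.fixedPoints σ) :=
    isCompact_iff_compactSpace.1 (isClosed_fixedPoints' hσ).isCompact
  obtain ⟨b, hb⟩ := exists_isUnitSec (L := L) hq φ continuous_subtype_val fun t => t.2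
  obtain ⟨u, hu⟩ := hb.exists_phase φ continuous_subtype_val fun t => t.2
  choose d hd using fun i => exists_homotopic_circlePow (u.comp (c i))
  -- Both degrees have the parity dictated by orientability along the loop, so they differ by an
  -- even number.
  have hn : ∀ i, ∃ n, halfTurns c o i = d i + 2 * n := fun i => by
    have h1 := orientableOver_iff_even hb hu (hd i).symm
    obtain ⟨n, hn⟩ := Int.even_sub.2 ((orientableOver_iff_even_halfTurns (o := o) i).symm.trans h1)
    exact ⟨n, by omega⟩
  choose n hn using hn
  obtain ⟨g, hg⟩ := hc.1 n
  -- Multiplying the section by `g` divides its conjugate by `g`, so the phase gains `g²` and the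
  -- degrees change by `2 n`.
  refine ⟨fun t p => g t * b t p, g * g * u, hb.mul g, fun t p hp hp0 => ?_, fun i => ?_⟩
  · simp only [conjUnitSec, map_mul]
    have h1 := hu t p hp hp0
    rw [conjUnitSec] at h1
    have h2 : (g t : ℂ) * starRingEnd ℂ (g t) = 1 := by
      rw [Complex.mul_conj, Circle.normSq_coe, Complex.ofReal_one]
    conv_lhs => rw [h1]
    simp only [ContinuousMap.mul_apply, Circle.coe_mul]
    linear_combination (-(g t : ℂ) * u t * starRingEnd ℂ (b t (φ.tot p))) * h2
  · have h1 := homotopic_mul (homotopic_mul (hg i) (hg i)) (hd i)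
    have h2 : circlePow (n i) * circlePow (n i) * circlePow (d i) =
        circlePow (halfTurns c o i) := by
      ext z
      simp only [ContinuousMap.mul_apply, circlePow_apply, hn i]
      rw [← zpow_add, ← zpow_add]
      congr 2
      ring
    rw [h2] at h1
    exact h1.symm

end Classes

end RealPairs

open RealPairs in
theorem corollary3p3 {S : Type*} [TopologicalSpace S] [T2Space S] [CompactSpace S]
    [ChartedSpace (EuclideanSpace ℝ (Fin 2)) S] [IsManifold (𝓡 2) ∞ S]
    (X : RealPairs.SymmetricSurface S) [ConnectedSpace X.Carrier]
    {L : X.Carrier → Type*} [∀ x, AddCommGroup (L x)] [∀ x, Module ℂ (L x)]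
    [∀ x, TopologicalSpace (L x)] [TopologicalSpace (TotalSpace ℂ L)]
    [FiberBundle ℂ L] [VectorBundle ℂ ℂ L]
    (φ : RealPairs.Conjugation X.conj L) :
    -- the real part is orientable: the canonical isomorphisms form one homotopy class
    (φ.RealPartOrientableAlong (Subtype.val : Function.fixedPoints X.conj → X.Carrier) →
      ∃ Ψ₀ : RealPairs.RealIso φ, ∀ Ψ : RealPairs.RealIso φ, Ψ.IsCanonical ↔ Ψ₀.Homotopic Ψ) ∧
    -- in general, so do those determined by the orientations of the non-orientable loops
    (∀ {ι : Type*} (c : ι → C(Circle, Function.fixedPoints X.conj)), RealPairs.IsLoopBasis c →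
      ∀ o : {i : ι // ¬ φ.OrientableOver (c i)} → ℤˣ,
        (∃ Ψ₀ : RealPairs.RealIso φ, ∀ Ψ : RealPairs.RealIso φ,
          Ψ.IsCanonicalFor c o ↔ Ψ₀.Homotopic Ψ) ∧
        -- if the real part is orientable, this is the canonical class above
        (φ.RealPartOrientableAlong (Subtype.val : Function.fixedPoints X.conj → X.Carrier) →
          ∀ Ψ : RealPairs.RealIso φ, Ψ.IsCanonicalFor c o ↔ Ψ.IsCanonical)) := by
  have hσ := X.continuous_conj
  refine ⟨fun h => ?_, fun {ι} c hc o => ⟨?_, fun h Ψ => ?_⟩⟩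
  · obtain ⟨s⟩ := h.exists_frame
    obtain ⟨b, hb, hs, him⟩ := s.exists_isUnitSec
    obtain ⟨Ψ₀, hΨ₀⟩ := exists_homotopy_class (φ := φ) hσ X.conj_involutive (X.isSpread _) hb
    refine ⟨Ψ₀, fun Ψ => ?_⟩
    obtain ⟨γ, -, hγΨ⟩ := Ψ.exists_coframe_quotient hb
    rw [← hΨ₀ Ψ γ hγΨ]
    exact and_congr_right fun _ => isStandardOnFixedLocus_iff hb s hs him hγΨ
  · obtain ⟨b, u, hb, hu, hk⟩ := exists_isUnitSec_halfTurns hσ X.isSpread_realMk hc o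
    obtain ⟨Ψ₀, hΨ₀⟩ := exists_homotopy_class (φ := φ) hσ X.conj_involutive (X.isSpread _) hb
    refine ⟨Ψ₀, fun Ψ => ?_⟩
    obtain ⟨γ, hγ0, hγΨ⟩ := Ψ.exists_coframe_quotient hb
    rw [← hΨ₀ Ψ γ hγΨ]
    exact isCanonicalFor_iff hσ X.isSpread_realMk hc hb hu hk γ.continuous hγ0 hγΨ
  · obtain ⟨s⟩ := h.exists_frame
    obtain ⟨b, hb, hs, him⟩ := s.exists_isUnitSec
    obtain ⟨u, hu⟩ := hb.exists_phase φ continuous_subtype_val fun t => t.2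
    obtain ⟨γ, hγ0, hγΨ⟩ := Ψ.exists_coframe_quotient hb
    -- The section is real and so has phase `1`, of degree zero along every loop. This matches the
    -- prescribed half-turns, all loops being orientable, and one section serves both conditions.
    have hu1 : ∀ t, u t = 1 := fun t => by
      have hr : φ.tot ⟨t.1, s.sec t⟩ = ⟨t.1, s.sec t⟩ := s.isReal t
      have h1 := hu t ⟨t.1, s.sec t⟩ rfl (s.ne_zero t)
      rw [conjUnitSec_of_real hr, hs, map_one, mul_one] at h1
      exact Circle.ext h1.symm
    have hk : ∀ i, ContinuousMap.Homotopic (circlePow (halfTurns c o i)) (u.comp (c i)) :=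
      fun i => by
        have h1 : circlePow (halfTurns c o i) = u.comp (c i) := by
          ext z
          rw [halfTurns_of_orientableOver (h.comp (c i).continuous), circlePow_apply, zpow_zero,
            ContinuousMap.comp_apply, hu1]
        rw [h1]
    rw [isCanonicalFor_iff hσ X.isSpread_realMk hc hb hu hk γ.continuous hγ0 hγΨ]
    exact and_congr_right fun _ => (isStandardOnFixedLocus_iff hb s hs him hγΨ).symm
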